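/- **Setting.** Let $d,n\ge1$, let $\Sigma\in\mathbb R^{d\times d}$ be symmetric positive definite with eigenvalues $\sigma_1^2\ge\dots\ge\sigma_d^2>0$, and let $d_{\rm eff}(r)=\sum_{i=1}^d(\sigma_i/\sigma_1)^{2/r}$. Let $a_1,\dots,a_n$ be independent random vectors in $\mathbb R^d$ that are $\Sigma$-subgaussian, i.e. $\mathbb P(|a_i^\top x|>t)\le 2\exp\left(-\frac{t^2}{2x^\top\Sigma x}\right)$ for all $t>0$, $\|x\|\le 1$. Let $f(x)=\frac1n\sum_{i=1}^n\ell_i(a_i^\top x)$ with $\ell_i:\mathbb R\to\mathbb R$ convex and $L$-Lipschitz ($L>0$), let $\psi$ be convex with domain ${\rm Dom}_\psi\subset\mathcal B(0,R)$ ($R>0$), let $x^*$ minimize $f+\psi$ over ${\rm Dom}_\psi$, and let $L_0>0$ be a Lipschitz constant of each of the functions $x\mapsto\ell_i(a_i^\top x)$. **Algorithm** (accelerated stochastic dual averaging with smoothing distribution $\mu=\mathcal N(0,\sqrt\Sigma)$ and $m\ge1$ samples per step). Put $\theta_0=1$, $\theta_{t+1}=2/(1+\sqrt{1+4/\theta_t^2})$,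 $x_0=z_0=0$. For $t\ge0$: set $y_t=(1-\theta_t)x_t+\theta_tz_t$; draw i.i.d. $Z_{1,t},\dots,Z_{m,t}\sim\mu$ and, independently, i.i.d. uniform indices $I_{1,t},\dots,I_{m,t}\in\{1,\dots,n\}$, all draws being independent over $t$; take subgradients $g_{j,t}$ of $x\mapsto \ell_{I_{j,t}}(a_{I_{j,t}}^\top x)$ at $y_t+u_tZ_{j,t}$ and $g_t=\frac1m\sum_jg_{j,t}$; set $$z_{t+1}=\operatorname*{arg\,min}_{x\in{\rm Dom}_\psi}\Big\{\sum_{\tau=0}^t\tfrac1{\theta_\tau}\langle g_\tau,x\rangle+\sum_{\tau=0}^t\tfrac1{\theta_\tau}\psi(x)+\tfrac12\Big(L_{t+1}+\tfrac{\eta_{t+1}}{\theta_{t+1}}\Big)\|x\|^2\Big\},\qquad x_{t+1}=(1-\theta_t)x_t+\theta_tz_{t+1}.$$ **Step sizes.** For $\delta\in(0,1)$ put $\kappa=1+\sqrt{\frac{d_{\rm eff}(1)\ln d+\ln(\delta^{-1})}{n}}$ and $\Lambda=\ln(e\,d/\delta)$. With numerical constants $c>0$, $p\in\mathbb N$, take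 $u_t=\theta_tu$, $L_t=L_1/u_t$ and $\eta_t=\frac{L_0\sqrt{t+1}}{R\sqrt m}$, where $$u=\frac{R\sqrt{d_{\rm eff}(2)\,\kappa}}{\sigma_1^{1/2}d_{\rm eff}(1)^{3/4}},\qquad L_1=c\Lambda^{p}\,L\,\sigma_1^{1/2}\,\frac{d_{\rm eff}(2)}{d_{\rm eff}(1)}\,\kappa .$$ **Statement.** The numerical constants $c,C>0$ and $p\in\mathbb N$ can be chosen so that for all $d,n,\Sigma$, all laws of the $a_i$ as above and all $\delta\in(0,1)$ the following holds. With probability at least $1-\delta$ over the data $a_1,\dots,a_n$, simultaneously for all $L,R,(\ell_i),\psi,x^*,L_0,m$ as above and all $T\ge1$, the random variable $f(x_T)+\psi(x_T)$ is integrable and, the expectation being over the randomness of the algorithm conditionally on the data, $$\mathbb E\big[f(x_T)+\psi(x_T)-f(x^*)-\psi(x^*)\big]\le C\,\Lambda^{p}\sqrt{\kappa}\;\frac{LR\,\sigma_1\sqrt{d_{\rm eff}(2)/\sqrt{d_{\rm eff}(1)}}}{T}+\frac{5L_0R}{\sqrt{Tm}} .$$ In particular, when $n\ge d_{\rm eff}(1)\ln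 d+\ln(\delta^{-1})$ one has $\kappa\le2$, and the first term is $\tilde O\big(LR\sigma_1\sqrt{d_{\rm eff}(2)/\sqrt{d_{\rm eff}(1)}}/T\big)$, where $\tilde O$ hides only logarithmic factors in $d$ and $\delta^{-1}$. -/

import Mathlib

open MeasureTheory ProbabilityTheory
open scoped RealInnerProductSpace MatrixOrder

noncomputable section

namespace NonIsoSmoothing

/-- The Euclidean space `ℝ^d`. -/
abbrev Vec (d : ℕ) : Type := EuclideanSpace ℝ (Fin d)

/-- A random vector `a` is `S`-subgaussian: for all `t > 0` and all `x` in the unit ball,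
`P(|aᵀx| > t) ≤ 2 exp(-t² / (2 xᵀSx))`. -/
def IsSubgaussianVec {d : ℕ} {Ω : Type*} [MeasurableSpace Ω] (P : Measure Ω)
    (S : Matrix (Fin d) (Fin d) ℝ) (a : Ω → Vec d) : Prop :=
  ∀ t : ℝ, 0 < t → ∀ x : Vec d, ‖x‖ ≤ 1 →
    P.real {ω | t < |⟪a ω, x⟫|} ≤
      2 * Real.exp (-(1 / 2) * (t ^ 2 / dotProduct x.ofLp (S.mulVec x.ofLp)))

/-- `σ₁²`, the largest eigenvalue of the Hermitian matrix `S`. -/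
def topEig {d : ℕ} {S : Matrix (Fin d) (Fin d) ℝ} (hS : S.IsHermitian) : ℝ :=
  ⨆ i, hS.eigenvalues i

/-- `σ₁`, the square root of the largest eigenvalue of `S`. -/
def sigmaOne {d : ℕ} {S : Matrix (Fin d) (Fin d) ℝ} (hS : S.IsHermitian) : ℝ :=
  √(topEig hS)

/-- The effective dimension `d_eff(r) = ∑ i, (σ_i / σ₁)^(2/r)`, where the `σ_i²` are the
eigenvalues of `S`. -/
def effDim {d : ℕ} {S : Matrix (Fin d) (Fin d) ℝ} (hS : S.IsHermitian) (r : ℕ) : ℝ :=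
  ∑ i, (√(hS.eigenvalues i) / sigmaOne hS) ^ (2 / (r : ℝ))

/-- `g` is a subgradient of `F` at `x`. -/
def IsSubgradient {d : ℕ} (F : Vec d → ℝ) (x g : Vec d) : Prop :=
  ∀ y, F x + ⟪g, y - x⟫ ≤ F y

/-- The individual loss `F(x, i) = ℓ_i(a_iᵀ x)` of a linear model. -/
def linLoss {d n : ℕ} (loss : Fin n → ℝ → ℝ) (a : Fin n → Vec d) (i : Fin n) (x : Vec d) : ℝ :=
  loss i ⟪a i, x⟫

/-- The empirical risk `f(x) = (1/n) ∑ i, ℓ_i(a_iᵀ x)`. -/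
def empRisk {d n : ℕ} (loss : Fin n → ℝ → ℝ) (a : Fin n → Vec d) (x : Vec d) : ℝ :=
  (1 / (n : ℝ)) * ∑ i, linLoss loss a i x

/-- The momentum sequence `θ_0 = 1`, `θ_{t+1} = 2 / (1 + √(1 + 4 / θ_t²))`. -/
def theta : ℕ → ℝ
  | 0 => 1
  | t + 1 => 2 / (1 + √(1 + 4 / theta t ^ 2))

/-- The sampling factor `1 + √((d_eff(1) ln d + ln(1/δ)) / n)`. -/
def sampleFactor {d : ℕ} {S : Matrix (Fin d) (Fin d) ℝ} (hS : S.IsHermitian) (n : ℕ) (δ : ℝ) : ℝ :=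
  1 + √((effDim hS 1 * Real.log d + Real.log (1 / δ)) / n)

/-- The logarithmic factor `ln(e d / δ) = 1 + ln d + ln(1/δ)`. -/
def logFactor (d : ℕ) (δ : ℝ) : ℝ :=
  1 + Real.log d + Real.log (1 / δ)

/-- The smoothing radius `u = R √(d_eff(2) κ) / (√σ₁ d_eff(1)^(3/4))`, where `κ` is the sampling
factor. -/
def radius {d : ℕ} {S : Matrix (Fin d) (Fin d) ℝ} (hS : S.IsHermitian) (n : ℕ) (δ R : ℝ) : ℝ :=
  R * √(effDim hS 2 * sampleFactor hS n δ) / (√(sigmaOne hS) * effDim hS 1 ^ (3 / 4 : ℝ))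

/-- The smoothness parameter `L₁ = B L √σ₁ (d_eff(2) / d_eff(1)) κ`, where `κ` is the sampling
factor and `B` a numerical factor. -/
def modulus {d : ℕ} {S : Matrix (Fin d) (Fin d) ℝ} (hS : S.IsHermitian) (n : ℕ)
    (δ L B : ℝ) : ℝ :=
  B * L * √(sigmaOne hS) * (effDim hS 2 / effDim hS 1) * sampleFactor hS n δ

/-- A run, on the probability space `(Ω, P)`, of accelerated stochastic dual averaging with
randomized smoothing for the objective `(1/n) ∑ i, F i + ψ` over `D = Dom ψ`: the smoothing
distribution is `μ`, each iteration uses `m` stochastic subgradients, and the step-size sequences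
are `θ` (see `theta`), the smoothing radii `u`, and `L`, `η`. -/
structure Run {d n : ℕ} (μ : Measure (Vec d)) (F : Fin n → Vec d → ℝ) (D : Set (Vec d))
    (ψ : Vec d → ℝ) (m : ℕ) (u L η : ℕ → ℝ)
    {Ω : Type*} [MeasurableSpace Ω] (P : Measure Ω) where
  /-- the three sequences of iterates -/
  x : ℕ → Ω → Vec d
  y : ℕ → Ω → Vec d
  z : ℕ → Ω → Vec d
  /-- the smoothing perturbations -/
  Z : ℕ → Fin m → Ω → Vec d
  /-- the indices of the sampled individual losses -/
  idx : ℕ → Fin m → Ω → Fin n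
  /-- the stochastic subgradients -/
  g : ℕ → Fin m → Ω → Vec d
  Z_measurable : ∀ t i, Measurable (Z t i)
  idx_measurable : ∀ t i, Measurable (idx t i)
  g_measurable : ∀ t i, Measurable (g t i)
  /-- `Z t i` has law `μ`, `idx t i` is uniform, and the two are independent -/
  law : ∀ t i, P.map (fun ω => (Z t i ω, idx t i ω)) = μ.prod (uniformOn Set.univ)
  /-- all the draws are independent -/
  indep : iIndepFun (fun (p : ℕ × Fin m) ω => (Z p.1 p.2 ω, idx p.1 p.2 ω)) P
  x_zero : ∀ ω, x 0 ω = 0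
  z_zero : ∀ ω, z 0 ω = 0
  y_eq : ∀ t ω, y t ω = (1 - theta t) • x t ω + theta t • z t ω
  oracle : ∀ t i ω, IsSubgradient (F (idx t i ω)) (y t ω + u t • Z t i ω) (g t i ω)
  z_mem : ∀ t ω, z (t + 1) ω ∈ D
  /-- `z (t+1)` minimizes the dual-averaging objective over `D`, with the averaged subgradients
  `(1/m) ∑ i, g τ i` -/
  z_min : ∀ t ω, IsMinOn (fun v : Vec d =>
      ∑ τ ∈ Finset.range (t + 1), (1 / theta τ) * ⟪(1 / (m : ℝ)) • ∑ i, g τ i ω, v⟫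
        + (∑ τ ∈ Finset.range (t + 1), 1 / theta τ) * ψ v
        + (1 / 2) * (L (t + 1) + η (t + 1) / theta (t + 1)) * ‖v‖ ^ 2) D (z (t + 1) ω)
  x_eq : ∀ t ω, x (t + 1) ω = (1 - theta t) • x t ω + theta t • z (t + 1) ω

end NonIsoSmoothing

end

/-!
Averaging a convex `K`-Lipschitz function on the line against a centred Gaussian of variance `v`
makes it smooth with a constant of order `K / √v`. For the `i`-th loss, smoothed at radius `u` by
`N(0, √Σ)`, the variance is `u² aᵢᵀ√Σaᵢ`. Hence the smoothed risk exceeds the risk by at most `u L`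
times the average of `√(aᵢᵀ√Σaᵢ)`, while its curvature in a direction `h` is of order `L / u` times
the average of `⟨aᵢ, h⟩² / √(aᵢᵀ√Σaᵢ)`. Accelerated dual averaging along the decreasing radii
`u θ_t` turns a bound for each of these two averages, together with the variance of the sampled
gradients, into a convergence rate.

The delicate average is the normalized quadratic form. Split the eigenbasis of `Σ` into about
`log₂ d` dyadic blocks according to the size of `σ_j`, with spectral projections `P`. On a block, a
factor of `⟨P aᵢ, h⟩²` is absorbed by `√(aᵢᵀ√Σaᵢ)`, and the remaining sum `∑ᵢ |⟨P aᵢ, h⟩|` is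
`⟨∑ᵢ εᵢ P aᵢ, h⟩` for suitable signs `ε`. So it suffices to bound the norms of the block projections
of all signed sums of the data: a subgaussian tail bound for each, and a union bound over the `2ⁿ`
choices of signs, whose cost in the exponent is only of order `n`. The eigenvalues below the last
block are so small that the Cauchy–Schwarz inequality disposes of them.
-/

namespace NonIsoSmoothing

open scoped ENNReal NNReal MeasureTheory

/-! ### The momentum sequence -/

lemma theta_pos (t : ℕ) : 0 < theta t := by
  cases t with
  | zero => simp [theta]
  | succ t => simp only [theta]; positivity

lemma one_div_theta_pos (t : ℕ) : 0 < 1 / theta t := one_div_pos.2 (theta_pos t)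

lemma one_div_theta_succ (t : ℕ) :
    1 / theta (t + 1) = (1 + √(1 + 4 * (1 / theta t) ^ 2)) / 2 := by
  simp only [theta]
  rw [one_div_div, one_div_pow, mul_one_div]

lemma one_div_theta_sq_succ (t : ℕ) :
    (1 / theta (t + 1)) ^ 2 = (1 / theta t) ^ 2 + 1 / theta (t + 1) := by
  have hsq : √(1 + 4 * (1 / theta t) ^ 2) ^ 2 = 1 + 4 * (1 / theta t) ^ 2 :=
    Real.sq_sqrt (by positivity)
  rw [one_div_theta_succ]
  linear_combination hsq / 4

lemma one_div_theta_sq_succ_mul (t : ℕ) :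
    (1 / theta (t + 1)) ^ 2 * (1 - theta (t + 1)) = (1 / theta t) ^ 2 := by
  have hcancel : (1 / theta (t + 1)) ^ 2 * theta (t + 1) = 1 / theta (t + 1) := by
    field_simp [(theta_pos (t + 1)).ne']
  linear_combination one_div_theta_sq_succ t - hcancel

lemma sum_one_div_theta (t : ℕ) :
    ∑ τ ∈ Finset.range (t + 1), 1 / theta τ = (1 / theta t) ^ 2 := by
  induction t with
  | zero => simp [theta]
  | succ t ih => rw [Finset.sum_range_succ, ih, one_div_theta_sq_succ]

lemma one_div_theta_succ_le (t : ℕ) : 1 / theta (t + 1) ≤ 1 / theta t + 1 := by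
  have hpos := one_div_theta_pos t
  have hsqrt : √(1 + 4 * (1 / theta t) ^ 2) ≤ 1 + 2 * (1 / theta t) :=
    Real.sqrt_le_iff.2 ⟨by positivity, by nlinarith⟩
  rw [one_div_theta_succ]
  linarith

lemma one_div_theta_add_half_le (t : ℕ) : 1 / theta t + 1 / 2 ≤ 1 / theta (t + 1) := by
  have hsqrt : 2 * (1 / theta t) ≤ √(1 + 4 * (1 / theta t) ^ 2) :=
    Real.le_sqrt_of_sq_le (by linarith)
  rw [one_div_theta_succ]
  linarith

lemma one_div_theta_le (t : ℕ) : 1 / theta t ≤ t + 1 := by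
  induction t with
  | zero => simp [theta]
  | succ t ih =>
    push_cast
    linarith [one_div_theta_succ_le t]

lemma le_one_div_theta (t : ℕ) : ((t : ℝ) + 2) / 2 ≤ 1 / theta t := by
  induction t with
  | zero => simp [theta]
  | succ t ih =>
    push_cast
    linarith [one_div_theta_add_half_le t]

lemma one_div_theta_monotone : Monotone fun t => 1 / theta t :=
  monotone_nat_of_le_succ fun t => by linarith [one_div_theta_add_half_le t]

lemma theta_antitone : Antitone theta := fun _ t h =>
  (one_div_le_one_div (theta_pos _) (theta_pos t)).1 (one_div_theta_monotone h)

lemma theta_le_one (t : ℕ) : theta t ≤ 1 := theta_antitone (Nat.zero_le t)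

/-! ### Gaussian averages of convex Lipschitz functions on the line -/

section GaussianAverage

variable {f : ℝ → ℝ} {K : ℝ≥0}

lemma intervalIntegral_sub_comp_sub_le {g : ℝ → ℝ} (hg : Continuous g) {C : ℝ}
    (hC : ∀ x, |g x| ≤ C) (a b h : ℝ) :
    ∫ x in a..b, (g x - g (x - h)) ≤ 2 * (C * |h|) := by
  have hint : ∀ r s, IntervalIntegrable g volume r s := hg.intervalIntegrable
  have hend : ∀ r, |∫ x in r..r - h, g x| ≤ C * |h| := fun r => by
    simpa using intervalIntegral.norm_integral_le_of_norm_le_const (f := g) (a := r)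
      (b := r - h) fun x _ => hC x
  calc ∫ x in a..b, (g x - g (x - h))
      = (∫ x in a..b, g x) - ∫ x in a - h..b - h, g x := by
        rw [intervalIntegral.integral_sub (hint a b)
          ((by fun_prop : Continuous fun x => g (x - h)).intervalIntegrable a b),
          intervalIntegral.integral_comp_sub_right]
    _ = (∫ x in a..a - h, g x) - ∫ x in b..b - h, g x :=
        intervalIntegral.integral_interval_sub_interval_comm (hint _ _) (hint _ _) (hint _ _)
    _ ≤ 2 * (C * |h|) := by linarith [abs_le.1 (hend a), abs_le.1 (hend b)]

lemma convexOn_univ_second_difference_nonneg (hc : ConvexOn ℝ Set.univ f) (x h : ℝ) :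
    0 ≤ f (x + h) + f (x - h) - 2 * f x := by
  have hmid := hc.2 (Set.mem_univ (x + h)) (Set.mem_univ (x - h))
    (by norm_num : (0 : ℝ) ≤ 1 / 2) (by norm_num : (0 : ℝ) ≤ 1 / 2) (by norm_num)
  simp only [smul_eq_mul] at hmid
  rw [show 1 / 2 * (x + h) + 1 / 2 * (x - h) = x by ring] at hmid
  linarith

/-- The second difference telescopes, so its integral over `(-M, M]` only sees the endpoints: this
is where smoothness of the Gaussian average comes from, with no curvature of `f` itself. -/
lemma lintegral_second_difference_le (hf : LipschitzWith K f) (hc : ConvexOn ℝ Set.univ f)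
    (h : ℝ) :
    ∫⁻ x, ENNReal.ofReal (f (x + h) + f (x - h) - 2 * f x) ≤
      ENNReal.ofReal (2 * K * h ^ 2) := by
  have hfc := hf.continuous
  have hcont : Continuous fun x => f (x + h) + f (x - h) - 2 * f x := by fun_prop
  have hcover : AECover (volume : Measure ℝ) Filter.atTop fun M : ℝ => Set.Ioc (-M) M :=
    aecover_Ioc Filter.tendsto_neg_atTop_atBot Filter.tendsto_id
  refine le_of_tendsto (hcover.lintegral_tendsto_of_countably_generated
    hcont.measurable.ennreal_ofReal.aemeasurable) (Filter.eventually_atTop.2 ⟨0, fun M hM => ?_⟩)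
  rw [← ofReal_integral_eq_lintegral_ofReal hcont.integrableOn_Ioc
    (ae_of_all _ fun x => convexOn_univ_second_difference_nonneg hc x h),
    ← intervalIntegral.integral_of_le (by linarith)]
  refine ENNReal.ofReal_le_ofReal ?_
  have hdiff : ∀ x, |f (x + h) - f x| ≤ K * |h| := fun x => by
    simpa [Real.dist_eq] using hf.dist_le_mul (x + h) x
  have htele := intervalIntegral_sub_comp_sub_le (by fun_prop : Continuous fun x => f (x + h) - f x)
    hdiff (-M) M h
  calc ∫ x in -M..M, (f (x + h) + f (x - h) - 2 * f x)
      = ∫ x in -M..M, (f (x + h) - f x - (f (x - h + h) - f (x - h))) := by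
        congr 1 with x
        rw [sub_add_cancel]
        ring
    _ ≤ 2 * (K * |h| * |h|) := htele
    _ = 2 * K * h ^ 2 := by rw [mul_assoc (K : ℝ), abs_mul_abs_self]; ring

lemma gaussianPDF_le {v : ℝ≥0} (hv : v ≠ 0) (m x : ℝ) :
    gaussianPDF m v x ≤ ENNReal.ofReal (1 / √v) := by
  have hv' : (0 : ℝ) < v := by positivity
  have hexp : Real.exp (-(x - m) ^ 2 / (2 * v)) ≤ 1 := by
    rw [Real.exp_le_one_iff, neg_div]
    exact neg_nonpos.2 (by positivity)
  have hsqrt : √(v : ℝ) ≤ √(2 * Real.pi * v) :=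
    Real.sqrt_le_sqrt (by nlinarith [Real.pi_gt_three])
  refine ENNReal.ofReal_le_ofReal ?_
  rw [gaussianPDFReal, one_div]
  exact (mul_le_of_le_one_right (by positivity) hexp).trans (inv_anti₀ (by positivity) hsqrt)

lemma lintegral_gaussianReal_le {v : ℝ≥0} (hv : v ≠ 0) (m : ℝ) {g : ℝ → ℝ≥0∞}
    (hg : Measurable g) :
    ∫⁻ x, g x ∂(gaussianReal m v) ≤ ENNReal.ofReal (1 / √v) * ∫⁻ x, g x := by
  rw [gaussianReal_of_var_ne_zero m hv, lintegral_withDensity_eq_lintegral_mul _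
    (measurable_gaussianPDF m v) hg, ← lintegral_const_mul _ hg]
  exact lintegral_mono fun x => mul_le_mul_left (gaussianPDF_le hv m x) _

lemma ae_gaussianReal_differentiableAt (hf : LipschitzWith K f) {v : ℝ≥0} (hv : v ≠ 0) (m : ℝ) :
    ∀ᵐ x ∂(gaussianReal m v), DifferentiableAt ℝ f x :=
  (gaussianReal_absolutelyContinuous m hv).ae_le hf.ae_differentiableAt_real

lemma abs_deriv_le_of_lipschitzWith (hf : LipschitzWith K f) (x : ℝ) : |deriv f x| ≤ K :=
  norm_deriv_le_of_lipschitz hf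

lemma convexOn_univ_add_deriv_mul_le (hc : ConvexOn ℝ Set.univ f) {x : ℝ}
    (hx : DifferentiableAt ℝ f x) (h : ℝ) : f x + deriv f x * h ≤ f (x + h) := by
  rcases lt_trichotomy h 0 with hneg | rfl | hpos
  · have hslope := hc.slope_le_deriv (Set.mem_univ (x + h)) (Set.mem_univ x) (by linarith) hx
    rw [slope_def_field, sub_add_cancel_left, div_neg, ← neg_div, neg_sub,
      div_le_iff_of_neg hneg] at hslope
    linarith
  · simp
  · have hslope := hc.deriv_le_slope (Set.mem_univ x) (Set.mem_univ (x + h)) (by linarith) hx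
    rw [slope_def_field, add_sub_cancel_left, le_div_iff₀ hpos] at hslope
    linarith

lemma integrable_of_lipschitzWith {μ : Measure ℝ} [IsFiniteMeasure μ] (hμ : Integrable id μ)
    (hf : LipschitzWith K f) : Integrable f μ := by
  refine ((hμ.norm.const_mul (K : ℝ)).add (integrable_const |f 0|)).mono'
    hf.continuous.aestronglyMeasurable (ae_of_all _ fun x => ?_)
  have hdist := hf.dist_le_mul x 0
  simp only [Real.dist_eq, sub_zero] at hdist
  simp only [Real.norm_eq_abs, Pi.add_apply, id]
  linarith [abs_sub_abs_le_abs_sub (f x) (f 0)]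

lemma integrable_gaussianReal_of_lipschitzWith (hf : LipschitzWith K f) (m : ℝ) (v : ℝ≥0) :
    Integrable f (gaussianReal m v) :=
  integrable_of_lipschitzWith ((memLp_id_gaussianReal 1).integrable le_rfl) hf

lemma integrable_deriv_of_lipschitzWith {μ : Measure ℝ} [IsFiniteMeasure μ]
    (hf : LipschitzWith K f) : Integrable (deriv f) μ :=
  Integrable.of_bound (measurable_deriv f).aestronglyMeasurable K
    (ae_of_all _ fun x => abs_deriv_le_of_lipschitzWith hf x)

lemma integral_gaussianReal_add_mean (g : ℝ → ℝ) (m h : ℝ) (v : ℝ≥0) :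
    ∫ x, g x ∂(gaussianReal (m + h) v) = ∫ x, g (x + h) ∂(gaussianReal m v) := by
  rw [← gaussianReal_map_add_const, (measurableEmbedding_addRight h).integral_map]

lemma integral_bregman_gaussianReal_eq (hf : LipschitzWith K f) (m h : ℝ) (v : ℝ≥0) :
    ∫ x, (f (x + h) - f x - deriv f x * h) ∂(gaussianReal m v)
      = ∫ x, f x ∂(gaussianReal (m + h) v) - ∫ x, f x ∂(gaussianReal m v)
        - (∫ x, deriv f x ∂(gaussianReal m v)) * h := by
  have hshift : Integrable (fun x => f (x + h)) (gaussianReal m v) :=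
    integrable_gaussianReal_of_lipschitzWith
      (hf.comp (LipschitzWith.id.add (LipschitzWith.const h))) m v
  have hfi := integrable_gaussianReal_of_lipschitzWith hf m v
  rw [integral_sub (f := fun x => f (x + h) - f x) (hshift.sub hfi)
      ((integrable_deriv_of_lipschitzWith hf).mul_const h),
    integral_sub hshift hfi, integral_mul_const, integral_gaussianReal_add_mean]

lemma integral_gaussianReal_add_deriv_mul_le (hf : LipschitzWith K f)
    (hc : ConvexOn ℝ Set.univ f) {v : ℝ≥0} (hv : v ≠ 0) (m h : ℝ) :
    ∫ x, f x ∂(gaussianReal m v) + (∫ x, deriv f x ∂(gaussianReal m v)) * h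
      ≤ ∫ x, f x ∂(gaussianReal (m + h) v) := by
  have hnonneg : 0 ≤ ∫ x, (f (x + h) - f x - deriv f x * h) ∂(gaussianReal m v) := by
    refine integral_nonneg_of_ae ?_
    filter_upwards [ae_gaussianReal_differentiableAt hf hv m] with x hx
    simp only [Pi.zero_apply]
    linarith [convexOn_univ_add_deriv_mul_le hc hx h]
  rw [integral_bregman_gaussianReal_eq hf] at hnonneg
  linarith

lemma integral_gaussianReal_le_quadratic (hf : LipschitzWith K f)
    (hc : ConvexOn ℝ Set.univ f) {v : ℝ≥0} (hv : v ≠ 0) (m h : ℝ) :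
    ∫ x, f x ∂(gaussianReal (m + h) v)
      ≤ ∫ x, f x ∂(gaussianReal m v) + (∫ x, deriv f x ∂(gaussianReal m v)) * h
        + 2 * K / √v * h ^ 2 := by
  have hfc := hf.continuous
  have hsecond : Continuous fun x => f (x + h) + f (x - h) - 2 * f x := by fun_prop
  have hdiff := ae_gaussianReal_differentiableAt hf hv m
  have hbregman_nonneg : 0 ≤ᵐ[gaussianReal m v] fun x => f (x + h) - f x - deriv f x * h := by
    filter_upwards [hdiff] with x hx
    simp only [Pi.zero_apply]
    linarith [convexOn_univ_add_deriv_mul_le hc hx h]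
  have hmeas : Measurable fun x => f (x + h) - f x - deriv f x * h :=
    ((by fun_prop : Continuous fun x => f (x + h) - f x).measurable).sub
      ((measurable_deriv f).mul_const h)
  have hbound : ∫ x, (f (x + h) - f x - deriv f x * h) ∂(gaussianReal m v)
      ≤ 2 * K / √v * h ^ 2 := by
    rw [integral_eq_lintegral_of_nonneg_ae hbregman_nonneg hmeas.aestronglyMeasurable]
    refine ENNReal.toReal_le_of_le_ofReal (by positivity) ?_
    calc ∫⁻ x, ENNReal.ofReal (f (x + h) - f x - deriv f x * h) ∂(gaussianReal m v)
        ≤ ∫⁻ x, ENNReal.ofReal (f (x + h) + f (x - h) - 2 * f x) ∂(gaussianReal m v) := by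
          refine lintegral_mono_ae ?_
          filter_upwards [hdiff] with x hx
          have hneg := convexOn_univ_add_deriv_mul_le hc hx (-h)
          rw [← sub_eq_add_neg] at hneg
          exact ENNReal.ofReal_le_ofReal (by linarith)
      _ ≤ ENNReal.ofReal (1 / √v) * ∫⁻ x, ENNReal.ofReal (f (x + h) + f (x - h) - 2 * f x) :=
          lintegral_gaussianReal_le hv m hsecond.measurable.ennreal_ofReal
      _ ≤ ENNReal.ofReal (1 / √v) * ENNReal.ofReal (2 * K * h ^ 2) := by
          gcongr
          exact lintegral_second_difference_le hf hc h
      _ = ENNReal.ofReal (2 * K / √v * h ^ 2) := by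
          rw [← ENNReal.ofReal_mul (by positivity)]
          congr 1
          ring
  rw [integral_bregman_gaussianReal_eq hf] at hbound
  linarith

lemma integral_gaussianReal_mono_variance (hf : LipschitzWith K f) (hc : ConvexOn ℝ Set.univ f)
    (m : ℝ) {v v' : ℝ≥0} (hvv : v ≤ v') :
    ∫ x, f x ∂(gaussianReal m v) ≤ ∫ x, f x ∂(gaussianReal m v') := by
  obtain ⟨w, rfl⟩ := exists_add_of_le hvv
  have hconv : gaussianReal m (v + w) = gaussianReal m v ∗ gaussianReal 0 w := by
    rw [gaussianReal_conv_gaussianReal, add_zero]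
  have hint := integrable_gaussianReal_of_lipschitzWith hf m (v + w)
  rw [hconv] at hint ⊢
  rw [integral_conv hint]
  refine integral_mono (integrable_gaussianReal_of_lipschitzWith hf m v)
    ((integrable_map_measure hint.1 (by fun_prop)).1 hint).integral_prod_left fun x => ?_
  have htranslate : Integrable (fun y => f (x + y)) (gaussianReal 0 w) :=
    integrable_gaussianReal_of_lipschitzWith
      (hf.comp ((LipschitzWith.const x).add LipschitzWith.id)) 0 w
  have hid : Integrable (fun y : ℝ => y) (gaussianReal 0 w) :=
    (memLp_id_gaussianReal 1).integrable le_rfl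
  have hjensen := hc.map_integral_le (f := fun y => x + y) (μ := gaussianReal 0 w)
    hf.continuous.continuousOn isClosed_univ (by simp)
    ((integrable_const x).add hid) htranslate
  rwa [integral_add (integrable_const x) hid,
    integral_id_gaussianReal, integral_const, probReal_univ, one_smul, add_zero] at hjensen

lemma integral_abs_sub_gaussianReal_le (m : ℝ) (v : ℝ≥0) :
    ∫ x, |x - m| ∂(gaussianReal m v) ≤ √v := by
  have hmem : MemLp (fun x : ℝ => |x - m|) 2 (gaussianReal m v) :=
    ((memLp_id_gaussianReal 2).sub (memLp_const m)).norm
  have hsecond : ∫ x, (x - m) ^ 2 ∂(gaussianReal m v) = v := by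
    rw [← variance_fun_id_gaussianReal (μ := m), variance_eq_integral (by fun_prop),
      integral_id_gaussianReal]
  have hvar := variance_nonneg (fun x : ℝ => |x - m|) (gaussianReal m v)
  rw [variance_eq_sub hmem] at hvar
  simp only [Pi.pow_apply, sq_abs, hsecond] at hvar
  exact Real.le_sqrt_of_sq_le (by linarith)

lemma integral_gaussianReal_le_add (hf : LipschitzWith K f) (m : ℝ) (v : ℝ≥0) :
    ∫ x, f x ∂(gaussianReal m v) ≤ f m + K * √v := by
  have hdev : Integrable (fun x => |x - m|) (gaussianReal m v) :=
    (((memLp_id_gaussianReal 1).integrable le_rfl).sub (integrable_const m)).abs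
  calc ∫ x, f x ∂(gaussianReal m v)
      ≤ ∫ x, (f m + K * |x - m|) ∂(gaussianReal m v) := by
        refine integral_mono (integrable_gaussianReal_of_lipschitzWith hf m v)
          ((integrable_const _).add (hdev.const_mul _)) fun x => ?_
        have hdist := hf.dist_le_mul x m
        rw [Real.dist_eq, Real.dist_eq] at hdist
        linarith [le_abs_self (f x - f m)]
    _ = f m + K * ∫ x, |x - m| ∂(gaussianReal m v) := by
        rw [integral_add (integrable_const _) (hdev.const_mul _), integral_const_mul]
        simp
    _ ≤ f m + K * √v := by
        gcongr
        exact integral_abs_sub_gaussianReal_le m v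

end GaussianAverage

/-! ### The smoothed empirical risk -/

/-- The smoothed empirical risk `f_u(x) = E f(x + u Z)`, where `Z` has law `μ`. -/
noncomputable def smoothRisk {d n : ℕ} (μ : Measure (Vec d)) (loss : Fin n → ℝ → ℝ)
    (a : Fin n → Vec d) (u : ℝ) (x : Vec d) : ℝ :=
  ∫ Z, empRisk loss a (x + u • Z) ∂μ

/-- The gradient of the smoothed empirical risk, with the expectation taken inside the sum: each
derivative exists almost everywhere with respect to a nondegenerate Gaussian law. -/
noncomputable def smoothGrad {d n : ℕ} (μ : Measure (Vec d)) (loss : Fin n → ℝ → ℝ)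
    (a : Fin n → Vec d) (u : ℝ) (x : Vec d) : Vec d :=
  (1 / (n : ℝ)) • ∑ i, (∫ Z, deriv (loss i) ⟪a i, x + u • Z⟫ ∂μ) • a i

section SmoothRisk

variable {d n : ℕ} {μ : Measure (Vec d)} {loss : Fin n → ℝ → ℝ} {a : Fin n → Vec d}
  {v : Fin n → ℝ≥0} {K : ℝ≥0} {u u' : ℝ}

lemma hasLaw_inner_add_smul {b : Vec d} {w : ℝ≥0}
    (hμ : HasLaw (fun Z => ⟪b, Z⟫) (gaussianReal 0 w) μ) (u : ℝ) (x : Vec d) :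
    HasLaw (fun Z => ⟪b, x + u • Z⟫) (gaussianReal ⟪b, x⟫ (.mk (u ^ 2) (sq_nonneg u) * w)) μ := by
  simpa only [inner_add_right, inner_smul_right, mul_zero, zero_add] using
    gaussianReal_const_add (gaussianReal_const_mul hμ u) ⟪b, x⟫

lemma integrable_linLoss_add_smul (hl : ∀ i, LipschitzWith K (loss i))
    (hμ : ∀ i, HasLaw (fun Z => ⟪a i, Z⟫) (gaussianReal 0 (v i)) μ) (u : ℝ) (x : Vec d)
    (i : Fin n) : Integrable (fun Z => linLoss loss a i (x + u • Z)) μ := by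
  have hlaw := hasLaw_inner_add_smul (hμ i) u x
  refine Integrable.comp_aemeasurable (g := loss i) ?_ hlaw.aemeasurable
  rw [hlaw.map_eq]
  exact integrable_gaussianReal_of_lipschitzWith (hl i) _ _

lemma smoothRisk_eq (hl : ∀ i, LipschitzWith K (loss i))
    (hμ : ∀ i, HasLaw (fun Z => ⟪a i, Z⟫) (gaussianReal 0 (v i)) μ) (u : ℝ) (x : Vec d) :
    smoothRisk μ loss a u x = (1 / (n : ℝ)) *
      ∑ i, ∫ r, loss i r ∂(gaussianReal ⟪a i, x⟫ (.mk (u ^ 2) (sq_nonneg u) * v i)) := by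
  unfold smoothRisk empRisk
  rw [integral_const_mul, integral_finsetSum _ fun i _ => integrable_linLoss_add_smul hl hμ u x i]
  congr 1
  exact Finset.sum_congr rfl fun i _ => (hasLaw_inner_add_smul (hμ i) u x).integral_comp
    (hl i).continuous.aestronglyMeasurable

lemma inner_smoothGrad_eq (hμ : ∀ i, HasLaw (fun Z => ⟪a i, Z⟫) (gaussianReal 0 (v i)) μ)
    (u : ℝ) (x h : Vec d) :
    ⟪smoothGrad μ loss a u x, h⟫ = (1 / (n : ℝ)) * ∑ i,
      (∫ r, deriv (loss i) r ∂(gaussianReal ⟪a i, x⟫ (.mk (u ^ 2) (sq_nonneg u) * v i)))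
        * ⟪a i, h⟫ := by
  simp only [smoothGrad, real_inner_smul_left, sum_inner]
  congr 1
  refine Finset.sum_congr rfl fun i _ => ?_
  rw [← (hasLaw_inner_add_smul (hμ i) u x).integral_comp
    (measurable_deriv _).aestronglyMeasurable]
  rfl

lemma smoothRisk_add_inner_smoothGrad_le (hl : ∀ i, LipschitzWith K (loss i))
    (hc : ∀ i, ConvexOn ℝ Set.univ (loss i))
    (hμ : ∀ i, HasLaw (fun Z => ⟪a i, Z⟫) (gaussianReal 0 (v i)) μ) (hv : ∀ i, v i = 0 → a i = 0)
    (hu : 0 < u) (x h : Vec d) :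
    smoothRisk μ loss a u x + ⟪smoothGrad μ loss a u x, h⟫ ≤ smoothRisk μ loss a u (x + h) := by
  rw [smoothRisk_eq hl hμ, smoothRisk_eq hl hμ, inner_smoothGrad_eq hμ, ← mul_add,
    ← Finset.sum_add_distrib]
  gcongr with i
  rcases eq_or_ne (v i) 0 with hvi | hvi
  · simp [hv i hvi]
  · rw [inner_add_right]
    exact integral_gaussianReal_add_deriv_mul_le (hl i) (hc i)
      (mul_ne_zero (by simpa [← NNReal.coe_ne_zero] using hu.ne') hvi) _ _

lemma smoothRisk_le_quadratic (hl : ∀ i, LipschitzWith K (loss i))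
    (hc : ∀ i, ConvexOn ℝ Set.univ (loss i))
    (hμ : ∀ i, HasLaw (fun Z => ⟪a i, Z⟫) (gaussianReal 0 (v i)) μ) (hv : ∀ i, v i = 0 → a i = 0)
    {M : ℝ} (hM : ∀ h : Vec d, (1 / (n : ℝ)) * ∑ i, ⟪a i, h⟫ ^ 2 / √(v i) ≤ M * ‖h‖ ^ 2)
    (hu : 0 < u) (x h : Vec d) :
    smoothRisk μ loss a u (x + h) ≤ smoothRisk μ loss a u x + ⟪smoothGrad μ loss a u x, h⟫
      + 2 * K * M / u * ‖h‖ ^ 2 := by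
  have hpoint : smoothRisk μ loss a u (x + h)
      ≤ smoothRisk μ loss a u x + ⟪smoothGrad μ loss a u x, h⟫
        + 2 * K / u * ((1 / (n : ℝ)) * ∑ i, ⟪a i, h⟫ ^ 2 / √(v i)) := by
    rw [smoothRisk_eq hl hμ, smoothRisk_eq hl hμ, inner_smoothGrad_eq hμ, mul_left_comm,
      ← mul_add, ← mul_add, Finset.mul_sum Finset.univ _ (2 * K / u : ℝ),
      ← Finset.sum_add_distrib, ← Finset.sum_add_distrib]
    gcongr with i
    rcases eq_or_ne (v i) 0 with hvi | hvi
    · simp [hv i hvi]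
    · have hquad := integral_gaussianReal_le_quadratic (hl i) (hc i)
        (mul_ne_zero (by simpa [← NNReal.coe_ne_zero] using hu.ne') hvi :
          NNReal.mk (u ^ 2) (sq_nonneg u) * v i ≠ 0) ⟪a i, x⟫ ⟪a i, h⟫
      rw [NNReal.coe_mul, NNReal.coe_mk, Real.sqrt_mul (sq_nonneg u), Real.sqrt_sq hu.le,
        ← inner_add_right] at hquad
      exact hquad.trans_eq (by ring)
  calc smoothRisk μ loss a u (x + h)
      ≤ smoothRisk μ loss a u x + ⟪smoothGrad μ loss a u x, h⟫ + 2 * K / u * (M * ‖h‖ ^ 2) :=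
        hpoint.trans (by gcongr _ + _ * ?_; exact hM h)
    _ = _ := by ring

lemma smoothRisk_mono_radius (hl : ∀ i, LipschitzWith K (loss i))
    (hc : ∀ i, ConvexOn ℝ Set.univ (loss i))
    (hμ : ∀ i, HasLaw (fun Z => ⟪a i, Z⟫) (gaussianReal 0 (v i)) μ)
    (hu : 0 ≤ u) (huu : u ≤ u') (x : Vec d) :
    smoothRisk μ loss a u x ≤ smoothRisk μ loss a u' x := by
  rw [smoothRisk_eq hl hμ, smoothRisk_eq hl hμ]
  gcongr _ * ∑ i, ?_ with i
  refine integral_gaussianReal_mono_variance (hl i) (hc i) _ (mul_le_mul_left ?_ (v i))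
  rw [← NNReal.coe_le_coe]
  exact pow_le_pow_left₀ hu huu 2

lemma empRisk_le_smoothRisk [IsProbabilityMeasure μ] (hl : ∀ i, LipschitzWith K (loss i))
    (hc : ∀ i, ConvexOn ℝ Set.univ (loss i))
    (hμ : ∀ i, HasLaw (fun Z => ⟪a i, Z⟫) (gaussianReal 0 (v i)) μ) (hu : 0 ≤ u) (x : Vec d) :
    empRisk loss a x ≤ smoothRisk μ loss a u x := by
  simpa [smoothRisk] using smoothRisk_mono_radius hl hc hμ le_rfl hu x

lemma smoothRisk_le_empRisk_add (hl : ∀ i, LipschitzWith K (loss i))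
    (hμ : ∀ i, HasLaw (fun Z => ⟪a i, Z⟫) (gaussianReal 0 (v i)) μ) (hu : 0 ≤ u) (x : Vec d) :
    smoothRisk μ loss a u x ≤ empRisk loss a x + u * (K * ((1 / (n : ℝ)) * ∑ i, √(v i))) := by
  calc smoothRisk μ loss a u x
      ≤ (1 / (n : ℝ)) * ∑ i, (loss i ⟪a i, x⟫ + K * (u * √(v i))) := by
        rw [smoothRisk_eq hl hμ]
        gcongr with i
        refine (integral_gaussianReal_le_add (hl i) _ _).trans_eq ?_
        rw [NNReal.coe_mul, NNReal.coe_mk, Real.sqrt_mul (sq_nonneg u), Real.sqrt_sq hu]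
    _ = empRisk loss a x + u * (K * ((1 / (n : ℝ)) * ∑ i, √(v i))) := by
        simp only [empRisk, linLoss, Finset.sum_add_distrib, ← Finset.mul_sum]
        ring

end SmoothRisk

/-! ### Accelerated dual averaging: the deterministic inequality -/

section DualAveraging

variable {E : Type*} [NormedAddCommGroup E] [InnerProductSpace ℝ E] {D : Set E}

lemma add_sq_norm_sub_le_of_isMinOn {φ : E → ℝ} {A : ℝ} (hφ : StrongConvexOn D A φ) {z v : E}
    (hz : z ∈ D) (hmin : IsMinOn φ D z) (hv : v ∈ D) : φ z + A / 2 * ‖v - z‖ ^ 2 ≤ φ v := by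
  have hchord : ∀ s ∈ Set.Ioo (0 : ℝ) 1, φ z + (1 - s) * (A / 2 * ‖v - z‖ ^ 2) ≤ φ v := by
    rintro s ⟨hs0, hs1⟩
    have hconv := hφ.2 hz hv (sub_pos.2 hs1).le hs0.le (sub_add_cancel 1 s)
    have hz_le := isMinOn_iff.1 hmin _ (hφ.1 hz hv (sub_pos.2 hs1).le hs0.le (sub_add_cancel 1 s))
    simp only [smul_eq_mul, norm_sub_rev z v] at hconv
    refine le_of_mul_le_mul_left ?_ hs0
    linarith
  have hlim : Filter.Tendsto (fun s : ℝ => φ z + (1 - s) * (A / 2 * ‖v - z‖ ^ 2))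
      (nhdsWithin 0 (Set.Ioi 0)) (nhds (φ z + (1 - 0) * (A / 2 * ‖v - z‖ ^ 2))) :=
    (by fun_prop : Continuous fun s : ℝ => φ z + (1 - s) * (A / 2 * ‖v - z‖ ^ 2)).continuousWithinAt
  rw [sub_zero, one_mul] at hlim
  exact le_of_tendsto hlim (Filter.eventually_of_mem (Ioo_mem_nhdsGT one_pos) hchord)

lemma strongConvexOn_add_sq_norm {φ : E → ℝ} (hφ : ConvexOn ℝ D φ) (A : ℝ) :
    StrongConvexOn D A fun v => φ v + 1 / 2 * A * ‖v‖ ^ 2 := by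
  rw [strongConvexOn_iff_convex]
  refine hφ.congr fun v _ => ?_
  ring

lemma inner_le_young {η : ℝ} (hη : 0 < η) (e h : E) :
    ⟪e, h⟫ ≤ ‖e‖ ^ 2 / (2 * η) + η / 2 * ‖h‖ ^ 2 := by
  have hsquare : ‖e‖ ^ 2 / (2 * η) + η / 2 * ‖h‖ ^ 2 - ‖e‖ * ‖h‖
      = (‖e‖ - η * ‖h‖) ^ 2 / (2 * η) := by
    field_simp
    ring
  have hnonneg : 0 ≤ (‖e‖ - η * ‖h‖) ^ 2 / (2 * η) := by positivity
  linarith [real_inner_le_norm e h]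

/-- The coupling of the three sequences of an accelerated method over the domain `D`. -/
structure IsAcceleratedScheme (D : Set E) (x y z : ℕ → E) : Prop where
  z_zero : z 0 = 0
  z_mem : ∀ t, z (t + 1) ∈ D
  y_eq : ∀ t, y t = (1 - theta t) • x t + theta t • z t
  x_eq : ∀ t, x (t + 1) = (1 - theta t) • x t + theta t • z (t + 1)

/-- A decreasing sequence of functions `F t` which, at the points visited by an accelerated method,
behave as convex functions with gradient `G t` and smoothness constant `L t`. -/
structure IsSmoothSequence (F : ℕ → E → ℝ) (G : ℕ → E) (L : ℕ → ℝ) (x y : ℕ → E) : Prop where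
  add_inner_le : ∀ t v, F t (y t) + ⟪G t, v - y t⟫ ≤ F t v
  le_quadratic : ∀ t, F t (x (t + 1)) ≤ F t (y t) + ⟪G t, x (t + 1) - y t⟫
    + L t / 2 * ‖x (t + 1) - y t‖ ^ 2
  succ_le : ∀ t v, F (t + 1) v ≤ F t v

/-- The weighted linear model of the composite objective `F t + ψ` at `y t`, built from the
inexact gradient `g t`. -/
noncomputable def linearModel (ψ : E → ℝ) (F : ℕ → E → ℝ) (y g : ℕ → E) (t : ℕ) (v : E) : ℝ :=
  1 / theta t * (F t (y t) + ⟪g t, v - y t⟫ + ψ v)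

/-- The estimate function of dual averaging: the linear models accumulated before time `t`, with
quadratic regularization `A t`. -/
noncomputable def estimateFun (ψ : E → ℝ) (F : ℕ → E → ℝ) (y g : ℕ → E) (A : ℕ → ℝ) (t : ℕ)
    (v : E) : ℝ :=
  ∑ τ ∈ Finset.range t, linearModel ψ F y g τ v + 1 / 2 * A t * ‖v‖ ^ 2

variable {ψ : E → ℝ} {x y z g G : ℕ → E} {F : ℕ → E → ℝ} {A L η : ℕ → ℝ}

lemma IsAcceleratedScheme.x_mem (hs : IsAcceleratedScheme D x y z) (hD : Convex ℝ D) (t : ℕ) :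
    x (t + 1) ∈ D := by
  induction t with
  | zero => simpa [hs.x_eq, theta] using hs.z_mem 0
  | succ t ih =>
    rw [hs.x_eq]
    exact hD ih (hs.z_mem _) (sub_nonneg.2 (theta_le_one _)) (theta_pos _).le (sub_add_cancel _ _)

lemma IsAcceleratedScheme.convexOn_x_le (hs : IsAcceleratedScheme D x y z)
    (hψ : ConvexOn ℝ D ψ) (t : ℕ) :
    ψ (x (t + 1)) ≤ (1 - theta t) * ψ (x t) + theta t * ψ (z (t + 1)) := by
  cases t with
  | zero => simp [hs.x_eq, theta]
  | succ t =>
    rw [hs.x_eq (t + 1)]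
    exact hψ.2 (hs.x_mem hψ.1 t) (hs.z_mem _) (sub_nonneg.2 (theta_le_one _)) (theta_pos _).le
      (sub_add_cancel _ _)

lemma IsAcceleratedScheme.x_sub_y (hs : IsAcceleratedScheme D x y z) (t : ℕ) :
    x (t + 1) - y t = theta t • (z (t + 1) - z t) := by
  rw [hs.x_eq, hs.y_eq]
  module

lemma IsAcceleratedScheme.x_sub_y_eq_add (hs : IsAcceleratedScheme D x y z) (t : ℕ) :
    x (t + 1) - y t = (1 - theta t) • (x t - y t) + theta t • (z (t + 1) - y t) := by
  rw [hs.x_eq]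
  module

lemma IsAcceleratedScheme.composite_le (hs : IsAcceleratedScheme D x y z)
    (hF : IsSmoothSequence F G L x y) (hψ : ConvexOn ℝ D ψ) (t : ℕ) :
    F t (x (t + 1)) + ψ (x (t + 1)) ≤ (1 - theta t) * (F t (x t) + ψ (x t))
      + theta t * (F t (y t) + ⟪G t, z (t + 1) - y t⟫ + ψ (z (t + 1)))
      + L t / 2 * (theta t ^ 2 * ‖z (t + 1) - z t‖ ^ 2) := by
  have hinner : ⟪G t, x (t + 1) - y t⟫
      = (1 - theta t) * ⟪G t, x t - y t⟫ + theta t * ⟪G t, z (t + 1) - y t⟫ := by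
    rw [hs.x_sub_y_eq_add, inner_add_right, inner_smul_right, inner_smul_right]
  have hnorm : ‖x (t + 1) - y t‖ ^ 2 = theta t ^ 2 * ‖z (t + 1) - z t‖ ^ 2 := by
    rw [hs.x_sub_y, norm_smul, mul_pow, Real.norm_eq_abs, sq_abs]
  have htangent := mul_le_mul_of_nonneg_left (hF.add_inner_le t (x t))
    (sub_nonneg.2 (theta_le_one t))
  rw [← hnorm]
  linarith [hF.le_quadratic t, hs.convexOn_x_le hψ t]

lemma convexOn_linearModel (hψ : ConvexOn ℝ D ψ) (t : ℕ) :
    ConvexOn ℝ D (linearModel ψ F y g t) := by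
  have haffine : ConvexOn ℝ D fun v => F t (y t) + ⟪g t, v - y t⟫ := by
    refine (((innerₛₗ ℝ (g t)).convexOn hψ.1).add_const (F t (y t) - ⟪g t, y t⟫)).congr
      fun v _ => ?_
    simp only [Pi.add_apply, innerₛₗ_apply_apply, inner_sub_right]
    ring
  exact (haffine.add hψ).smul (one_div_theta_pos t).le

lemma strongConvexOn_estimateFun (hψ : ConvexOn ℝ D ψ) (t : ℕ) :
    StrongConvexOn D (A t) (estimateFun ψ F y g A t) := by
  have hsum : ConvexOn ℝ D (∑ τ ∈ Finset.range t, linearModel ψ F y g τ) :=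
    Finset.sum_induction _ (ConvexOn ℝ D) (fun _ _ => ConvexOn.add) (convexOn_const 0 hψ.1)
      fun τ _ => convexOn_linearModel hψ τ
  refine strongConvexOn_add_sq_norm ?_ _
  simpa only [Finset.sum_fn] using hsum

lemma isMinOn_estimateFun (F : ℕ → E → ℝ) (y : ℕ → E) {t : ℕ} {p : E}
    (hmin : IsMinOn (fun v => ∑ τ ∈ Finset.range t, 1 / theta τ * ⟪g τ, v⟫
        + (∑ τ ∈ Finset.range t, 1 / theta τ) * ψ v + 1 / 2 * A t * ‖v‖ ^ 2) D p) :
    IsMinOn (estimateFun ψ F y g A t) D p := by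
  have hconst : ∀ v, estimateFun ψ F y g A t v
      = ∑ τ ∈ Finset.range t, 1 / theta τ * ⟪g τ, v⟫
        + (∑ τ ∈ Finset.range t, 1 / theta τ) * ψ v + 1 / 2 * A t * ‖v‖ ^ 2
        + ∑ τ ∈ Finset.range t, 1 / theta τ * (F τ (y τ) - ⟪g τ, y τ⟫) := fun v => by
    rw [estimateFun, Finset.sum_mul, add_right_comm, ← Finset.sum_add_distrib,
      ← Finset.sum_add_distrib]
    congr 1
    refine Finset.sum_congr rfl fun τ _ => ?_
    rw [linearModel, inner_sub_right]
    ring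
  refine isMinOn_iff.2 fun v hv => ?_
  rw [hconst, hconst]
  exact add_le_add_left (isMinOn_iff.1 hmin v hv) _

lemma estimateFun_add_sq_le (hs : IsAcceleratedScheme D x y z) (hψ : ConvexOn ℝ D ψ)
    (hmin : ∀ t, IsMinOn (estimateFun ψ F y g A (t + 1)) D (z (t + 1))) (t : ℕ) {v : E}
    (hv : v ∈ D) :
    estimateFun ψ F y g A t (z t) + A t / 2 * ‖v - z t‖ ^ 2 ≤ estimateFun ψ F y g A t v := by
  cases t with
  | zero => simp [estimateFun, hs.z_zero, div_eq_inv_mul]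
  | succ t =>
    exact add_sq_norm_sub_le_of_isMinOn (strongConvexOn_estimateFun hψ _) (hs.z_mem t) (hmin t) hv

/-- One step: the gap between the smoothness term `L t` and the curvature `L t + η t / θ t` of the
estimate function absorbs, by Young's inequality, the gradient error against `z (t + 1) - z t`. -/
lemma composite_le_add_estimateFun_sub (hs : IsAcceleratedScheme D x y z)
    (hF : IsSmoothSequence F G L x y) (hψ : ConvexOn ℝ D ψ) (hη : ∀ t, 0 < η t)
    (hA : ∀ t, A t = L t + η t / theta t) (hAmono : Monotone A)
    (hmin : ∀ t, IsMinOn (estimateFun ψ F y g A (t + 1)) D (z (t + 1))) (t : ℕ) :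
    (1 / theta t) ^ 2 * (F t (x (t + 1)) + ψ (x (t + 1)))
      ≤ (1 / theta t) ^ 2 * (1 - theta t) * (F t (x t) + ψ (x t))
        + (estimateFun ψ F y g A (t + 1) (z (t + 1)) - estimateFun ψ F y g A t (z t))
        + (‖G t - g t‖ ^ 2 / (2 * η t * theta t) + 1 / theta t * ⟪G t - g t, z t - y t⟫) := by
  have hθ := theta_pos t
  have hcomposite := mul_le_mul_of_nonneg_left (hs.composite_le hF hψ t)
    (sq_nonneg (1 / theta t))
  have hscaled : (1 / theta t) ^ 2 * ((1 - theta t) * (F t (x t) + ψ (x t))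
      + theta t * (F t (y t) + ⟪G t, z (t + 1) - y t⟫ + ψ (z (t + 1)))
      + L t / 2 * (theta t ^ 2 * ‖z (t + 1) - z t‖ ^ 2))
      = (1 / theta t) ^ 2 * (1 - theta t) * (F t (x t) + ψ (x t))
      + 1 / theta t * (F t (y t) + ⟪G t, z (t + 1) - y t⟫ + ψ (z (t + 1)))
      + L t / 2 * ‖z (t + 1) - z t‖ ^ 2 := by field_simp
  have hmodel : 1 / theta t * (F t (y t) + ⟪G t, z (t + 1) - y t⟫ + ψ (z (t + 1)))
      = linearModel ψ F y g t (z (t + 1)) + 1 / theta t * ⟪G t - g t, z (t + 1) - z t⟫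
        + 1 / theta t * ⟪G t - g t, z t - y t⟫ := by
    simp only [linearModel, inner_sub_left, inner_sub_right]
    ring
  have hyoung : 1 / theta t * ⟪G t - g t, z (t + 1) - z t⟫
      ≤ ‖G t - g t‖ ^ 2 / (2 * η t * theta t) + η t / theta t / 2 * ‖z (t + 1) - z t‖ ^ 2 := by
    refine (mul_le_mul_of_nonneg_left (inner_le_young (hη t) _ _)
      (one_div_theta_pos t).le).trans_eq ?_
    field_simp
  have hsucc : estimateFun ψ F y g A t (z (t + 1)) + linearModel ψ F y g t (z (t + 1))
      ≤ estimateFun ψ F y g A (t + 1) (z (t + 1)) := by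
    simp only [estimateFun, Finset.sum_range_succ]
    linarith [mul_le_mul_of_nonneg_right (hAmono t.le_succ) (sq_nonneg ‖z (t + 1)‖)]
  have hstrong := estimateFun_add_sq_le hs hψ hmin t (hs.z_mem t)
  rw [hA t] at hstrong
  linarith

lemma composite_le_estimateFun_add_sum (hs : IsAcceleratedScheme D x y z)
    (hF : IsSmoothSequence F G L x y) (hψ : ConvexOn ℝ D ψ) (hη : ∀ t, 0 < η t)
    (hA : ∀ t, A t = L t + η t / theta t) (hAmono : Monotone A)
    (hmin : ∀ t, IsMinOn (estimateFun ψ F y g A (t + 1)) D (z (t + 1))) (t : ℕ) :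
    (1 / theta t) ^ 2 * (F t (x (t + 1)) + ψ (x (t + 1)))
      ≤ estimateFun ψ F y g A (t + 1) (z (t + 1)) + ∑ τ ∈ Finset.range (t + 1),
        (‖G τ - g τ‖ ^ 2 / (2 * η τ * theta τ) + 1 / theta τ * ⟪G τ - g τ, z τ - y τ⟫) := by
  have hstep := composite_le_add_estimateFun_sub hs hF hψ hη hA hAmono hmin
  induction t with
  | zero =>
    have h0 := hstep 0
    simp only [theta, estimateFun, hs.z_zero] at h0 ⊢
    simpa [theta, estimateFun, hs.z_zero] using h0
  | succ t ih =>
    have hdecrease := mul_le_mul_of_nonneg_left (hF.succ_le t (x (t + 1)))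
      (sq_nonneg (1 / theta t))
    have hnext := hstep (t + 1)
    rw [one_div_theta_sq_succ_mul] at hnext
    rw [Finset.sum_range_succ]
    linarith

lemma sum_linearModel_le (hF : IsSmoothSequence F G L x y) {w : E} {b c : ℝ}
    (hb : ∀ t, F t w ≤ b + theta t * c) (t : ℕ) :
    ∑ τ ∈ Finset.range (t + 1), linearModel ψ F y g τ w
      ≤ (1 / theta t) ^ 2 * (b + ψ w) + (t + 1) * c
        - ∑ τ ∈ Finset.range (t + 1), 1 / theta τ * ⟪G τ - g τ, w - y τ⟫ := by
  have hc : ((t : ℝ) + 1) * c = ∑ _ ∈ Finset.range (t + 1), c := by simp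
  rw [← sum_one_div_theta, hc, Finset.sum_mul, ← Finset.sum_add_distrib, ← Finset.sum_sub_distrib]
  refine Finset.sum_le_sum fun τ _ => ?_
  have htangent := mul_le_mul_of_nonneg_left ((hF.add_inner_le τ w).trans (hb τ))
    (one_div_theta_pos τ).le
  have hcancel : 1 / theta τ * (b + theta τ * c) = 1 / theta τ * b + c := by
    field_simp [(theta_pos τ).ne']
  simp only [linearModel, inner_sub_left]
  linarith

theorem dual_averaging_inequality (hs : IsAcceleratedScheme D x y z)
    (hF : IsSmoothSequence F G L x y) (hψ : ConvexOn ℝ D ψ) (hη : ∀ t, 0 < η t)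
    (hA : ∀ t, A t = L t + η t / theta t) (hAmono : Monotone A)
    (hmin : ∀ t, IsMinOn (fun v => ∑ τ ∈ Finset.range (t + 1), 1 / theta τ * ⟪g τ, v⟫
        + (∑ τ ∈ Finset.range (t + 1), 1 / theta τ) * ψ v
        + 1 / 2 * A (t + 1) * ‖v‖ ^ 2) D (z (t + 1)))
    {w : E} (hw : w ∈ D) {b c : ℝ} (hb : ∀ t, F t w ≤ b + theta t * c) (t : ℕ) :
    (1 / theta t) ^ 2 * (F t (x (t + 1)) + ψ (x (t + 1)) - b - ψ w)
      ≤ 1 / 2 * A (t + 1) * ‖w‖ ^ 2 + (t + 1) * c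
        + ∑ τ ∈ Finset.range (t + 1), ‖G τ - g τ‖ ^ 2 / (2 * η τ * theta τ)
        + ∑ τ ∈ Finset.range (t + 1), 1 / theta τ * ⟪G τ - g τ, z τ - w⟫ := by
  have hest := fun t => isMinOn_estimateFun F y (hmin t)
  have hpotential := composite_le_estimateFun_add_sum hs hF hψ hη hA hAmono hest t
  have hz_le := isMinOn_iff.1 (hest t) w hw
  have hmodel := sum_linearModel_le (ψ := ψ) (g := g) hF hb t
  have hsplit : ∑ τ ∈ Finset.range (t + 1), 1 / theta τ * ⟪G τ - g τ, z τ - w⟫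
      = ∑ τ ∈ Finset.range (t + 1), 1 / theta τ * ⟪G τ - g τ, z τ - y τ⟫
        - ∑ τ ∈ Finset.range (t + 1), 1 / theta τ * ⟪G τ - g τ, w - y τ⟫ := by
    simp only [← Finset.sum_sub_distrib, inner_sub_right]
    exact Finset.sum_congr rfl fun τ _ => by ring
  rw [hsplit]
  rw [Finset.sum_add_distrib] at hpotential
  simp only [estimateFun] at hpotential hz_le
  linarith

end DualAveraging

/-! ### Sampled gradients -/

section Subgradients

variable {d : ℕ} {F : Vec d → ℝ} {p g : Vec d}

lemma IsSubgradient.eq_of_hasGradientAt (hg : IsSubgradient F p g) {G : Vec d}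
    (hF : HasGradientAt F G p) : g = G := by
  have hmin : IsLocalMin (fun x => F x - ⟪g, x⟫) p := by
    refine Filter.Eventually.of_forall fun x => ?_
    have hx := hg x
    rw [inner_sub_right] at hx
    linarith
  have hderiv := hmin.hasFDerivAt_eq_zero (hF.hasFDerivAt.sub (innerSL ℝ g).hasFDerivAt)
  refine ext_inner_right ℝ fun w => ?_
  exact (sub_eq_zero.1 (by simpa using DFunLike.congr_fun hderiv w)).symm

lemma IsSubgradient.norm_le (hg : IsSubgradient F p g) {K : ℝ≥0} (hF : LipschitzWith K F) :
    ‖g‖ ≤ K := by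
  have hsub := hg (p + g)
  have hlip := (le_abs_self _).trans (hF.dist_le_mul (p + g) p)
  rw [add_sub_cancel_left, real_inner_self_eq_norm_sq] at hsub
  rw [dist_eq_norm, add_sub_cancel_left] at hlip
  by_contra! hlt
  nlinarith [hlt.trans_le' K.2]

end Subgradients

/-- The gradient of the `i`-th loss at `p`, wherever that loss is differentiable. -/
noncomputable def lossGrad {d n : ℕ} (loss : Fin n → ℝ → ℝ) (a : Fin n → Vec d) (i : Fin n)
    (p : Vec d) : Vec d :=
  deriv (loss i) ⟪a i, p⟫ • a i

section LossGrad

variable {d n : ℕ} {loss : Fin n → ℝ → ℝ} {a : Fin n → Vec d} {K : ℝ≥0}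

lemma hasGradientAt_linLoss {i : Fin n} {p : Vec d}
    (h : a i = 0 ∨ DifferentiableAt ℝ (loss i) ⟪a i, p⟫) :
    HasGradientAt (linLoss loss a i) (lossGrad loss a i p) p := by
  rw [hasGradientAt_iff_hasFDerivAt]
  rcases h with h | h
  · have hconst : linLoss loss a i = fun _ => loss i 0 := by ext; simp [linLoss, h]
    simpa [hconst, lossGrad, h] using hasFDerivAt_const (loss i 0) p
  · rw [lossGrad, map_smulₛₗ]
    exact h.hasDerivAt.comp_hasFDerivAt p (innerSL ℝ (a i)).hasFDerivAt

lemma measurable_lossGrad : Measurable fun q : Vec d × Fin n => lossGrad loss a q.2 q.1 :=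
  measurable_from_prod_countable_left fun i =>
    ((measurable_deriv (loss i)).comp (by fun_prop : Measurable fun p => ⟪a i, p⟫)).smul_const (a i)

lemma norm_lossGrad_le (hl : ∀ i, LipschitzWith K (loss i)) (i : Fin n) (p : Vec d) :
    ‖lossGrad loss a i p‖ ≤ K * ∑ k, ‖a k‖ := by
  rw [lossGrad, norm_smul]
  gcongr
  · exact abs_deriv_le_of_lipschitzWith (hl i) _
  · exact Finset.single_le_sum (f := fun k => ‖a k‖) (fun _ _ => norm_nonneg _) (Finset.mem_univ i)

lemma measurableSet_differentiableAt_linLoss :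
    MeasurableSet {q : Vec d × Fin n | a q.2 = 0 ∨ DifferentiableAt ℝ (loss q.2) ⟪a q.2, q.1⟫} := by
  refine measurableSet_setOfPred.2 (measurable_from_prod_countable_left fun i =>
    measurableSet_setOfPred.1 ?_)
  exact (MeasurableSet.const (a i = 0)).union
    ((measurableSet_of_differentiableAt ℝ (loss i)).preimage
      (by fun_prop : Measurable fun p => ⟪a i, p⟫))

lemma integral_uniformOn_univ {ι : Type*} [Fintype ι] [MeasurableSpace ι]
    [MeasurableSingletonClass ι] (h : ι → ℝ) :
    ∫ i, h i ∂(uniformOn Set.univ) = (1 / (Fintype.card ι : ℝ)) * ∑ i, h i := by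
  rw [integral_fintype (by simp [Integrable.of_finite]), Finset.mul_sum]
  refine Finset.sum_congr rfl fun i _ => ?_
  rw [measureReal_def, uniformOn_univ]
  simp

variable {μ : Measure (Vec d)} {v : Fin n → ℝ≥0} {u : ℝ}

lemma ae_differentiableAt_linLoss (hl : ∀ i, LipschitzWith K (loss i))
    (hμ : ∀ i, HasLaw (fun Z => ⟪a i, Z⟫) (gaussianReal 0 (v i)) μ) (hv : ∀ i, v i = 0 → a i = 0)
    (hu : 0 < u) (y : Vec d) :
    ∀ᵐ p ∂(μ.prod (uniformOn (Set.univ : Set (Fin n)))),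
      a p.2 = 0 ∨ DifferentiableAt ℝ (loss p.2) ⟪a p.2, y + u • p.1⟫ := by
  have hmeas : MeasurableSet {p : Vec d × Fin n |
      a p.2 = 0 ∨ DifferentiableAt ℝ (loss p.2) ⟪a p.2, y + u • p.1⟫} :=
    measurableSet_differentiableAt_linLoss.preimage
      (by fun_prop : Measurable fun p : Vec d × Fin n => (y + u • p.1, p.2))
  refine (Measure.ae_prod_mem_iff_ae_ae_mem hmeas).2 ?_
  have hall : ∀ i, ∀ᵐ Z ∂μ, a i = 0 ∨ DifferentiableAt ℝ (loss i) ⟪a i, y + u • Z⟫ := fun i => by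
    rcases eq_or_ne (v i) 0 with hvi | hvi
    · exact ae_of_all _ fun _ => .inl (hv i hvi)
    · have hlaw := hasLaw_inner_add_smul (hμ i) u y
      have hdiff := ae_gaussianReal_differentiableAt (hl i)
        (mul_ne_zero (by simpa [← NNReal.coe_ne_zero] using hu.ne') hvi :
          NNReal.mk (u ^ 2) (sq_nonneg u) * v i ≠ 0) ⟪a i, y⟫
      rw [← hlaw.map_eq] at hdiff
      exact (ae_of_ae_map hlaw.aemeasurable hdiff).mono fun _ => .inr
  filter_upwards [ae_all_iff.2 hall] with Z hZ using ae_of_all _ hZ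

variable [IsProbabilityMeasure μ]

lemma integral_inner_lossGrad [NeZero n] (hl : ∀ i, LipschitzWith K (loss i)) (u : ℝ)
    (y w : Vec d) :
    ∫ p, ⟪lossGrad loss a p.2 (y + u • p.1), w⟫ ∂(μ.prod (uniformOn (Set.univ : Set (Fin n))))
      = ⟪smoothGrad μ loss a u y, w⟫ := by
  have hmeas : Measurable fun p : Vec d × Fin n => ⟪lossGrad loss a p.2 (y + u • p.1), w⟫ :=
    (measurable_lossGrad.comp
      (by fun_prop : Measurable fun p : Vec d × Fin n => (y + u • p.1, p.2))).inner_const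
  have hbound : ∀ p : Vec d × Fin n,
      ‖⟪lossGrad loss a p.2 (y + u • p.1), w⟫‖ ≤ K * (∑ k, ‖a k‖) * ‖w‖ := fun p =>
    (norm_inner_le_norm _ _).trans (by gcongr; exact norm_lossGrad_le hl _ _)
  rw [integral_prod _ (.of_bound hmeas.aestronglyMeasurable _ (ae_of_all _ hbound))]
  simp_rw [integral_uniformOn_univ, Fintype.card_fin]
  rw [integral_const_mul, integral_finsetSum]
  · simp only [smoothGrad, lossGrad, real_inner_smul_left, sum_inner, integral_mul_const]
  · exact fun i _ => .of_bound (hmeas.comp (measurable_prodMk_right (y := i))).aestronglyMeasurable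
      _ (ae_of_all _ fun Z => hbound (Z, i))

lemma measurable_smoothGrad : Measurable (smoothGrad μ loss a u) := by
  have hmeas : ∀ i, Measurable fun y => ∫ Z, deriv (loss i) ⟪a i, y + u • Z⟫ ∂μ := fun i => by
    have : Measurable fun q : Vec d × Vec d => deriv (loss i) ⟪a i, q.1 + u • q.2⟫ :=
      (measurable_deriv (loss i)).comp (by fun_prop)
    exact this.stronglyMeasurable.integral_prod_right.measurable
  exact (Finset.measurable_sum Finset.univ fun i _ => (hmeas i).smul_const (a i)).const_smul
    (1 / (n : ℝ))

lemma norm_smoothGrad_le (hl : ∀ i, LipschitzWith K (loss i)) (y : Vec d) :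
    ‖smoothGrad μ loss a u y‖ ≤ (1 / (n : ℝ)) * ∑ i, K * ‖a i‖ := by
  rw [smoothGrad, norm_smul, Real.norm_of_nonneg (by positivity)]
  gcongr
  refine (norm_sum_le _ _).trans (Finset.sum_le_sum fun i _ => ?_)
  rw [norm_smul]
  gcongr
  have hderiv : ∀ Z, ‖deriv (loss i) ⟪a i, y + u • Z⟫‖ ≤ K := fun Z =>
    abs_deriv_le_of_lipschitzWith (hl i) _
  simpa using norm_integral_le_of_norm_le_const (μ := μ) (ae_of_all _ hderiv)

end LossGrad

section Independence

variable {Ω α β : Type*} {m' : MeasurableSpace Ω} [mΩ : MeasurableSpace Ω] {Q : Measure Ω}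
  [IsProbabilityMeasure Q] [MeasurableSpace α] [TopologicalSpace α]
  [TopologicalSpace.PseudoMetrizableSpace α] [BorelSpace α] [MeasurableSpace β] {ν : Measure β}
  {X : Ω → α} {ξ : Ω → β}

lemma hasLaw_prodMk_of_indep (hm' : m' ≤ mΩ) (hX : AEStronglyMeasurable[m'] X Q)
    (hξ : HasLaw ξ ν Q) (hind : Indep m' (MeasurableSpace.comap ξ inferInstance) Q) :
    HasLaw (fun ω => (X ω, ξ ω)) ((Q.map X).prod ν) Q := by
  have hmk : Measurable[m'] (hX.mk X) := hX.measurable_mk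
  have hindep : IndepFun (hX.mk X) ξ Q :=
    (IndepFun_iff_Indep ..).2 (indep_of_indep_of_le_left hind hmk.comap_le)
  refine HasLaw.congr (hindep.hasLaw_prod
    ⟨(hmk.mono hm' le_rfl).aemeasurable, (Measure.map_congr hX.ae_eq_mk).symm⟩ hξ) ?_
  filter_upwards [hX.ae_eq_mk] with ω hω
  rw [hω]

lemma integral_comp_prodMk_of_indep (hm' : m' ≤ mΩ) (hX : AEStronglyMeasurable[m'] X Q)
    (hξ : HasLaw ξ ν Q) (hind : Indep m' (MeasurableSpace.comap ξ inferInstance) Q)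
    {f : α × β → ℝ} (hf : Measurable f) (hint : Integrable (fun ω => f (X ω, ξ ω)) Q) :
    ∫ ω, f (X ω, ξ ω) ∂Q = ∫ ω, ∫ b, f (X ω, b) ∂ν ∂Q := by
  have hXm : AEMeasurable X Q := (hX.mono hm').aemeasurable
  have hlaw := hasLaw_prodMk_of_indep hm' hX hξ hind
  have : IsProbabilityMeasure (Q.map X) := Measure.isProbabilityMeasure_map hXm
  have : IsProbabilityMeasure ν := hξ.isProbabilityMeasure_iff.1 inferInstance
  have hint' : Integrable f ((Q.map X).prod ν) := by
    rw [← hlaw.map_eq]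
    exact (integrable_map_measure hf.aestronglyMeasurable hlaw.aemeasurable).2 hint
  calc ∫ ω, f (X ω, ξ ω) ∂Q = ∫ q, f q ∂((Q.map X).prod ν) :=
        hlaw.integral_comp hf.aestronglyMeasurable
    _ = ∫ ω, ∫ b, f (X ω, b) ∂ν ∂Q := by
        rw [integral_prod _ hint',
          integral_map hXm hint'.integral_prod_left.aestronglyMeasurable]

end Independence

section Sample

variable {d n : ℕ} {loss : Fin n → ℝ → ℝ} {a : Fin n → Vec d} {K : ℝ≥0}
  {μ : Measure (Vec d)} [IsProbabilityMeasure μ] {v : Fin n → ℝ≥0} {u : ℝ}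
  {Ω : Type*} {m' : MeasurableSpace Ω} [mΩ : MeasurableSpace Ω] {Q : Measure Ω}
  [IsProbabilityMeasure Q] {Y W g : Ω → Vec d} {ξ : Ω → Vec d × Fin n}

lemma ae_eq_lossGrad (hl : ∀ i, LipschitzWith K (loss i))
    (hμ : ∀ i, HasLaw (fun Z => ⟪a i, Z⟫) (gaussianReal 0 (v i)) μ) (hv : ∀ i, v i = 0 → a i = 0)
    (hu : 0 < u) (hm' : m' ≤ mΩ) (hY : AEStronglyMeasurable[m'] Y Q)
    (hξ : HasLaw ξ (μ.prod (uniformOn Set.univ)) Q)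
    (hind : Indep m' (MeasurableSpace.comap ξ inferInstance) Q)
    (hg : ∀ ω, IsSubgradient (linLoss loss a (ξ ω).2) (Y ω + u • (ξ ω).1) (g ω)) :
    g =ᵐ[Q] fun ω => lossGrad loss a (ξ ω).2 (Y ω + u • (ξ ω).1) := by
  have hmeas : MeasurableSet {q : Vec d × Vec d × Fin n |
      a q.2.2 = 0 ∨ DifferentiableAt ℝ (loss q.2.2) ⟪a q.2.2, q.1 + u • q.2.1⟫} :=
    measurableSet_differentiableAt_linLoss.preimage
      (by fun_prop : Measurable fun q : Vec d × Vec d × Fin n => (q.1 + u • q.2.1, q.2.2))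
  have hlaw := hasLaw_prodMk_of_indep hm' hY hξ hind
  have hae := (Measure.ae_prod_mem_iff_ae_ae_mem hmeas).2
    (ae_of_all (Q.map Y) fun y => ae_differentiableAt_linLoss hl hμ hv hu y)
  rw [← hlaw.map_eq] at hae
  filter_upwards [ae_of_ae_map hlaw.aemeasurable hae] with ω hω
  exact (hg ω).eq_of_hasGradientAt (hasGradientAt_linLoss hω)

lemma integral_inner_sampled_lossGrad [NeZero n] (hl : ∀ i, LipschitzWith K (loss i))
    (hm' : m' ≤ mΩ) (hY : AEStronglyMeasurable[m'] Y Q) (hW : AEStronglyMeasurable[m'] W Q)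
    {C : ℝ} (hWC : ∀ ω, ‖W ω‖ ≤ C) (hξ : HasLaw ξ (μ.prod (uniformOn Set.univ)) Q)
    (hind : Indep m' (MeasurableSpace.comap ξ inferInstance) Q) :
    ∫ ω, ⟪lossGrad loss a (ξ ω).2 (Y ω + u • (ξ ω).1), W ω⟫ ∂Q
      = ∫ ω, ⟪smoothGrad μ loss a u (Y ω), W ω⟫ ∂Q := by
  have hYW : AEStronglyMeasurable[m'] (fun ω => (Y ω, W ω)) Q := hY.prodMk hW
  have hmeas : Measurable fun q : (Vec d × Vec d) × (Vec d × Fin n) =>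
      ⟪lossGrad loss a q.2.2 (q.1.1 + u • q.2.1), q.1.2⟫ :=
    (measurable_lossGrad.comp (by fun_prop :
      Measurable fun q : (Vec d × Vec d) × Vec d × Fin n => (q.1.1 + u • q.2.1, q.2.2))).inner
      (by fun_prop)
  have hint : Integrable (fun ω => ⟪lossGrad loss a (ξ ω).2 (Y ω + u • (ξ ω).1), W ω⟫) Q := by
    refine .of_bound (C := K * (∑ k, ‖a k‖) * C) (hmeas.comp_aemeasurable
      (hasLaw_prodMk_of_indep hm' hYW hξ hind).aemeasurable).aestronglyMeasurable
      (ae_of_all _ fun ω => (norm_inner_le_norm _ _).trans ?_)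
    gcongr
    exacts [norm_lossGrad_le hl _ _, hWC ω]
  rw [integral_comp_prodMk_of_indep hm' hYW hξ hind hmeas hint]
  simp only [integral_inner_lossGrad hl]

end Sample

/-! ### Measurability of the iterates -/

lemma exists_continuous_factor {Ω : Type*} {d : ℕ} {z G : Ω → Vec d} {K : ℝ≥0}
    (h : ∀ ω ω', ‖z ω - z ω'‖ ≤ K * ‖G ω - G ω'‖) :
    ∃ φ : Vec d → Vec d, Continuous φ ∧ ∀ ω, z ω = φ (G ω) := by
  cases isEmpty_or_nonempty Ω
  · exact ⟨id, continuous_id, isEmptyElim⟩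
  choose! s hs using fun p (hp : p ∈ Set.range G) => hp
  have hlip : LipschitzOnWith K (fun p => z (s p)) (Set.range G) := by
    refine LipschitzOnWith.of_dist_le_mul fun p hp q hq => ?_
    simpa only [dist_eq_norm, hs p hp, hs q hq] using h (s p) (s q)
  obtain ⟨φ, hφ, heq⟩ := hlip.extend_finite_dimension
  refine ⟨φ, hφ.continuous, fun ω => ?_⟩
  have hω : G ω ∈ Set.range G := Set.mem_range_self ω
  have hdist := h ω (s (G ω))
  rw [hs _ hω, sub_self, norm_zero, mul_zero] at hdist
  rw [← heq hω]
  exact sub_eq_zero.1 (norm_le_zero_iff.1 hdist)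

lemma norm_sub_le_of_isMinOn {E : Type*} [NormedAddCommGroup E] [InnerProductSpace ℝ E]
    {D : Set E} {ψ : E → ℝ} (hψ : ConvexOn ℝ D ψ) {b A : ℝ} (hb : 0 ≤ b) (hA : 0 < A)
    {G G' z z' : E} (hz : z ∈ D) (hz' : z' ∈ D)
    (hmin : IsMinOn (fun v => ⟪G, v⟫ + b * ψ v + 1 / 2 * A * ‖v‖ ^ 2) D z)
    (hmin' : IsMinOn (fun v => ⟪G', v⟫ + b * ψ v + 1 / 2 * A * ‖v‖ ^ 2) D z') :
    ‖z - z'‖ ≤ 1 / A * ‖G - G'‖ := by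
  have hconv : ∀ G : E, ConvexOn ℝ D (fun v => ⟪G, v⟫ + b * ψ v) := fun G =>
    ((innerSL ℝ G).toLinearMap.convexOn hψ.1).add (hψ.smul hb)
  have hmin_le := add_sq_norm_sub_le_of_isMinOn (strongConvexOn_add_sq_norm (hconv G) A) hz hmin hz'
  have hmin_le' :=
    add_sq_norm_sub_le_of_isMinOn (strongConvexOn_add_sq_norm (hconv G') A) hz' hmin' hz
  have hcauchy := real_inner_le_norm (G - G') (z' - z)
  simp only [inner_sub_left, inner_sub_right] at hcauchy
  rw [norm_sub_rev z' z] at hmin_le hcauchy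
  have hsq : A * ‖z - z'‖ ^ 2 ≤ ‖G - G'‖ * ‖z - z'‖ := by linarith
  rcases (norm_nonneg (z - z')).eq_or_lt with hzero | hpos
  · rw [← hzero]; positivity
  · rw [one_div, inv_mul_eq_div, le_div_iff₀ hA]
    exact le_of_mul_le_mul_right (hsq.trans_eq' (by ring)) hpos

lemma aestronglyMeasurable_finsetSum {Ω ι E : Type*} [TopologicalSpace E] [AddCommMonoid E]
    [ContinuousAdd E] {m' mΩ : MeasurableSpace Ω} {Q : Measure[mΩ] Ω} {s : Finset ι}
    {f : ι → Ω → E} (hf : ∀ i ∈ s, AEStronglyMeasurable[m'] (f i) Q) :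
    AEStronglyMeasurable[m'] (fun ω => ∑ i ∈ s, f i ω) Q := by
  rw [← Finset.sum_fn]
  exact Finset.sum_induction f (AEStronglyMeasurable[m'] · Q) (fun _ _ hf hg => hf.add hg)
    stronglyMeasurable_zero.aestronglyMeasurable hf

namespace Run

section Iterates

variable {d n : ℕ} {μ : Measure (Vec d)} {F : Fin n → Vec d → ℝ} {D : Set (Vec d)}
  {ψ : Vec d → ℝ} {m : ℕ} {u L η : ℕ → ℝ} {Ω : Type*} {m' : MeasurableSpace Ω}
  [mΩ : MeasurableSpace Ω] {Q : Measure Ω} (run : Run μ F D ψ m u L η Q)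

/-- The averaged stochastic subgradient `g_t` of step `t`. -/
noncomputable def gbar (t : ℕ) (ω : Ω) : Vec d := (1 / (m : ℝ)) • ∑ j, run.g t j ω

/-- The weighted sum `∑ τ < t, g_τ / θ_τ` of subgradients, through which the past enters the
minimization problem defining `z_t`. -/
noncomputable def gsum (t : ℕ) (ω : Ω) : Vec d :=
  ∑ τ ∈ Finset.range t, (1 / theta τ) • run.gbar τ ω

/-- The draw `(Z_{j,t}, I_{j,t})`, indexed by the pair `p = (t, j)`. -/
def draw (p : ℕ × Fin m) (ω : Ω) : Vec d × Fin n := (run.Z p.1 p.2 ω, run.idx p.1 p.2 ω)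

/-- The `σ`-algebra generated by the draws with index in `A`; with `A = {p | p.1 < t}` it is the
information available before step `t`. -/
abbrev drawAlg (A : Set (ℕ × Fin m)) : MeasurableSpace Ω :=
  ⨆ p ∈ A, MeasurableSpace.comap (run.draw p) inferInstance

lemma measurable_draw (p : ℕ × Fin m) : Measurable (run.draw p) :=
  (run.Z_measurable _ _).prodMk (run.idx_measurable _ _)

lemma hasLaw_draw (p : ℕ × Fin m) : HasLaw (run.draw p) (μ.prod (uniformOn Set.univ)) Q :=
  ⟨(run.measurable_draw p).aemeasurable, run.law p.1 p.2⟩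

lemma drawAlg_le (A : Set (ℕ × Fin m)) : run.drawAlg A ≤ mΩ :=
  iSup₂_le fun p _ => (run.measurable_draw p).comap_le

lemma drawAlg_mono {A B : Set (ℕ × Fin m)} (h : A ⊆ B) : run.drawAlg A ≤ run.drawAlg B :=
  biSup_mono h

lemma measurable_draw_drawAlg {A : Set (ℕ × Fin m)} {p : ℕ × Fin m} (hp : p ∈ A) :
    Measurable[run.drawAlg A] (run.draw p) :=
  measurable_iff_comap_le.2 <|
    le_iSup₂ (f := fun p (_ : p ∈ A) => MeasurableSpace.comap (run.draw p) inferInstance) p hp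

lemma indep_drawAlg {A : Set (ℕ × Fin m)} {p : ℕ × Fin m} (hp : p ∉ A) :
    Indep (run.drawAlg A) (MeasurableSpace.comap (run.draw p) inferInstance) Q := by
  have hindep := indep_iSup_of_disjoint (fun p => (run.measurable_draw p).comap_le)
    run.indep.iIndep (S := A) (T := {p}) (Set.disjoint_singleton_right.2 hp)
  simpa only [Set.mem_singleton_iff, iSup_iSup_eq_left] using hindep

lemma exists_continuous_z_eq (hψ : ConvexOn ℝ D ψ)
    (hA : ∀ t, 0 < L (t + 1) + η (t + 1) / theta (t + 1)) (t : ℕ) :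
    ∃ φ : Vec d → Vec d, Continuous φ ∧ ∀ ω, run.z (t + 1) ω = φ (run.gsum (t + 1) ω) := by
  have hmin : ∀ ω, IsMinOn (fun v => ⟪run.gsum (t + 1) ω, v⟫
      + (∑ τ ∈ Finset.range (t + 1), 1 / theta τ) * ψ v
      + 1 / 2 * (L (t + 1) + η (t + 1) / theta (t + 1)) * ‖v‖ ^ 2) D (run.z (t + 1) ω) :=
    fun ω => by simpa only [gsum, gbar, sum_inner, real_inner_smul_left] using run.z_min t ω
  exact exists_continuous_factor (K := ⟨_, (one_div_pos.2 (hA t)).le⟩) fun ω ω' =>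
    norm_sub_le_of_isMinOn hψ (Finset.sum_nonneg fun τ _ => (one_div_theta_pos τ).le) (hA t)
      (run.z_mem t ω) (run.z_mem t ω') (hmin ω) (hmin ω')

lemma aestronglyMeasurable_iterates_of_g (hψ : ConvexOn ℝ D ψ)
    (hA : ∀ t, 0 < L (t + 1) + η (t + 1) / theta (t + 1)) {t : ℕ}
    (hg : ∀ τ < t, ∀ j, AEStronglyMeasurable[m'] (run.g τ j) Q) :
    AEStronglyMeasurable[m'] (run.x t) Q ∧ AEStronglyMeasurable[m'] (run.z t) Q := by
  induction t with
  | zero =>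
    rw [funext run.x_zero, funext run.z_zero]
    exact ⟨aestronglyMeasurable_const, aestronglyMeasurable_const⟩
  | succ t ih =>
    obtain ⟨hx, -⟩ := ih fun τ hτ => hg τ (by lia)
    have hgsum : AEStronglyMeasurable[m'] (run.gsum (t + 1)) Q :=
      aestronglyMeasurable_finsetSum fun τ hτ => ((aestronglyMeasurable_finsetSum fun j _ =>
        hg τ (Finset.mem_range.1 hτ) j).const_smul (1 / (m : ℝ))).const_smul (1 / theta τ)
    obtain ⟨φ, hφ, hz⟩ := run.exists_continuous_z_eq hψ hA t
    have hz' : AEStronglyMeasurable[m'] (run.z (t + 1)) Q := by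
      rw [funext hz]
      exact hφ.comp_aestronglyMeasurable hgsum
    rw [funext (run.x_eq t)]
    exact ⟨(hx.const_smul (1 - theta t)).add (hz'.const_smul (theta t)), hz'⟩

lemma aestronglyMeasurable_y_of_g (hψ : ConvexOn ℝ D ψ)
    (hA : ∀ t, 0 < L (t + 1) + η (t + 1) / theta (t + 1)) {t : ℕ}
    (hg : ∀ τ < t, ∀ j, AEStronglyMeasurable[m'] (run.g τ j) Q) :
    AEStronglyMeasurable[m'] (run.y t) Q := by
  obtain ⟨hx, hz⟩ := run.aestronglyMeasurable_iterates_of_g hψ hA hg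
  rw [funext (run.y_eq t)]
  exact (hx.const_smul (1 - theta t)).add (hz.const_smul (theta t))

lemma aestronglyMeasurable_x (hψ : ConvexOn ℝ D ψ)
    (hA : ∀ t, 0 < L (t + 1) + η (t + 1) / theta (t + 1)) (t : ℕ) :
    AEStronglyMeasurable (run.x t) Q :=
  (run.aestronglyMeasurable_iterates_of_g hψ hA fun τ _ j =>
    (run.g_measurable τ j).aestronglyMeasurable).1

lemma norm_g_le {K₀ : ℝ≥0} (hF : ∀ i, LipschitzWith K₀ (F i)) (t : ℕ) (j : Fin m) (ω : Ω) :
    ‖run.g t j ω‖ ≤ K₀ :=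
  (run.oracle t j ω).norm_le (hF _)

lemma norm_z_sub_le {R : ℝ} (hR : 0 ≤ R) (hD : D ⊆ Metric.closedBall 0 R) (w : Vec d) (t : ℕ)
    (ω : Ω) : ‖run.z t ω - w‖ ≤ R + ‖w‖ := by
  refine (norm_sub_le _ _).trans (add_le_add_left ?_ _)
  cases t with
  | zero => simpa only [run.z_zero, norm_zero] using hR
  | succ t => exact mem_closedBall_zero_iff.1 (hD (run.z_mem t ω))

end Iterates

section GradientNoise

variable {d n : ℕ} {μ : Measure (Vec d)} {loss : Fin n → ℝ → ℝ}
  {a : Fin n → Vec d} {D : Set (Vec d)} {ψ : Vec d → ℝ} {m : ℕ} {u L η : ℕ → ℝ} {Ω : Type*}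
  [mΩ : MeasurableSpace Ω] {Q : Measure Ω} (run : Run μ (linLoss loss a) D ψ m u L η Q)
  {K K₀ : ℝ≥0} {v : Fin n → ℝ≥0}

/-- The noise `∇f_u(y_t) - g_{j,t}` of a single stochastic subgradient. -/
noncomputable def noise (t : ℕ) (j : Fin m) (ω : Ω) : Vec d :=
  smoothGrad μ loss a (u t) (run.y t ω) - run.g t j ω

lemma smoothGrad_sub_gbar (hm : 1 ≤ m) (t : ℕ) (ω : Ω) :
    smoothGrad μ loss a (u t) (run.y t ω) - run.gbar t ω
      = (1 / (m : ℝ)) • ∑ j, run.noise t j ω := by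
  have hm' : (m : ℝ) ≠ 0 := by positivity
  simp only [noise, gbar, Finset.sum_sub_distrib, Finset.sum_const, Finset.card_univ,
    Fintype.card_fin, smul_sub]
  rw [← Nat.cast_smul_eq_nsmul ℝ, smul_smul, one_div_mul_cancel hm', one_smul]

lemma norm_sq_smoothGrad_sub_gbar (hm : 1 ≤ m) (t : ℕ) (ω : Ω) :
    ‖smoothGrad μ loss a (u t) (run.y t ω) - run.gbar t ω‖ ^ 2
      = (1 / (m : ℝ)) ^ 2 * ∑ j, ∑ k, ⟪run.noise t j ω, run.noise t k ω⟫ := by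
  rw [run.smoothGrad_sub_gbar hm, norm_smul, mul_pow, Real.norm_of_nonneg (by positivity),
    ← real_inner_self_eq_norm_sq, sum_inner]
  simp only [inner_sum]

variable [IsProbabilityMeasure μ]

lemma norm_noise_le (hl : ∀ i, LipschitzWith K (loss i))
    (hl₀ : ∀ i, LipschitzWith K₀ (linLoss loss a i)) (t : ℕ) (j : Fin m) (ω : Ω) :
    ‖run.noise t j ω‖ ≤ (1 / (n : ℝ)) * ∑ i, K * ‖a i‖ + K₀ :=
  (norm_sub_le _ _).trans (add_le_add (norm_smoothGrad_le hl _) (run.norm_g_le hl₀ t j ω))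

variable [IsProbabilityMeasure Q]

lemma g_ae_eq (hl : ∀ i, LipschitzWith K (loss i))
    (hμ : ∀ i, HasLaw (fun Z => ⟪a i, Z⟫) (gaussianReal 0 (v i)) μ) (hv : ∀ i, v i = 0 → a i = 0)
    (hu : ∀ t, 0 < u t) {A : Set (ℕ × Fin m)} {t : ℕ} {j : Fin m} (hp : (t, j) ∉ A)
    (hy : AEStronglyMeasurable[run.drawAlg A] (run.y t) Q) :
    run.g t j =ᵐ[Q] fun ω => lossGrad loss a (run.idx t j ω) (run.y t ω + u t • run.Z t j ω) :=
  ae_eq_lossGrad (ξ := run.draw (t, j)) hl hμ hv (hu t) (run.drawAlg_le A) hy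
    (run.hasLaw_draw _) (run.indep_drawAlg hp) (run.oracle t j)

lemma aestronglyMeasurable_g (hl : ∀ i, LipschitzWith K (loss i))
    (hμ : ∀ i, HasLaw (fun Z => ⟪a i, Z⟫) (gaussianReal 0 (v i)) μ) (hv : ∀ i, v i = 0 → a i = 0)
    (hu : ∀ t, 0 < u t) {A B : Set (ℕ × Fin m)} {t : ℕ} {j : Fin m} (hp : (t, j) ∉ A)
    (hAB : A ⊆ B) (hpB : (t, j) ∈ B) (hy : AEStronglyMeasurable[run.drawAlg A] (run.y t) Q) :
    AEStronglyMeasurable[run.drawAlg B] (run.g t j) Q := by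
  have hmk : Measurable[run.drawAlg B] (hy.mk (run.y t)) :=
    hy.measurable_mk.mono (run.drawAlg_mono hAB) le_rfl
  have hdraw := run.measurable_draw_drawAlg hpB
  refine ⟨_, ((measurable_lossGrad (loss := loss) (a := a)).comp ((hmk.add
    (hdraw.fst.const_smul (u t))).prodMk hdraw.snd)).stronglyMeasurable, ?_⟩
  filter_upwards [run.g_ae_eq hl hμ hv hu hp hy, hy.ae_eq_mk] with ω hg hmk_eq
  rw [hg, hmk_eq]
  rfl

variable (hψ : ConvexOn ℝ D ψ) (hA : ∀ t, 0 < L (t + 1) + η (t + 1) / theta (t + 1))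
  (hl : ∀ i, LipschitzWith K (loss i))
  (hμ : ∀ i, HasLaw (fun Z => ⟪a i, Z⟫) (gaussianReal 0 (v i)) μ) (hv : ∀ i, v i = 0 → a i = 0)
  (hu : ∀ t, 0 < u t)

include hψ hA hl hμ hv hu

lemma aestronglyMeasurable_g_of_lt (t : ℕ) :
    ∀ τ < t, ∀ j, AEStronglyMeasurable[run.drawAlg {p | p.1 < t}] (run.g τ j) Q := by
  induction t with
  | zero => simp
  | succ t ih =>
    intro τ hτ j
    have hsub : {p : ℕ × Fin m | p.1 < t} ⊆ {p | p.1 < t + 1} := fun p hp => Nat.lt_succ_of_lt hp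
    rcases Nat.lt_succ_iff_lt_or_eq.1 hτ with h | rfl
    · exact (ih τ h j).mono (run.drawAlg_mono hsub)
    · exact run.aestronglyMeasurable_g hl hμ hv hu (by simp) hsub (by simp)
        (run.aestronglyMeasurable_y_of_g hψ hA ih)

lemma aestronglyMeasurable_z (t : ℕ) :
    AEStronglyMeasurable[run.drawAlg {p | p.1 < t}] (run.z t) Q :=
  (run.aestronglyMeasurable_iterates_of_g hψ hA
    (run.aestronglyMeasurable_g_of_lt hψ hA hl hμ hv hu t)).2

lemma aestronglyMeasurable_y (t : ℕ) :
    AEStronglyMeasurable[run.drawAlg {p | p.1 < t}] (run.y t) Q :=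
  run.aestronglyMeasurable_y_of_g hψ hA (run.aestronglyMeasurable_g_of_lt hψ hA hl hμ hv hu t)

lemma aestronglyMeasurable_smoothGrad_y (t : ℕ) :
    AEStronglyMeasurable[run.drawAlg {p | p.1 < t}]
      (fun ω => smoothGrad μ loss a (u t) (run.y t ω)) Q := by
  have hy := run.aestronglyMeasurable_y hψ hA hl hμ hv hu t
  exact ⟨_, (measurable_smoothGrad.comp hy.measurable_mk).stronglyMeasurable,
    hy.ae_eq_mk.fun_comp (smoothGrad μ loss a (u t))⟩

lemma aestronglyMeasurable_noise_drawAlg {B : Set (ℕ × Fin m)} {t : ℕ} {j : Fin m}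
    (hsub : {p | p.1 < t} ⊆ B) (hpB : (t, j) ∈ B) :
    AEStronglyMeasurable[run.drawAlg B] (run.noise t j) Q :=
  ((run.aestronglyMeasurable_smoothGrad_y hψ hA hl hμ hv hu t).mono (run.drawAlg_mono hsub)).sub
    (run.aestronglyMeasurable_g hl hμ hv hu (by simp) hsub hpB
      (run.aestronglyMeasurable_y hψ hA hl hμ hv hu t))

lemma aestronglyMeasurable_noise (t : ℕ) (j : Fin m) : AEStronglyMeasurable (run.noise t j) Q :=
  (run.aestronglyMeasurable_noise_drawAlg hψ hA hl hμ hv hu (Set.subset_univ _)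
    (Set.mem_univ (t, j))).mono (run.drawAlg_le _)

variable (hl₀ : ∀ i, LipschitzWith K₀ (linLoss loss a i))

include hl₀

lemma integrable_inner_noise {t : ℕ} {j : Fin m} {W : Ω → Vec d} (hW : AEStronglyMeasurable W Q)
    {C : ℝ} (hWC : ∀ ω, ‖W ω‖ ≤ C) : Integrable (fun ω => ⟪run.noise t j ω, W ω⟫) Q :=
  Integrable.of_bound ((run.aestronglyMeasurable_noise hψ hA hl hμ hv hu t j).inner hW)
    (((1 / (n : ℝ)) * ∑ i, K * ‖a i‖ + K₀) * C) (ae_of_all _ fun ω =>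
      (norm_inner_le_norm _ _).trans (mul_le_mul (run.norm_noise_le hl hl₀ t j ω) (hWC ω)
        (norm_nonneg _) (by positivity)))

lemma integrable_inner_noise_noise (t : ℕ) (j k : Fin m) :
    Integrable (fun ω => ⟪run.noise t j ω, run.noise t k ω⟫) Q :=
  run.integrable_inner_noise hψ hA hl hμ hv hu hl₀
    (run.aestronglyMeasurable_noise hψ hA hl hμ hv hu t k) (run.norm_noise_le hl hl₀ t k)

lemma integral_inner_noise_eq_zero [NeZero n] {A : Set (ℕ × Fin m)} {t : ℕ} {j : Fin m}
    (hp : (t, j) ∉ A) (hsub : {p | p.1 < t} ⊆ A) {W : Ω → Vec d}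
    (hW : AEStronglyMeasurable[run.drawAlg A] W Q) {C : ℝ} (hWC : ∀ ω, ‖W ω‖ ≤ C) :
    ∫ ω, ⟪run.noise t j ω, W ω⟫ ∂Q = 0 := by
  have hy := (run.aestronglyMeasurable_y hψ hA hl hμ hv hu t).mono (run.drawAlg_mono hsub)
  have hW' : AEStronglyMeasurable W Q := hW.mono (run.drawAlg_le A)
  have hG := (run.aestronglyMeasurable_smoothGrad_y hψ hA hl hμ hv hu t).mono (run.drawAlg_le _)
  have hGint : Integrable (fun ω => ⟪smoothGrad μ loss a (u t) (run.y t ω), W ω⟫) Q :=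
    Integrable.of_bound (hG.inner hW') (((1 / (n : ℝ)) * ∑ i, K * ‖a i‖) * C) <|
      ae_of_all _ fun ω => (norm_inner_le_norm _ _).trans (mul_le_mul (norm_smoothGrad_le hl _)
        (hWC ω) (norm_nonneg _) (by positivity))
  have hgint : Integrable (fun ω => ⟪run.g t j ω, W ω⟫) Q :=
    Integrable.of_bound ((run.g_measurable t j).aestronglyMeasurable.inner hW') (K₀ * C) <|
      ae_of_all _ fun ω => (norm_inner_le_norm _ _).trans (mul_le_mul (run.norm_g_le hl₀ t j ω)
        (hWC ω) (norm_nonneg _) K₀.2)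
  have hunbiased : ∫ ω, ⟪run.g t j ω, W ω⟫ ∂Q
      = ∫ ω, ⟪smoothGrad μ loss a (u t) (run.y t ω), W ω⟫ ∂Q := by
    rw [← integral_inner_sampled_lossGrad hl (run.drawAlg_le A) hy hW hWC
      (run.hasLaw_draw (t, j)) (run.indep_drawAlg hp)]
    refine integral_congr_ae ?_
    filter_upwards [run.g_ae_eq hl hμ hv hu hp hy] with ω hg
    rw [hg, draw]
  simp only [noise, inner_sub_left]
  rw [integral_sub hGint hgint, hunbiased, sub_self]

lemma integral_inner_noise_noise_of_ne [NeZero n] (t : ℕ) {j k : Fin m} (hjk : j ≠ k) :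
    ∫ ω, ⟪run.noise t j ω, run.noise t k ω⟫ ∂Q = 0 := by
  have hsub : {p : ℕ × Fin m | p.1 < t} ⊆ {p | p.1 < t} ∪ {(t, k)} := Set.subset_union_left
  exact run.integral_inner_noise_eq_zero hψ hA hl hμ hv hu hl₀ (by simp [hjk]) hsub
    (run.aestronglyMeasurable_noise_drawAlg hψ hA hl hμ hv hu hsub (by simp))
    (run.norm_noise_le hl hl₀ t k)

lemma integral_norm_sq_noise_le [NeZero n] (t : ℕ) (j : Fin m) :
    ∫ ω, ⟪run.noise t j ω, run.noise t j ω⟫ ∂Q ≤ K₀ ^ 2 := by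
  have hG := run.aestronglyMeasurable_smoothGrad_y hψ hA hl hμ hv hu t
  have hGnorm : ∀ ω, ‖smoothGrad μ loss a (u t) (run.y t ω)‖ ≤ (1 / (n : ℝ)) * ∑ i, K * ‖a i‖ :=
    fun ω => norm_smoothGrad_le hl _
  have hcross := run.integral_inner_noise_eq_zero hψ hA hl hμ hv hu hl₀ (j := j) (by simp)
    subset_rfl hG hGnorm
  have hcross_int := run.integrable_inner_noise hψ hA hl hμ hv hu hl₀ (t := t) (j := j)
    (hG.mono (run.drawAlg_le _)) hGnorm
  have hsq_int := run.integrable_inner_noise_noise hψ hA hl hμ hv hu hl₀ t j j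
  calc ∫ ω, ⟪run.noise t j ω, run.noise t j ω⟫ ∂Q
      = ∫ ω, (⟪run.noise t j ω, run.noise t j ω⟫
          - 2 * ⟪run.noise t j ω, smoothGrad μ loss a (u t) (run.y t ω)⟫) ∂Q := by
        rw [integral_sub hsq_int (hcross_int.const_mul 2), integral_const_mul, hcross, mul_zero,
          sub_zero]
    _ ≤ ∫ _, (K₀ : ℝ) ^ 2 ∂Q := by
        refine integral_mono (hsq_int.sub (hcross_int.const_mul 2)) (integrable_const _)
          fun ω => ?_
        have hg := pow_le_pow_left₀ (norm_nonneg _) (run.norm_g_le hl₀ t j ω) 2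
        have hGsq := real_inner_self_nonneg (x := smoothGrad μ loss a (u t) (run.y t ω))
        rw [← real_inner_self_eq_norm_sq] at hg
        simp only [noise, inner_sub_left, inner_sub_right]
        rw [real_inner_comm (smoothGrad μ loss a (u t) (run.y t ω)) (run.g t j ω)]
        linarith
    _ = K₀ ^ 2 := by simp

lemma integrable_norm_sq_smoothGrad_sub_gbar (hm : 1 ≤ m) (t : ℕ) :
    Integrable (fun ω => ‖smoothGrad μ loss a (u t) (run.y t ω) - run.gbar t ω‖ ^ 2) Q := by
  simp_rw [run.norm_sq_smoothGrad_sub_gbar hm]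
  exact (integrable_finsetSum _ fun j _ => integrable_finsetSum _ fun k _ =>
    run.integrable_inner_noise_noise hψ hA hl hμ hv hu hl₀ t j k).const_mul _

lemma integral_norm_sq_smoothGrad_sub_gbar_le [NeZero n] (hm : 1 ≤ m) (t : ℕ) :
    ∫ ω, ‖smoothGrad μ loss a (u t) (run.y t ω) - run.gbar t ω‖ ^ 2 ∂Q ≤ K₀ ^ 2 / m := by
  have hint := run.integrable_inner_noise_noise hψ hA hl hμ hv hu hl₀ t
  have hrow : ∀ j : Fin m, ∫ ω, ∑ k, ⟪run.noise t j ω, run.noise t k ω⟫ ∂Q ≤ K₀ ^ 2 := by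
    intro j
    rw [integral_finsetSum _ fun k _ => hint j k, Finset.sum_eq_single j (fun k _ hkj =>
      run.integral_inner_noise_noise_of_ne hψ hA hl hμ hv hu hl₀ t hkj.symm) (by simp)]
    exact run.integral_norm_sq_noise_le hψ hA hl hμ hv hu hl₀ t j
  calc ∫ ω, ‖smoothGrad μ loss a (u t) (run.y t ω) - run.gbar t ω‖ ^ 2 ∂Q
      = (1 / (m : ℝ)) ^ 2 * ∑ j, ∫ ω, ∑ k, ⟪run.noise t j ω, run.noise t k ω⟫ ∂Q := by
        simp_rw [run.norm_sq_smoothGrad_sub_gbar hm]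
        rw [integral_const_mul,
          integral_finsetSum _ fun j _ => integrable_finsetSum _ fun k _ => hint j k]
    _ ≤ (1 / (m : ℝ)) ^ 2 * ∑ _j : Fin m, (K₀ : ℝ) ^ 2 := by
        gcongr _ * ∑ j, ?_ with j
        exact hrow j
    _ = K₀ ^ 2 / m := by
        have hm' : (m : ℝ) ≠ 0 := by positivity
        simp only [Finset.sum_const, Finset.card_univ, Fintype.card_fin, nsmul_eq_mul]
        field_simp

lemma integrable_inner_smoothGrad_sub_gbar (hm : 1 ≤ m) {R : ℝ} (hR : 0 ≤ R)
    (hD : D ⊆ Metric.closedBall 0 R) (w : Vec d) (t : ℕ) :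
    Integrable (fun ω => ⟪smoothGrad μ loss a (u t) (run.y t ω) - run.gbar t ω,
      run.z t ω - w⟫) Q := by
  have hz : AEStronglyMeasurable (fun ω => run.z t ω - w) Q :=
    ((run.aestronglyMeasurable_z hψ hA hl hμ hv hu t).mono (run.drawAlg_le _)).sub
      aestronglyMeasurable_const
  simp_rw [run.smoothGrad_sub_gbar hm, real_inner_smul_left, sum_inner]
  exact (integrable_finsetSum _ fun j _ => run.integrable_inner_noise hψ hA hl hμ hv hu hl₀
    hz (run.norm_z_sub_le hR hD w t)).const_mul _

lemma integral_inner_smoothGrad_sub_gbar [NeZero n] (hm : 1 ≤ m) {R : ℝ} (hR : 0 ≤ R)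
    (hD : D ⊆ Metric.closedBall 0 R) (w : Vec d) (t : ℕ) :
    ∫ ω, ⟪smoothGrad μ loss a (u t) (run.y t ω) - run.gbar t ω, run.z t ω - w⟫ ∂Q = 0 := by
  have hz : AEStronglyMeasurable[run.drawAlg {p | p.1 < t}] (fun ω => run.z t ω - w) Q :=
    (run.aestronglyMeasurable_z hψ hA hl hμ hv hu t).sub aestronglyMeasurable_const
  have hzR := run.norm_z_sub_le hR hD w t
  simp_rw [run.smoothGrad_sub_gbar hm, real_inner_smul_left, sum_inner]
  rw [integral_const_mul, integral_finsetSum _ fun j _ =>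
    run.integrable_inner_noise hψ hA hl hμ hv hu hl₀ (hz.mono (run.drawAlg_le _)) hzR,
    Finset.sum_eq_zero fun j _ => run.integral_inner_noise_eq_zero hψ hA hl hμ hv hu hl₀
      (by simp) subset_rfl hz hzR, mul_zero]

end GradientNoise

end Run

/-! ### The expected optimality gap -/

/-- The step sizes of accelerated dual averaging with randomized smoothing: radii `u t` decreasing
from `r` in proportion to `θ_t`, smoothness parameters `L t` inversely proportional to `u t`, and
regularization `η t` growing like `√t`. -/
structure IsStepSchedule (r B γ : ℝ) (u L η : ℕ → ℝ) : Prop where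
  u_eq : ∀ t, u t = theta t * r
  L_eq : ∀ t, L t = B / u t
  η_eq : ∀ t : ℕ, η t = γ * √((t : ℝ) + 1)

namespace IsStepSchedule

variable {r B γ : ℝ} {u L η : ℕ → ℝ} (hs : IsStepSchedule r B γ u L η)

include hs

lemma u_pos (hr : 0 < r) (t : ℕ) : 0 < u t := by
  rw [hs.u_eq]
  exact mul_pos (theta_pos t) hr

lemma u_antitone (hr : 0 < r) : Antitone u := by
  rw [funext hs.u_eq]
  exact theta_antitone.mul_const hr.le

lemma L_nonneg (hr : 0 < r) (hB : 0 ≤ B) (t : ℕ) : 0 ≤ L t := by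
  rw [hs.L_eq]
  exact div_nonneg hB (hs.u_pos hr t).le

lemma η_pos (hγ : 0 < γ) (t : ℕ) : 0 < η t := by
  rw [hs.η_eq]
  positivity

lemma regularization_pos (hr : 0 < r) (hB : 0 ≤ B) (hγ : 0 < γ) (t : ℕ) :
    0 < L t + η t / theta t :=
  add_pos_of_nonneg_of_pos (hs.L_nonneg hr hB t) (div_pos (hs.η_pos hγ t) (theta_pos t))

lemma regularization_eq (t : ℕ) :
    L t + η t / theta t = 1 / theta t * (B / r + γ * √((t : ℝ) + 1)) := by
  rw [hs.L_eq, hs.u_eq, hs.η_eq, mul_add, one_div_mul_eq_div, one_div_mul_eq_div, div_div,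
    mul_comm r]

lemma regularization_monotone (hr : 0 < r) (hB : 0 ≤ B) (hγ : 0 < γ) :
    Monotone fun t => L t + η t / theta t := by
  intro s t hst
  simp only [hs.regularization_eq]
  have hθ : 1 / theta s ≤ 1 / theta t := one_div_theta_monotone hst
  have hθ_pos := one_div_theta_pos t
  gcongr

lemma regularization_le (hr : 0 < r) (hB : 0 ≤ B) (hγ : 0 < γ) (t : ℕ) :
    L t + η t / theta t ≤ (t + 1) * (B / r + γ * √((t : ℝ) + 1)) := by
  rw [hs.regularization_eq]
  exact mul_le_mul_of_nonneg_right (one_div_theta_le t) (by positivity)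

lemma sum_div_le (hγ : 0 < γ) {s : ℝ} (hs₀ : 0 ≤ s) (T : ℕ) :
    ∑ τ ∈ Finset.range T, s / (2 * η τ * theta τ) ≤ T * √T * (s / (2 * γ)) := by
  have hterm : ∀ τ ∈ Finset.range T, s / (2 * η τ * theta τ) ≤ √T * (s / (2 * γ)) := by
    intro τ hτ
    have hτT : (τ : ℝ) + 1 ≤ T := by exact_mod_cast Finset.mem_range.1 hτ
    have hsqrt : 0 < √((τ : ℝ) + 1) := by positivity
    calc s / (2 * η τ * theta τ)
        = 1 / theta τ / √((τ : ℝ) + 1) * (s / (2 * γ)) := by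
          rw [hs.η_eq]
          field_simp
      _ ≤ √((τ : ℝ) + 1) * (s / (2 * γ)) := by
          gcongr
          rw [div_le_iff₀ hsqrt, Real.mul_self_sqrt (by positivity)]
          exact one_div_theta_le τ
      _ ≤ √T * (s / (2 * γ)) := by gcongr
  refine (Finset.sum_le_sum hterm).trans_eq ?_
  rw [Finset.sum_const, Finset.card_range, nsmul_eq_mul, mul_assoc]

end IsStepSchedule

lemma le_of_sq_mul_le {T q X a b k l : ℝ} (hT : 0 < T) (hq : (T + 1) / 2 ≤ q)
    (ha : 0 ≤ a) (hb : 0 ≤ b) (hk : 0 ≤ k) (hl : 0 ≤ l)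
    (hX : q ^ 2 * X ≤ (T + 1) / 2 * a + T * b + (T + 1) * √(T + 1) / 2 * k + T * √T / 2 * l) :
    X ≤ 2 * a / T + 4 * b / T + 2 * (k + l) / √T := by
  have hsqrt : 0 < √T := Real.sqrt_pos.2 hT
  have hsqrt_sq : √T * √T = T := Real.mul_self_sqrt hT.le
  have ha_coeff : (T + 1) / 2 ≤ (T + 1) ^ 2 / 4 * (2 / T) := by
    rw [mul_div_assoc', le_div_iff₀ hT]
    nlinarith
  have hb_coeff : T ≤ (T + 1) ^ 2 / 4 * (4 / T) := by
    rw [mul_div_assoc', le_div_iff₀ hT]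
    nlinarith
  have hk_coeff : (T + 1) * √(T + 1) / 2 ≤ (T + 1) ^ 2 / 4 * (2 / √T) := by
    have hsqrt_succ : √(T + 1) * √T ≤ T + 1 := by
      calc √(T + 1) * √T ≤ √(T + 1) * √(T + 1) := by gcongr; linarith
        _ = T + 1 := Real.mul_self_sqrt (by linarith)
    rw [mul_div_assoc', le_div_iff₀ hsqrt]
    nlinarith
  have hl_coeff : T * √T / 2 ≤ (T + 1) ^ 2 / 4 * (2 / √T) := by
    rw [mul_div_assoc', le_div_iff₀ hsqrt]
    nlinarith
  have hq_sq : (T + 1) ^ 2 / 4 ≤ q ^ 2 := by nlinarith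
  refine le_of_mul_le_mul_left ?_ (show 0 < q ^ 2 by nlinarith)
  calc q ^ 2 * X
      ≤ (T + 1) / 2 * a + T * b + (T + 1) * √(T + 1) / 2 * k + T * √T / 2 * l := hX
    _ ≤ (T + 1) ^ 2 / 4 * (2 / T) * a + (T + 1) ^ 2 / 4 * (4 / T) * b
        + (T + 1) ^ 2 / 4 * (2 / √T) * k + (T + 1) ^ 2 / 4 * (2 / √T) * l := by gcongr
    _ = (T + 1) ^ 2 / 4 * (2 * a / T + 4 * b / T + 2 * (k + l) / √T) := by ring
    _ ≤ q ^ 2 * (2 * a / T + 4 * b / T + 2 * (k + l) / √T) := by gcongr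

section ExpectedGap

variable {d n : ℕ} {μ : Measure (Vec d)} {loss : Fin n → ℝ → ℝ} {a : Fin n → Vec d}
  {K K₀ : ℝ≥0} {v : Fin n → ℝ≥0} {r B γ M R : ℝ} {u L η : ℕ → ℝ}

lemma isSmoothSequence_smoothRisk (hl : ∀ i, LipschitzWith K (loss i))
    (hc : ∀ i, ConvexOn ℝ Set.univ (loss i))
    (hμ : ∀ i, HasLaw (fun Z => ⟪a i, Z⟫) (gaussianReal 0 (v i)) μ) (hv : ∀ i, v i = 0 → a i = 0)
    (hM : ∀ h : Vec d, (1 / (n : ℝ)) * ∑ i, ⟪a i, h⟫ ^ 2 / √(v i) ≤ M * ‖h‖ ^ 2)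
    (hs : IsStepSchedule r B γ u L η) (hr : 0 < r) (hBM : 4 * K * M ≤ B) (x y : ℕ → Vec d) :
    IsSmoothSequence (fun t => smoothRisk μ loss a (u t))
      (fun t => smoothGrad μ loss a (u t) (y t)) L x y where
  add_inner_le t v := by
    simpa using smoothRisk_add_inner_smoothGrad_le hl hc hμ hv (hs.u_pos hr t) (y t) (v - y t)
  le_quadratic t := by
    have hquad := smoothRisk_le_quadratic hl hc hμ hv hM (hs.u_pos hr t) (y t) (x (t + 1) - y t)
    have hconst : 2 * K * M / u t ≤ L t / 2 := by
      have hu := hs.u_pos hr t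
      rw [hs.L_eq, div_div, mul_comm (u t), ← div_div]
      gcongr
      linarith
    rw [add_sub_cancel] at hquad
    exact hquad.trans (by gcongr)
  succ_le t v := smoothRisk_mono_radius hl hc hμ (hs.u_pos hr _).le (hs.u_antitone hr t.le_succ) v

namespace Run

variable {D : Set (Vec d)} {ψ : Vec d → ℝ} {m : ℕ} {Ω : Type*} [MeasurableSpace Ω] {Q : Measure Ω}
  {w : Vec d}

lemma isAcceleratedScheme {F : Fin n → Vec d → ℝ} (run : Run μ F D ψ m u L η Q) (ω : Ω) :
    IsAcceleratedScheme D (fun t => run.x t ω) (fun t => run.y t ω) (fun t => run.z t ω) where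
  z_zero := run.z_zero ω
  z_mem t := run.z_mem t ω
  y_eq t := run.y_eq t ω
  x_eq t := run.x_eq t ω

variable (run : Run μ (linLoss loss a) D ψ m u L η Q)

lemma aestronglyMeasurable_gap (hψ : ConvexOn ℝ D ψ)
    (hA : ∀ t, 0 < L (t + 1) + η (t + 1) / theta (t + 1)) (hψm : Measurable fun v : D => ψ v)
    (hl : ∀ i, LipschitzWith K (loss i)) (w : Vec d) (t : ℕ) :
    AEStronglyMeasurable (fun ω => empRisk loss a (run.x (t + 1) ω) + ψ (run.x (t + 1) ω)
      - empRisk loss a w - ψ w) Q := by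
  have hx : AEMeasurable (run.x (t + 1)) Q :=
    (run.aestronglyMeasurable_x hψ hA (t + 1)).aemeasurable
  have hψx : AEMeasurable (fun ω => ψ (run.x (t + 1) ω)) Q :=
    hψm.comp_aemeasurable
      (hx.subtype_mk (hfs := fun ω => (run.isAcceleratedScheme ω).x_mem hψ.1 t))
  have hrisk : Continuous (empRisk loss a) := by
    unfold empRisk linLoss
    exact continuous_const.mul <|
      continuous_finsetSum _ fun i _ => (hl i).continuous.comp (by fun_prop)
  exact (((hrisk.measurable.comp_aemeasurable hx).add hψx).sub_const _ |>.sub_const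
    _).aestronglyMeasurable

variable [IsProbabilityMeasure μ]

section Expectation

variable [IsProbabilityMeasure Q] (hψ : ConvexOn ℝ D ψ)
  (hA : ∀ t, 0 < L (t + 1) + η (t + 1) / theta (t + 1)) (hl : ∀ i, LipschitzWith K (loss i))
  (hμ : ∀ i, HasLaw (fun Z => ⟪a i, Z⟫) (gaussianReal 0 (v i)) μ) (hv : ∀ i, v i = 0 → a i = 0)
  (hu : ∀ t, 0 < u t) (hl₀ : ∀ i, LipschitzWith K₀ (linLoss loss a i)) (hm : 1 ≤ m) (hR : 0 ≤ R)
  (hD : D ⊆ Metric.closedBall 0 R)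

include hψ hA hl hμ hv hu hl₀ hm hR hD

lemma integrable_noise_terms (b c : ℕ → ℝ) (w : Vec d) (T : ℕ) :
    Integrable (fun ω =>
      ∑ τ ∈ Finset.range T, ‖smoothGrad μ loss a (u τ) (run.y τ ω) - run.gbar τ ω‖ ^ 2 / b τ
        + ∑ τ ∈ Finset.range T, c τ
          * ⟪smoothGrad μ loss a (u τ) (run.y τ ω) - run.gbar τ ω, run.z τ ω - w⟫) Q :=
  (integrable_finsetSum _ fun τ _ => (run.integrable_norm_sq_smoothGrad_sub_gbar hψ hA hl hμ hv hu
    hl₀ hm τ).div_const _).add (integrable_finsetSum _ fun τ _ =>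
      (run.integrable_inner_smoothGrad_sub_gbar hψ hA hl hμ hv hu hl₀ hm hR hD w τ).const_mul _)

lemma integral_noise_terms_le [NeZero n] {b : ℕ → ℝ} (hb : ∀ τ, 0 ≤ b τ) (c : ℕ → ℝ) (w : Vec d)
    (T : ℕ) :
    ∫ ω, (∑ τ ∈ Finset.range T, ‖smoothGrad μ loss a (u τ) (run.y τ ω) - run.gbar τ ω‖ ^ 2 / b τ
        + ∑ τ ∈ Finset.range T, c τ
          * ⟪smoothGrad μ loss a (u τ) (run.y τ ω) - run.gbar τ ω, run.z τ ω - w⟫) ∂Q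
      ≤ ∑ τ ∈ Finset.range T, (K₀ ^ 2 / m) / b τ := by
  have hsq := fun τ (_ : τ ∈ Finset.range T) =>
    (run.integrable_norm_sq_smoothGrad_sub_gbar hψ hA hl hμ hv hu hl₀ hm τ).div_const (b τ)
  have hinner := fun τ (_ : τ ∈ Finset.range T) =>
    (run.integrable_inner_smoothGrad_sub_gbar hψ hA hl hμ hv hu hl₀ hm hR hD w τ).const_mul (c τ)
  rw [integral_add (integrable_finsetSum _ hsq) (integrable_finsetSum _ hinner),
    integral_finsetSum _ hsq, integral_finsetSum _ hinner]
  simp only [integral_div, integral_const_mul,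
    run.integral_inner_smoothGrad_sub_gbar hψ hA hl hμ hv hu hl₀ hm hR hD w, mul_zero,
    Finset.sum_const_zero, add_zero]
  gcongr with τ
  · exact hb τ
  · exact run.integral_norm_sq_smoothGrad_sub_gbar_le hψ hA hl hμ hv hu hl₀ hm τ

end Expectation

variable (hψ : ConvexOn ℝ D ψ)
  (hl : ∀ i, LipschitzWith K (loss i)) (hc : ∀ i, ConvexOn ℝ Set.univ (loss i))
  (hμ : ∀ i, HasLaw (fun Z => ⟪a i, Z⟫) (gaussianReal 0 (v i)) μ) (hv : ∀ i, v i = 0 → a i = 0)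
  (hM : ∀ h : Vec d, (1 / (n : ℝ)) * ∑ i, ⟪a i, h⟫ ^ 2 / √(v i) ≤ M * ‖h‖ ^ 2)
  (hs : IsStepSchedule r B γ u L η) (hr : 0 < r) (hB : 0 ≤ B) (hBM : 4 * K * M ≤ B) (hγ : 0 < γ)
  (hw : w ∈ D)

include hψ hl hc hμ hv hM hs hr hB hBM hγ hw

lemma weighted_gap_le (t : ℕ) (ω : Ω) :
    (1 / theta t) ^ 2 * (empRisk loss a (run.x (t + 1) ω) + ψ (run.x (t + 1) ω)
      - empRisk loss a w - ψ w)
      ≤ 1 / 2 * (L (t + 1) + η (t + 1) / theta (t + 1)) * ‖w‖ ^ 2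
        + (t + 1) * (r * (K * ((1 / (n : ℝ)) * ∑ i, √(v i))))
        + ∑ τ ∈ Finset.range (t + 1), ‖smoothGrad μ loss a (u τ) (run.y τ ω) - run.gbar τ ω‖ ^ 2
            / (2 * η τ * theta τ)
        + ∑ τ ∈ Finset.range (t + 1), 1 / theta τ
            * ⟪smoothGrad μ loss a (u τ) (run.y τ ω) - run.gbar τ ω, run.z τ ω - w⟫ := by
  have hbias : ∀ t, smoothRisk μ loss a (u t) w
      ≤ empRisk loss a w + theta t * (r * (K * ((1 / (n : ℝ)) * ∑ i, √(v i)))) := fun t => by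
    simpa only [hs.u_eq, mul_assoc] using smoothRisk_le_empRisk_add hl hμ (hs.u_pos hr t).le w
  have hsmoothed := dual_averaging_inequality (run.isAcceleratedScheme ω)
    (isSmoothSequence_smoothRisk hl hc hμ hv hM hs hr hBM _ _) hψ (hs.η_pos hγ) (fun _ => rfl)
    (hs.regularization_monotone hr hB hγ) (fun t => run.z_min t ω) hw hbias t
  have hrisk := empRisk_le_smoothRisk hl hc hμ (hs.u_pos hr t).le (run.x (t + 1) ω)
  refine le_trans ?_ hsmoothed
  gcongr

variable [IsProbabilityMeasure Q] (hψm : Measurable fun v : D => ψ v)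
  (hl₀ : ∀ i, LipschitzWith K₀ (linLoss loss a i)) (hm : 1 ≤ m) (hR : 0 ≤ R)
  (hD : D ⊆ Metric.closedBall 0 R) (hmin : IsMinOn (fun v => empRisk loss a v + ψ v) D w)

include hψm hl₀ hm hR hD hmin

lemma integrable_gap (t : ℕ) :
    Integrable (fun ω => empRisk loss a (run.x (t + 1) ω) + ψ (run.x (t + 1) ω)
      - empRisk loss a w - ψ w) Q := by
  have hA := fun t => hs.regularization_pos hr hB hγ (t + 1)
  have hnonneg : ∀ ω, 0 ≤ empRisk loss a (run.x (t + 1) ω) + ψ (run.x (t + 1) ω)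
      - empRisk loss a w - ψ w := fun ω => by
    have hopt := isMinOn_iff.1 hmin _ ((run.isAcceleratedScheme ω).x_mem hψ.1 t)
    linarith
  have hθ := one_div_theta_pos t
  have hbound := run.integrable_noise_terms hψ hA hl hμ hv (hs.u_pos hr) hl₀ hm hR hD
    (fun τ => 2 * η τ * theta τ) (fun τ => 1 / theta τ) w (t + 1)
  refine (integrable_const_mul_iff (IsUnit.mk0 ((1 / theta t) ^ 2) (by positivity)) _).1 <|
    ((integrable_const (1 / 2 * (L (t + 1) + η (t + 1) / theta (t + 1)) * ‖w‖ ^ 2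
      + (t + 1) * (r * (K * ((1 / (n : ℝ)) * ∑ i, √(v i)))))).add hbound).mono'
      ((run.aestronglyMeasurable_gap hψ hA hψm hl w t).const_mul _) (ae_of_all _ fun ω => ?_)
  rw [Real.norm_of_nonneg (mul_nonneg (sq_nonneg _) (hnonneg ω)), Pi.add_apply, ← add_assoc]
  exact run.weighted_gap_le hψ hl hc hμ hv hM hs hr hB hBM hγ hw t ω

lemma weighted_integral_gap_le [NeZero n] (t : ℕ) :
    (1 / theta t) ^ 2 * ∫ ω, (empRisk loss a (run.x (t + 1) ω) + ψ (run.x (t + 1) ω)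
      - empRisk loss a w - ψ w) ∂Q
      ≤ 1 / 2 * (L (t + 1) + η (t + 1) / theta (t + 1)) * R ^ 2
        + (t + 1) * (r * (K * ((1 / (n : ℝ)) * ∑ i, √(v i))))
        + ∑ τ ∈ Finset.range (t + 1), (K₀ ^ 2 / m) / (2 * η τ * theta τ) := by
  have hA := fun t => hs.regularization_pos hr hB hγ (t + 1)
  set C := 1 / 2 * (L (t + 1) + η (t + 1) / theta (t + 1)) * ‖w‖ ^ 2
    + (t + 1) * (r * (K * ((1 / (n : ℝ)) * ∑ i, √(v i : ℝ)))) with hC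
  have hgap := run.integrable_gap hψ hl hc hμ hv hM hs hr hB hBM hγ hw hψm hl₀ hm hR hD hmin t
  have hnoise := run.integrable_noise_terms hψ hA hl hμ hv (hs.u_pos hr) hl₀ hm hR hD
    (fun τ => 2 * η τ * theta τ) (fun τ => 1 / theta τ) w (t + 1)
  have hnoise_le := run.integral_noise_terms_le hψ hA hl hμ hv (hs.u_pos hr) hl₀ hm hR hD
    (b := fun τ => 2 * η τ * theta τ) (fun τ => by
      have := hs.η_pos hγ τ
      have := theta_pos τ
      positivity) (fun τ => 1 / theta τ) w (t + 1)
  have hwR : ‖w‖ ≤ R := mem_closedBall_zero_iff.1 (hD hw)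
  have hA_pos := hA t
  have hint := integral_mono (hgap.const_mul ((1 / theta t) ^ 2)) ((integrable_const C).add hnoise)
    fun ω => (run.weighted_gap_le hψ hl hc hμ hv hM hs hr hB hBM hγ hw t ω).trans_eq
      (add_assoc _ _ _)
  simp only [Pi.add_apply] at hint
  rw [integral_const_mul, integral_add (integrable_const C) hnoise, integral_const, probReal_univ,
    one_smul] at hint
  refine hint.trans (add_le_add ?_ hnoise_le)
  rw [hC]
  gcongr

theorem integral_gap_le [NeZero n] {T : ℕ} (hT : 1 ≤ T) :
    ∫ ω, (empRisk loss a (run.x T ω) + ψ (run.x T ω) - empRisk loss a w - ψ w) ∂Q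
      ≤ 2 * (B * R ^ 2 / r) / T + 4 * (r * (K * ((1 / (n : ℝ)) * ∑ i, √(v i)))) / T
        + 2 * (γ * R ^ 2 + K₀ ^ 2 / (m * γ)) / √T := by
  obtain ⟨t, rfl⟩ := Nat.exists_eq_add_of_le' hT
  have hreg := hs.regularization_le hr hB hγ (t + 1)
  have hnoise := hs.sum_div_le hγ (show (0 : ℝ) ≤ K₀ ^ 2 / m by positivity) (t + 1)
  have hweighted :=
    run.weighted_integral_gap_le hψ hl hc hμ hv hM hs hr hB hBM hγ hw hψm hl₀ hm hR hD hmin t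
  refine le_of_sq_mul_le (q := 1 / theta t) (by positivity) ?_ (by positivity) (by positivity)
    (by positivity) (by positivity) (hweighted.trans ?_)
  · refine le_trans (le_of_eq ?_) (le_one_div_theta t)
    push_cast
    ring
  · calc _ ≤ 1 / 2 * (((t + 1 : ℕ) + 1) * (B / r + γ * √((t + 1 : ℕ) + 1))) * R ^ 2
          + (t + 1) * (r * (K * ((1 / (n : ℝ)) * ∑ i, √(v i))))
          + (t + 1 : ℕ) * √(t + 1 : ℕ) * (K₀ ^ 2 / m / (2 * γ)) := by gcongr
      _ = _ := by
        push_cast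
        field_simp
        ring

end Run

end ExpectedGap

/-! ### Exponential moments of variables with Gaussian tails -/

section GaussianTail

lemma hasDerivAt_exp_sq_div (c t : ℝ) :
    HasDerivAt (fun t : ℝ => Real.exp (t ^ 2 / c)) (2 * t / c * Real.exp (t ^ 2 / c)) t := by
  have h := ((hasDerivAt_pow 2 t).div_const c).exp
  convert h using 1
  push_cast
  ring

lemma integral_mul_exp_sq_div (c x : ℝ) :
    ∫ t in 0..x, 2 * t / c * Real.exp (t ^ 2 / c) = Real.exp (x ^ 2 / c) - 1 := by
  have hcont : Continuous fun t : ℝ => 2 * t / c * Real.exp (t ^ 2 / c) := by fun_prop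
  rw [intervalIntegral.integral_eq_sub_of_hasDerivAt (fun t _ => hasDerivAt_exp_sq_div c t)
    (hcont.intervalIntegrable _ _)]
  simp

lemma lintegral_Ioi_mul_exp_neg_sq_div {c : ℝ} (hc : 0 < c) :
    ∫⁻ t in Set.Ioi 0, ENNReal.ofReal (2 * t / c * Real.exp (-(t ^ 2 / c))) = 1 := by
  have hderiv : ∀ t ∈ Set.Ici (0 : ℝ), HasDerivAt (fun t : ℝ => -Real.exp (t ^ 2 / (-c)))
      (2 * t / c * Real.exp (-(t ^ 2 / c))) t := fun t _ => by
    refine (hasDerivAt_exp_sq_div (-c) t).fun_neg.congr_deriv ?_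
    simp only [div_neg, neg_mul, neg_neg]
  have hnonneg : ∀ t ∈ Set.Ioi (0 : ℝ), 0 ≤ 2 * t / c * Real.exp (-(t ^ 2 / c)) :=
    fun t ht => by
      have : 0 < t := ht
      positivity
  have hlim : Filter.Tendsto (fun t : ℝ => -Real.exp (t ^ 2 / (-c))) Filter.atTop (nhds 0) := by
    have hsq : Filter.Tendsto (fun t : ℝ => t ^ 2 / c) Filter.atTop Filter.atTop :=
      (Filter.tendsto_pow_atTop two_ne_zero).atTop_div_const hc
    simpa [div_neg, Function.comp_def] using (Real.tendsto_exp_neg_atTop_nhds_zero.comp hsq).neg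
  rw [← ofReal_integral_eq_lintegral_ofReal (integrableOn_Ioi_deriv_of_nonneg' hderiv hnonneg hlim)
    ((ae_restrict_mem measurableSet_Ioi).mono hnonneg),
    integral_Ioi_of_hasDerivAt_of_nonneg' hderiv hnonneg hlim]
  simp

variable {Ω : Type*} [MeasurableSpace Ω] {P : Measure Ω}

/-- `X` has Gaussian tails of variance proxy `s`: `P(|X| > t) ≤ 2 exp(-t² / (2s))` for all
`t > 0`. For `s = 0` the division by zero makes this no condition at all. -/
def HasGaussianTail (X : Ω → ℝ) (s : ℝ) (P : Measure Ω) : Prop :=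
  ∀ t, 0 < t → P.real {ω | t < |X ω|} ≤ 2 * Real.exp (-(1 / 2) * (t ^ 2 / s))

lemma HasGaussianTail.meas_mul_le [IsFiniteMeasure P] {X : Ω → ℝ} {s : ℝ}
    (htail : HasGaussianTail X s P) {t : ℝ} (ht : 0 < t) :
    P {ω | t < |X ω|} * ENNReal.ofReal (2 * t / (4 * s) * Real.exp (t ^ 2 / (4 * s)))
      ≤ 2 * ENNReal.ofReal (2 * t / (4 * s) * Real.exp (-(t ^ 2 / (4 * s)))) := by
  calc P {ω | t < |X ω|} * ENNReal.ofReal (2 * t / (4 * s) * Real.exp (t ^ 2 / (4 * s)))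
      ≤ ENNReal.ofReal (2 * Real.exp (-(1 / 2) * (t ^ 2 / s)))
          * ENNReal.ofReal (2 * t / (4 * s) * Real.exp (t ^ 2 / (4 * s))) := by
        gcongr
        rw [← ofReal_measureReal]
        exact ENNReal.ofReal_le_ofReal (htail t ht)
    _ = 2 * ENNReal.ofReal (2 * t / (4 * s) * Real.exp (-(t ^ 2 / (4 * s)))) := by
        have hexp : Real.exp (-(t ^ 2 / (4 * s)))
            = Real.exp (-(1 / 2) * (t ^ 2 / s)) * Real.exp (t ^ 2 / (4 * s)) := by
          rw [← Real.exp_add]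
          ring_nf
        rw [hexp, ← ENNReal.ofReal_mul (by positivity), ← ENNReal.ofReal_ofNat 2,
          ← ENNReal.ofReal_mul zero_le_two]
        ring_nf

lemma HasGaussianTail.lintegral_exp_sq_div_le [IsProbabilityMeasure P] {X : Ω → ℝ} {s : ℝ}
    (hX : AEMeasurable X P) (hs : 0 < s) (htail : HasGaussianTail X s P) :
    ∫⁻ ω, ENNReal.ofReal (Real.exp (X ω ^ 2 / (4 * s))) ∂P ≤ 3 := by
  have hcont : Continuous fun t : ℝ => 2 * t / (4 * s) * Real.exp (t ^ 2 / (4 * s)) := by fun_prop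
  have hlayer := lintegral_comp_eq_lintegral_meas_lt_mul P (f := fun ω => |X ω|)
    (ae_of_all _ fun ω => abs_nonneg _) (by fun_prop)
    (fun t _ => hcont.intervalIntegrable 0 t)
    ((ae_restrict_mem measurableSet_Ioi).mono fun t ht => by
      have : 0 < t := ht
      positivity)
  simp only [integral_mul_exp_sq_div, sq_abs] at hlayer
  have hsplit : ∀ ω, ENNReal.ofReal (Real.exp (X ω ^ 2 / (4 * s)))
      = ENNReal.ofReal (Real.exp (X ω ^ 2 / (4 * s)) - 1) + 1 := fun ω => by
    rw [← ENNReal.ofReal_one, ← ENNReal.ofReal_add _ zero_le_one, sub_add_cancel]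
    exact sub_nonneg.2 (Real.one_le_exp (by positivity))
  simp_rw [hsplit]
  rw [lintegral_add_right _ measurable_const, hlayer, lintegral_const, measure_univ, one_mul]
  calc (∫⁻ t in Set.Ioi 0, P {ω | t < |X ω|}
          * ENNReal.ofReal (2 * t / (4 * s) * Real.exp (t ^ 2 / (4 * s)))) + 1
      ≤ (∫⁻ t in Set.Ioi 0,
          2 * ENNReal.ofReal (2 * t / (4 * s) * Real.exp (-(t ^ 2 / (4 * s))))) + 1 := by
        gcongr ?_ + 1
        exact setLIntegral_mono' measurableSet_Ioi fun t ht => htail.meas_mul_le ht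
    _ = 3 := by
        rw [lintegral_const_mul' _ _ ENNReal.ofNat_ne_top,
          lintegral_Ioi_mul_exp_neg_sq_div (by positivity)]
        norm_num

lemma HasGaussianTail.lintegral_exp_abs_le [IsProbabilityMeasure P] {X : Ω → ℝ} {s : ℝ}
    (hX : AEMeasurable X P) (hs : 0 < s) (htail : HasGaussianTail X s P) :
    ∫⁻ ω, ENNReal.ofReal (Real.exp |X ω|) ∂P ≤ 3 * ENNReal.ofReal (Real.exp s) := by
  calc ∫⁻ ω, ENNReal.ofReal (Real.exp |X ω|) ∂P
      ≤ ∫⁻ ω, ENNReal.ofReal (Real.exp (X ω ^ 2 / (4 * s))) * ENNReal.ofReal (Real.exp s) ∂P := by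
        refine lintegral_mono fun ω => ?_
        rw [← ENNReal.ofReal_mul (Real.exp_pos _).le, ← Real.exp_add]
        refine ENNReal.ofReal_le_ofReal (Real.exp_le_exp.2 ?_)
        have hsq : X ω ^ 2 / (4 * s) + s - |X ω| = (|X ω| - 2 * s) ^ 2 / (4 * s) := by
          rw [← sq_abs (X ω)]
          field
        have hnonneg : 0 ≤ (|X ω| - 2 * s) ^ 2 / (4 * s) := by positivity
        linarith
    _ ≤ 3 * ENNReal.ofReal (Real.exp s) := by
        rw [lintegral_mul_const' _ _ ENNReal.ofReal_ne_top]
        gcongr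
        exact htail.lintegral_exp_sq_div_le hX hs

lemma measure_lt_le_lintegral_exp_mul {X : Ω → ℝ} (hX : AEMeasurable X P) (t : ℝ) :
    P {ω | t < X ω} ≤ (∫⁻ ω, ENNReal.ofReal (Real.exp (X ω)) ∂P) * ENNReal.ofReal (Real.exp (-t)) :=
  calc P {ω | t < X ω}
      ≤ P {ω | ENNReal.ofReal (Real.exp t) ≤ ENNReal.ofReal (Real.exp (X ω))} :=
        measure_mono fun ω hω => ENNReal.ofReal_le_ofReal (Real.exp_le_exp.2 (le_of_lt hω))
    _ ≤ (∫⁻ ω, ENNReal.ofReal (Real.exp (X ω)) ∂P) / ENNReal.ofReal (Real.exp t) :=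
        meas_ge_le_lintegral_div (by fun_prop) (by simp [Real.exp_pos]) ENNReal.ofReal_ne_top
    _ = (∫⁻ ω, ENNReal.ofReal (Real.exp (X ω)) ∂P) * ENNReal.ofReal (Real.exp (-t)) := by
        rw [Real.exp_neg, ENNReal.ofReal_inv_of_pos (Real.exp_pos t), ENNReal.div_eq_inv_mul,
          mul_comm]

lemma measure_lt_average_sq_le [IsProbabilityMeasure P] {n : ℕ} [NeZero n] {X : Fin n → Ω → ℝ}
    (hX : ∀ i, AEMeasurable (X i) P) {s : ℝ} (hs : 0 < s)
    (htail : ∀ i, HasGaussianTail (X i) s P) (l : ℝ) :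
    P {ω | 4 * l * s < (1 / (n : ℝ)) * ∑ i, X i ω ^ 2} ≤ 3 * ENNReal.ofReal (Real.exp (-l)) := by
  have hw : ∑ _i : Fin n, 1 / (n : ℝ) = 1 := by simp
  have hset : {ω | 4 * l * s < (1 / (n : ℝ)) * ∑ i, X i ω ^ 2}
      = {ω | l < ∑ i, (1 / (n : ℝ)) * (X i ω ^ 2 / (4 * s))} := by
    ext ω
    simp only [Set.mem_ofPred_eq]
    rw [← Finset.mul_sum, ← Finset.sum_div, ← mul_div_assoc, lt_div_iff₀ (by positivity)]
    ring_nf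
  have hjensen : ∀ ω, ENNReal.ofReal (Real.exp (∑ i, (1 / (n : ℝ)) * (X i ω ^ 2 / (4 * s))))
      ≤ ∑ i, ENNReal.ofReal (1 / (n : ℝ)) * ENNReal.ofReal (Real.exp (X i ω ^ 2 / (4 * s))) := by
    intro ω
    simp_rw [← ENNReal.ofReal_mul (by positivity : (0 : ℝ) ≤ 1 / (n : ℝ))]
    rw [← ENNReal.ofReal_sum_of_nonneg fun i _ => by positivity]
    exact ENNReal.ofReal_le_ofReal (convexOn_exp.map_sum_le (fun i _ => by positivity) hw
      fun i _ => Set.mem_univ _)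
  rw [hset]
  refine (measure_lt_le_lintegral_exp_mul (by fun_prop) l).trans ?_
  gcongr
  calc ∫⁻ ω, ENNReal.ofReal (Real.exp (∑ i, (1 / (n : ℝ)) * (X i ω ^ 2 / (4 * s)))) ∂P
      ≤ ∑ i, ENNReal.ofReal (1 / (n : ℝ))
          * ∫⁻ ω, ENNReal.ofReal (Real.exp (X i ω ^ 2 / (4 * s))) ∂P := by
        refine (lintegral_mono hjensen).trans_eq ?_
        rw [lintegral_finsetSum' _ fun i _ => by fun_prop]
        exact Finset.sum_congr rfl fun i _ => lintegral_const_mul' _ _ ENNReal.ofReal_ne_top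
    _ ≤ ∑ _i : Fin n, ENNReal.ofReal (1 / (n : ℝ)) * 3 := by
        gcongr with i
        exact (htail i).lintegral_exp_sq_div_le (hX i) hs
    _ = 3 := by
        rw [← Finset.sum_mul, ← ENNReal.ofReal_sum_of_nonneg fun i _ => by positivity, hw,
          ENNReal.ofReal_one, one_mul]

end GaussianTail

section GaussianLinearization

lemma lintegral_exp_mul_gaussianReal (c : ℝ) :
    ∫⁻ x, ENNReal.ofReal (Real.exp (c * x)) ∂(gaussianReal 0 1)
      = ENNReal.ofReal (Real.exp (c ^ 2 / 2)) := by
  rw [← ofReal_integral_eq_lintegral_ofReal (integrable_exp_mul_gaussianReal c)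
    (ae_of_all _ fun x => (Real.exp_pos _).le)]
  have hmgf := congr_fun (mgf_fun_id_gaussianReal (μ := 0) (v := 1)) c
  rw [mgf] at hmgf
  rw [hmgf]
  simp

lemma lintegral_exp_sq_div_gaussianReal_le :
    ∫⁻ x, ENNReal.ofReal (Real.exp (x ^ 2 / 4)) ∂(gaussianReal 0 1) ≤ 2 := by
  have hint : Integrable fun x : ℝ => (√(2 * Real.pi))⁻¹ * Real.exp (-(1 / 4) * x ^ 2) :=
    (integrable_exp_neg_mul_sq (by norm_num)).const_mul _
  have hdensity : ∀ x, (gaussianPDF 0 1 * fun x => ENNReal.ofReal (Real.exp (x ^ 2 / 4))) x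
      = ENNReal.ofReal ((√(2 * Real.pi))⁻¹ * Real.exp (-(1 / 4) * x ^ 2)) := fun x => by
    rw [Pi.mul_apply, gaussianPDF, ← ENNReal.ofReal_mul (gaussianPDFReal_nonneg _ _ _),
      gaussianPDFReal, mul_assoc, ← Real.exp_add]
    simp only [NNReal.coe_one, mul_one, sub_zero]
    ring_nf
  rw [gaussianReal_of_var_ne_zero 0 one_ne_zero, lintegral_withDensity_eq_lintegral_mul _
    (measurable_gaussianPDF 0 1) (by fun_prop), lintegral_congr hdensity,
    ← ofReal_integral_eq_lintegral_ofReal hint (ae_of_all _ fun x => by positivity),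
    integral_const_mul, integral_gaussian]
  refine ENNReal.ofReal_le_of_le_toReal ?_
  rw [← Real.sqrt_inv, ← Real.sqrt_mul (by positivity), ENNReal.toReal_ofNat]
  refine Real.sqrt_le_iff.2 ⟨zero_le_two, ?_⟩
  have := Real.pi_pos
  field_simp
  norm_num

lemma lintegral_pi_finsetProd {κ : Type*} [Fintype κ] (ν : Measure ℝ) [IsProbabilityMeasure ν]
    (B : Finset κ) {f : κ → ℝ → ℝ≥0∞} (hf : ∀ j, Measurable (f j)) :
    ∫⁻ γ, ∏ j ∈ B, f j (γ j) ∂(Measure.pi fun _ : κ => ν) = ∏ j ∈ B, ∫⁻ x, f j x ∂ν := by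
  have hind : iIndepFun (fun (j : κ) (γ : κ → ℝ) => f j (γ j)) (Measure.pi fun _ : κ => ν) :=
    iIndepFun_pi (X := f) fun j => (hf j).aemeasurable
  rw [lintegral_prod_eq_prod_lintegral_of_indepFun B _ hind fun j =>
    (hf j).comp (measurable_pi_apply j)]
  exact Finset.prod_congr rfl fun j _ =>
    (measurePreserving_eval (fun _ : κ => ν) j).lintegral_comp (hf j)

lemma ofReal_exp_finsetSum {κ : Type*} (B : Finset κ) (f : κ → ℝ) :
    ENNReal.ofReal (Real.exp (∑ j ∈ B, f j)) = ∏ j ∈ B, ENNReal.ofReal (Real.exp (f j)) := by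
  rw [Real.exp_sum, ENNReal.ofReal_prod_of_nonneg fun i _ => (Real.exp_pos _).le]

lemma lintegral_exp_sum_mul_gaussianReal {κ : Type*} [Fintype κ] (B : Finset κ) (y : κ → ℝ) :
    ∫⁻ γ, ENNReal.ofReal (Real.exp (∑ j ∈ B, y j * γ j)) ∂(Measure.pi fun _ => gaussianReal 0 1)
      = ENNReal.ofReal (Real.exp (∑ j ∈ B, y j ^ 2 / 2)) := by
  simp_rw [ofReal_exp_finsetSum]
  rw [lintegral_pi_finsetProd (gaussianReal 0 1) B
    (f := fun j x => ENNReal.ofReal (Real.exp (y j * x))) fun j => by fun_prop]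
  simp_rw [lintegral_exp_mul_gaussianReal]

/-- The exponential of a square is a Gaussian average of exponentials of linear forms, which
turns a bound on the Laplace transform into one on an exponential square moment. -/
lemma lintegral_exp_sum_sq_div_le {Ω κ : Type*} [MeasurableSpace Ω] {P : Measure Ω} [SFinite P]
    [Finite κ] {B : Finset κ} {y : κ → Ω → ℝ} (hy : ∀ j, Measurable (y j)) {v : ℝ} (hv : 0 < v)
    {C : ℝ≥0∞} (hlaplace : ∀ c : κ → ℝ, ∫⁻ ω, ENNReal.ofReal (Real.exp (∑ j ∈ B, c j * y j ω)) ∂P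
      ≤ C * ENNReal.ofReal (Real.exp (v * ∑ j ∈ B, c j ^ 2))) :
    ∫⁻ ω, ENNReal.ofReal (Real.exp ((∑ j ∈ B, y j ω ^ 2) / (8 * v))) ∂P ≤ C * 2 ^ B.card := by
  have := Fintype.ofFinite κ
  set ν := Measure.pi fun _ : κ => gaussianReal 0 1
  set r := 1 / (2 * √v)
  have hr : r ^ 2 = 1 / (4 * v) := by
    rw [div_pow, mul_pow, Real.sq_sqrt hv.le]
    norm_num
  have hlinearize : ∀ ω, ENNReal.ofReal (Real.exp ((∑ j ∈ B, y j ω ^ 2) / (8 * v)))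
      = ∫⁻ γ, ENNReal.ofReal (Real.exp (∑ j ∈ B, r * γ j * y j ω)) ∂ν := fun ω => by
    have hcomm : ∀ (γ : κ → ℝ) j, r * γ j * y j ω = r * y j ω * γ j := fun γ j => by ring
    simp_rw [hcomm]
    rw [lintegral_exp_sum_mul_gaussianReal, Finset.sum_div]
    simp_rw [mul_pow, hr]
    congr! 3 with j
    ring
  have hlaplace_gaussian : ∀ γ : κ → ℝ,
      ∫⁻ ω, ENNReal.ofReal (Real.exp (∑ j ∈ B, r * γ j * y j ω)) ∂P
        ≤ C * ∏ j ∈ B, ENNReal.ofReal (Real.exp (γ j ^ 2 / 4)) := fun γ => by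
    refine (hlaplace fun j => r * γ j).trans_eq ?_
    rw [← ofReal_exp_finsetSum, Finset.mul_sum]
    simp_rw [mul_pow, hr]
    field_simp
  calc ∫⁻ ω, ENNReal.ofReal (Real.exp ((∑ j ∈ B, y j ω ^ 2) / (8 * v))) ∂P
      = ∫⁻ γ, ∫⁻ ω, ENNReal.ofReal (Real.exp (∑ j ∈ B, r * γ j * y j ω)) ∂P ∂ν := by
        rw [lintegral_congr hlinearize, lintegral_lintegral_swap (by fun_prop)]
    _ ≤ ∫⁻ γ, C * ∏ j ∈ B, ENNReal.ofReal (Real.exp (γ j ^ 2 / 4)) ∂ν :=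
        lintegral_mono hlaplace_gaussian
    _ = C * ∏ _j ∈ B, ∫⁻ x, ENNReal.ofReal (Real.exp (x ^ 2 / 4)) ∂(gaussianReal 0 1) := by
        rw [lintegral_const_mul _ (by fun_prop), lintegral_pi_finsetProd (gaussianReal 0 1) B
          (f := fun _ x => ENNReal.ofReal (Real.exp (x ^ 2 / 4))) fun _ => by fun_prop]
    _ ≤ C * 2 ^ B.card := by
        rw [Finset.prod_const]
        gcongr
        exact lintegral_exp_sq_div_gaussianReal_le

end GaussianLinearization

/-! ### Typical samples -/

section Scales

variable {κ : Type*} {σ : κ → ℝ} {s : ℝ}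

/-- The `k` for which `σ j` is of order `s / 2 ^ k`. -/
noncomputable def scaleIndex (σ : κ → ℝ) (s : ℝ) (j : κ) : ℕ := Nat.log 2 ⌊s / σ j⌋₊

lemma le_div_two_pow_scaleIndex {j : κ} (hσ : 0 < σ j) (hs : σ j ≤ s) :
    σ j ≤ s / 2 ^ scaleIndex σ s j := by
  have hratio : 1 ≤ s / σ j := (one_le_div hσ).2 hs
  have hpow : ((2 ^ scaleIndex σ s j : ℕ) : ℝ) ≤ s / σ j :=
    (Nat.cast_le.2 (Nat.pow_log_le_self 2 (Nat.floor_pos.2 hratio).ne')).trans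
      (Nat.floor_le (by linarith))
  push_cast at hpow
  rwa [le_div_comm₀ hσ (by positivity)]

lemma div_two_pow_scaleIndex_le {j : κ} (hσ : 0 < σ j) (hs : σ j ≤ s) :
    s / 2 ^ scaleIndex σ s j ≤ 2 * σ j := by
  have hratio : 1 ≤ s / σ j := (one_le_div hσ).2 hs
  have hpow : s / σ j < ((2 ^ (scaleIndex σ s j + 1) : ℕ) : ℝ) :=
    (Nat.floor_lt (by linarith)).1 (Nat.lt_pow_succ_log_self one_lt_two _)
  push_cast at hpow
  rw [div_lt_iff₀ hσ, pow_succ] at hpow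
  rw [div_le_iff₀ (by positivity)]
  linarith

/-- The dyadic block of the indices `j` with `σ j` of order `s / 2 ^ k`. -/
noncomputable def scaleBlock [Fintype κ] (σ : κ → ℝ) (s : ℝ) (k : ℕ) : Finset κ :=
  {j | scaleIndex σ s j = k}

lemma mem_scaleBlock [Fintype κ] {k : ℕ} {j : κ} : j ∈ scaleBlock σ s k ↔ scaleIndex σ s j = k := by
  simp [scaleBlock]

lemma le_of_mem_scaleBlock [Fintype κ] (hσ : ∀ j, 0 < σ j) (hs : ∀ j, σ j ≤ s) {k : ℕ} {j : κ}
    (hj : j ∈ scaleBlock σ s k) : σ j ≤ s / 2 ^ k :=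
  mem_scaleBlock.1 hj ▸ le_div_two_pow_scaleIndex (hσ j) (hs j)

lemma le_two_mul_of_mem_scaleBlock [Fintype κ] (hσ : ∀ j, 0 < σ j) (hs : ∀ j, σ j ≤ s) {k : ℕ}
    {j : κ} (hj : j ∈ scaleBlock σ s k) : s / 2 ^ k ≤ 2 * σ j :=
  mem_scaleBlock.1 hj ▸ div_two_pow_scaleIndex_le (hσ j) (hs j)

end Scales

section TypicalSample

variable {κ E : Type*} [Fintype κ] [NormedAddCommGroup E] [InnerProductSpace ℝ E]
  {b : OrthonormalBasis κ ℝ E} {σ : κ → ℝ} {n : ℕ}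

/-- The variance of `⟪x, Z⟫` for a random vector `Z` whose covariance has the eigenvalues `c j` in
the basis `b`. -/
noncomputable def directionalVariance (b : OrthonormalBasis κ ℝ E) (c : κ → ℝ) (x : E) : ℝ :=
  ∑ j, c j * ⟪x, b j⟫ ^ 2

section DirectionalVariance

variable {c : κ → ℝ}

lemma directionalVariance_nonneg (hc : ∀ j, 0 ≤ c j) (x : E) : 0 ≤ directionalVariance b c x :=
  Finset.sum_nonneg fun j _ => mul_nonneg (hc j) (sq_nonneg _)

lemma directionalVariance_pos (hc : ∀ j, 0 < c j) {x : E} (hx : x ≠ 0) :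
    0 < directionalVariance b c x := by
  obtain ⟨j, hj⟩ : ∃ j, ⟪x, b j⟫ ≠ 0 := by
    by_contra! h
    refine hx ?_
    rw [← b.sum_repr' x, Finset.sum_eq_zero fun j _ => by rw [real_inner_comm, h j, zero_smul]]
  refine Finset.sum_pos' (fun j _ => mul_nonneg (hc j).le (sq_nonneg _)) ⟨j, Finset.mem_univ j, ?_⟩
  have := hc j
  positivity

lemma directionalVariance_smul (r : ℝ) (x : E) :
    directionalVariance b c (r • x) = r ^ 2 * directionalVariance b c x := by
  simp only [directionalVariance, real_inner_smul_left, Finset.mul_sum]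
  exact Finset.sum_congr rfl fun j _ => by ring

lemma directionalVariance_sum_smul (B : Finset κ) (v : κ → ℝ) :
    directionalVariance b c (∑ k ∈ B, v k • b k) = ∑ j ∈ B, c j * v j ^ 2 := by
  classical
  simp [directionalVariance, sum_inner, real_inner_smul_left, orthonormal_iff_ite.1 b.orthonormal,
    ite_pow]

lemma directionalVariance_basis (j : κ) : directionalVariance b c (b j) = c j := by
  classical
  simp [directionalVariance, orthonormal_iff_ite.1 b.orthonormal, ite_pow]

lemma sum_mul_inner_sq_le_directionalVariance (hc : ∀ j, 0 ≤ c j) (B : Finset κ) (x : E) :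
    ∑ j ∈ B, c j * ⟪x, b j⟫ ^ 2 ≤ directionalVariance b c x :=
  Finset.sum_le_sum_of_subset_of_nonneg B.subset_univ fun j _ _ =>
    mul_nonneg (hc j) (sq_nonneg _)

end DirectionalVariance

/-- The conditions on the data under which the normalized second-moment form is under control:
the empirical second moments along the basis are at most `4 l` times the variances `σ j ^ 2`, and
on each of the `K` largest dyadic blocks of scales all signed sums of the data have the norm
expected of a subgaussian vector. -/
structure IsTypicalSample (b : OrthonormalBasis κ ℝ E) (σ : κ → ℝ) (s l : ℝ) (K : ℕ)
    (a : Fin n → E) : Prop where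
  secondMoment_le : ∀ j, (1 / (n : ℝ)) * ∑ i, ⟪a i, b j⟫ ^ 2 ≤ 4 * l * σ j ^ 2
  signedSum_le : ∀ k < K, ∀ ε : Fin n → ℤˣ, ∑ j ∈ scaleBlock σ s k, ⟪∑ i, ε i • a i, b j⟫ ^ 2
    ≤ 8 * n * (s / 2 ^ k) ^ 2 * (2 * n + (scaleBlock σ s k).card + l)

lemma inner_units_smul_left (ε : ℤˣ) (x y : E) : ⟪ε • x, y⟫ = ε • ⟪x, y⟫ := by
  rcases Int.units_eq_one_or ε with rfl | rfl <;> simp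

lemma units_smul_le_abs (ε : ℤˣ) (x : ℝ) : ε • x ≤ |x| := by
  rcases Int.units_eq_one_or ε with rfl | rfl
  · simpa using le_abs_self x
  · simpa using neg_le_abs x

lemma exists_units_smul_eq_abs (x : ℝ) : ∃ ε : ℤˣ, ε • x = |x| := by
  rcases abs_choice x with h | h
  · exact ⟨1, by simp [h]⟩
  · exact ⟨-1, by simp [h]⟩

variable [MeasurableSpace E] [BorelSpace E] [SecondCountableTopology E]
  {Ω : Type*} [MeasurableSpace Ω] {P : Measure Ω} [IsProbabilityMeasure P] {a : Fin n → Ω → E}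
  (ha : ∀ i, Measurable (a i))

include ha

lemma measurable_inner_signedSum (ε : Fin n → ℤˣ) (g : E) :
    Measurable fun ω => ⟪∑ i, ε i • a i ω, g⟫ := by
  simp_rw [sum_inner, inner_units_smul_left]
  exact Finset.measurable_sum _ fun i _ => ((ha i).inner_const (c := g)).const_smul (ε i)

lemma measurableSet_isTypicalSample (s l : ℝ) (K : ℕ) :
    MeasurableSet {ω | IsTypicalSample b σ s l K fun i => a i ω} := by
  have hset : {ω | IsTypicalSample b σ s l K fun i => a i ω}
      = (⋂ j, {ω | (1 / (n : ℝ)) * ∑ i, ⟪a i ω, b j⟫ ^ 2 ≤ 4 * l * σ j ^ 2})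
        ∩ ⋂ k < K, ⋂ ε : Fin n → ℤˣ, {ω | ∑ j ∈ scaleBlock σ s k, ⟪∑ i, ε i • a i ω, b j⟫ ^ 2
          ≤ 8 * n * (s / 2 ^ k) ^ 2 * (2 * n + (scaleBlock σ s k).card + l)} := by
    ext ω
    simp only [Set.mem_ofPred_eq, Set.mem_inter_iff, Set.mem_iInter]
    exact ⟨fun h => ⟨h.1, h.2⟩, fun h => ⟨h.1, h.2⟩⟩
  rw [hset]
  refine (MeasurableSet.iInter fun j => measurableSet_le (by fun_prop) measurable_const).inter
    (MeasurableSet.iInter fun k => MeasurableSet.iInter fun _ => MeasurableSet.iInter fun ε =>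
      measurableSet_le (Finset.measurable_sum _ fun j _ =>
        (measurable_inner_signedSum ha ε (b j)).pow_const 2) measurable_const)

variable (hind : iIndepFun a P) (hσ : ∀ j, 0 < σ j)
  (htail : ∀ i g, HasGaussianTail (fun ω => ⟪a i ω, g⟫) (directionalVariance b (σ ^ 2) g) P)

include hσ htail in
lemma measure_secondMoment_gt_le [NeZero n] (j : κ) (l : ℝ) :
    P {ω | 4 * l * σ j ^ 2 < (1 / (n : ℝ)) * ∑ i, ⟪a i ω, b j⟫ ^ 2}
      ≤ 3 * ENNReal.ofReal (Real.exp (-l)) := by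
  refine measure_lt_average_sq_le (fun i => by fun_prop) (pow_pos (hσ j) 2) (fun i => ?_) l
  simpa only [directionalVariance_basis, Pi.pow_apply] using htail i (b j)

include hind hσ htail

lemma lintegral_exp_inner_signedSum_le (ε : Fin n → ℤˣ) (g : E) :
    ∫⁻ ω, ENNReal.ofReal (Real.exp ⟪∑ i, ε i • a i ω, g⟫) ∂P
      ≤ 3 ^ n * ENNReal.ofReal (Real.exp (n * directionalVariance b (σ ^ 2) g)) := by
  rcases eq_or_ne g 0 with rfl | hg
  · simpa [directionalVariance] using one_le_pow₀ (by norm_num : (1 : ℝ≥0∞) ≤ 3)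
  have hfactor : ∀ i, Measurable fun x : E => ENNReal.ofReal (Real.exp (ε i • ⟪x, g⟫)) :=
    fun i => by fun_prop
  simp_rw [sum_inner, inner_units_smul_left, ofReal_exp_finsetSum]
  rw [lintegral_prod_eq_prod_lintegral_of_indepFun Finset.univ
    (fun i ω => ENNReal.ofReal (Real.exp (ε i • ⟪a i ω, g⟫))) (hind.comp _ hfactor)
    fun i => (hfactor i).comp (ha i)]
  calc ∏ i, ∫⁻ ω, ENNReal.ofReal (Real.exp (ε i • ⟪a i ω, g⟫)) ∂P
      ≤ ∏ _i : Fin n, 3 * ENNReal.ofReal (Real.exp (directionalVariance b (σ ^ 2) g)) := by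
        refine Finset.prod_le_prod' fun i _ => (lintegral_mono fun ω => ?_).trans
          ((htail i g).lintegral_exp_abs_le (by fun_prop)
            (directionalVariance_pos (fun j => pow_pos (hσ j) 2) hg))
        gcongr
        exact units_smul_le_abs (ε i) _
    _ = 3 ^ n * ENNReal.ofReal (Real.exp (n * directionalVariance b (σ ^ 2) g)) := by
        rw [Finset.prod_const, Finset.card_univ, Fintype.card_fin, mul_pow, Real.exp_nat_mul,
          ENNReal.ofReal_pow (Real.exp_pos _).le]

lemma lintegral_exp_signedSum_block_le [NeZero n] (ε : Fin n → ℤˣ) {B : Finset κ} {τ : ℝ}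
    (hτ : 0 < τ) (hB : ∀ j ∈ B, σ j ≤ τ) :
    ∫⁻ ω, ENNReal.ofReal (Real.exp ((∑ j ∈ B, ⟪∑ i, ε i • a i ω, b j⟫ ^ 2)
      / (8 * (n * τ ^ 2)))) ∂P ≤ 3 ^ n * 2 ^ B.card := by
  have hn : 0 < n := Nat.pos_of_neZero n
  refine lintegral_exp_sum_sq_div_le (fun j => measurable_inner_signedSum ha ε (b j))
    (by positivity) fun c => ?_
  have hlinear : ∀ ω, ∑ j ∈ B, c j * ⟪∑ i, ε i • a i ω, b j⟫
      = ⟪∑ i, ε i • a i ω, ∑ j ∈ B, c j • b j⟫ := fun ω => by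
    simp_rw [inner_sum, real_inner_smul_right]
  simp_rw [hlinear]
  refine (lintegral_exp_inner_signedSum_le ha hind hσ htail ε _).trans ?_
  rw [directionalVariance_sum_smul, mul_assoc, Finset.mul_sum (a := τ ^ 2)]
  gcongr with j hj
  rw [Pi.pow_apply]
  gcongr
  · exact (hσ j).le
  · exact hB j hj

lemma measure_signedSum_block_gt_le [NeZero n] {B : Finset κ} {τ : ℝ} (hτ : 0 < τ)
    (hB : ∀ j ∈ B, σ j ≤ τ) (l : ℝ) :
    P (⋃ ε : Fin n → ℤˣ, {ω | 8 * n * τ ^ 2 * (2 * n + B.card + l)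
      < ∑ j ∈ B, ⟪∑ i, ε i • a i ω, b j⟫ ^ 2}) ≤ ENNReal.ofReal (Real.exp (-l)) := by
  have hn : 0 < n := Nat.pos_of_neZero n
  have hε : ∀ ε : Fin n → ℤˣ, P {ω | 8 * n * τ ^ 2 * (2 * n + B.card + l)
      < ∑ j ∈ B, ⟪∑ i, ε i • a i ω, b j⟫ ^ 2}
        ≤ 3 ^ n * 2 ^ B.card * ENNReal.ofReal (Real.exp (-(2 * n + B.card + l))) := fun ε => by
    have hmeas : Measurable fun ω =>
        (∑ j ∈ B, ⟪∑ i, ε i • a i ω, b j⟫ ^ 2) / (8 * (n * τ ^ 2)) :=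
      (Finset.measurable_sum _ fun j _ =>
        (measurable_inner_signedSum ha ε (b j)).pow_const 2).div_const _
    refine (measure_mono fun ω hω => ?_).trans
      ((measure_lt_le_lintegral_exp_mul hmeas.aemeasurable _).trans
        (mul_le_mul_left (lintegral_exp_signedSum_block_le ha hind hσ htail ε hτ hB) _))
    rw [Set.mem_ofPred_eq, lt_div_iff₀ (by positivity)]
    linarith [Set.mem_ofPred_eq ▸ hω]
  have hpow : (6 : ℝ) ^ n * 2 ^ B.card ≤ Real.exp (2 * n + B.card) := by
    have hexp := Real.exp_one_gt_d9
    have hsix : (6 : ℝ) ≤ Real.exp 1 ^ 2 := by nlinarith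
    rw [Real.exp_add, mul_comm (2 : ℝ) (n : ℝ), Real.exp_nat_mul, ← mul_one (B.card : ℝ),
      Real.exp_nat_mul, ← mul_one (2 : ℝ), ← Nat.cast_two, Real.exp_nat_mul, Nat.cast_two]
    gcongr
    linarith
  calc P (⋃ ε : Fin n → ℤˣ, {ω | 8 * n * τ ^ 2 * (2 * n + B.card + l)
        < ∑ j ∈ B, ⟪∑ i, ε i • a i ω, b j⟫ ^ 2})
      ≤ ∑ _ε : Fin n → ℤˣ, 3 ^ n * 2 ^ B.card
          * ENNReal.ofReal (Real.exp (-(2 * n + B.card + l))) :=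
        (measure_iUnion_fintype_le _ _).trans (Finset.sum_le_sum fun ε _ => hε ε)
    _ = ENNReal.ofReal (6 ^ n * 2 ^ B.card * Real.exp (-(2 * n + B.card + l))) := by
        rw [ENNReal.ofReal_mul (by positivity), ENNReal.ofReal_mul (by positivity),
          ENNReal.ofReal_pow (by norm_num), ENNReal.ofReal_pow (by norm_num)]
        simp only [Finset.sum_const, Finset.card_univ, Fintype.card_fun, Fintype.card_units_int,
          Fintype.card_fin, nsmul_eq_mul, Nat.cast_pow, Nat.cast_ofNat, ENNReal.ofReal_ofNat]
        rw [show (6 : ℝ≥0∞) = 2 * 3 by norm_num, mul_pow]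
        ring
    _ ≤ ENNReal.ofReal (Real.exp (2 * n + B.card) * Real.exp (-(2 * n + B.card + l))) := by gcongr
    _ = ENNReal.ofReal (Real.exp (-l)) := by
        rw [← Real.exp_add]
        ring_nf

lemma one_sub_le_measureReal_isTypicalSample [NeZero n] {s : ℝ} (hs : ∀ j, σ j ≤ s) (hs0 : 0 < s)
    (l : ℝ) (K : ℕ) :
    1 - (K + 3 * Fintype.card κ) * Real.exp (-l)
      ≤ P.real {ω | IsTypicalSample b σ s l K fun i => a i ω} := by
  have hcompl : {ω | IsTypicalSample b σ s l K fun i => a i ω}ᶜ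
      ⊆ (⋃ j, {ω | 4 * l * σ j ^ 2 < (1 / (n : ℝ)) * ∑ i, ⟪a i ω, b j⟫ ^ 2})
        ∪ ⋃ k ∈ Finset.range K, ⋃ ε : Fin n → ℤˣ,
          {ω | 8 * n * (s / 2 ^ k) ^ 2 * (2 * n + (scaleBlock σ s k).card + l)
            < ∑ j ∈ scaleBlock σ s k, ⟪∑ i, ε i • a i ω, b j⟫ ^ 2} := by
    intro ω
    contrapose!
    simp only [Set.mem_union, Set.mem_iUnion, Set.mem_ofPred_eq, Finset.mem_range, not_or,
      not_exists, not_lt, Set.mem_compl_iff, not_not]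
    exact fun h => ⟨h.1, h.2⟩
  have hP : P {ω | IsTypicalSample b σ s l K fun i => a i ω}ᶜ
      ≤ ENNReal.ofReal ((K + 3 * Fintype.card κ) * Real.exp (-l)) :=
    calc P {ω | IsTypicalSample b σ s l K fun i => a i ω}ᶜ
        ≤ (∑ _j : κ, 3 * ENNReal.ofReal (Real.exp (-l)))
          + ∑ _k ∈ Finset.range K, ENNReal.ofReal (Real.exp (-l)) := by
          refine (measure_mono hcompl).trans ((measure_union_le _ _).trans (add_le_add
            ((measure_iUnion_fintype_le _ _).trans (Finset.sum_le_sum fun j _ =>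
              measure_secondMoment_gt_le ha hσ htail j l))
            ((measure_biUnion_finset_le _ _).trans (Finset.sum_le_sum fun k _ =>
              measure_signedSum_block_gt_le ha hind hσ htail (by positivity)
                (fun j hj => le_of_mem_scaleBlock hσ hs hj) l))))
      _ = ENNReal.ofReal ((K + 3 * Fintype.card κ) * Real.exp (-l)) := by
          rw [ENNReal.ofReal_mul (by positivity), ENNReal.ofReal_add (by positivity)
            (by positivity), ENNReal.ofReal_mul (by norm_num)]
          simp only [Finset.sum_const, Finset.card_univ, Finset.card_range, nsmul_eq_mul,
            ENNReal.ofReal_natCast, ENNReal.ofReal_ofNat]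
          ring
  have hreal := ENNReal.toReal_le_of_le_ofReal (by positivity) hP
  rw [← measureReal_def,
    probReal_compl_eq_one_sub (measurableSet_isTypicalSample ha s l K)] at hreal
  linarith

end TypicalSample

/-! ### The normalized quadratic form of a typical sample -/

lemma average_sqrt_le_sqrt_average {n : ℕ} {q : Fin n → ℝ} (hq : ∀ i, 0 ≤ q i) :
    (1 / (n : ℝ)) * ∑ i, √(q i) ≤ √((1 / (n : ℝ)) * ∑ i, q i) := by
  rcases n.eq_zero_or_pos with rfl | hn
  · simp
  refine Real.le_sqrt_of_sq_le ?_
  have hcauchy := sq_sum_le_card_mul_sum_sq (s := Finset.univ) (f := fun i => √(q i))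
  simp only [Real.sq_sqrt (hq _), Finset.card_univ, Fintype.card_fin] at hcauchy
  calc ((1 / (n : ℝ)) * ∑ i, √(q i)) ^ 2 = (1 / (n : ℝ)) ^ 2 * (∑ i, √(q i)) ^ 2 := mul_pow _ _ _
    _ ≤ (1 / (n : ℝ)) ^ 2 * (n * ∑ i, q i) := by gcongr
    _ = (1 / (n : ℝ)) * ∑ i, q i := by field_simp

section QuadraticForm

variable {κ E : Type*} [Fintype κ] [NormedAddCommGroup E] [InnerProductSpace ℝ E]
  {b : OrthonormalBasis κ ℝ E} {σ : κ → ℝ} {n : ℕ} {a : Fin n → E}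

/-- The inner product of the projections of `x` and `h` onto the span of the basis vectors indexed
by `B`. -/
noncomputable def blockInner (b : OrthonormalBasis κ ℝ E) (B : Finset κ) (x h : E) : ℝ :=
  ∑ j ∈ B, ⟪x, b j⟫ * ⟪b j, h⟫

lemma sq_blockInner_le (B : Finset κ) (x h : E) :
    blockInner b B x h ^ 2 ≤ (∑ j ∈ B, ⟪x, b j⟫ ^ 2) * ‖h‖ ^ 2 := by
  refine (Finset.sum_mul_sq_le_sq_mul_sq B _ _).trans ?_
  rw [← b.sum_sq_inner_right h]
  gcongr
  exact B.subset_univ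

lemma sum_units_smul_blockInner (ε : Fin n → ℤˣ) (B : Finset κ) (h : E) :
    ∑ i, ε i • blockInner b B (a i) h = blockInner b B (∑ i, ε i • a i) h := by
  simp only [blockInner, sum_inner, inner_units_smul_left, Finset.sum_mul, Finset.smul_sum,
    smul_mul_assoc]
  exact Finset.sum_comm

lemma sum_abs_blockInner_le {B : Finset κ} {A : ℝ}
    (hA : ∀ ε : Fin n → ℤˣ, ∑ j ∈ B, ⟪∑ i, ε i • a i, b j⟫ ^ 2 ≤ A) (h : E) :
    ∑ i, |blockInner b B (a i) h| ≤ √A * ‖h‖ := by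
  choose ε hε using fun i => exists_units_smul_eq_abs (blockInner b B (a i) h)
  simp_rw [← hε, sum_units_smul_blockInner]
  rw [← Real.sqrt_sq (norm_nonneg h), ← Real.sqrt_mul' _ (sq_nonneg _)]
  exact Real.le_sqrt_of_sq_le ((sq_blockInner_le B _ h).trans
    (mul_le_mul_of_nonneg_right (hA ε) (sq_nonneg _)))

section

variable (hσ : ∀ j, 0 < σ j)

include hσ

lemma abs_blockInner_le {B : Finset κ} {τ : ℝ} (hτ : 0 < τ) (hB : ∀ j ∈ B, τ ≤ 2 * σ j) (x h : E) :
    |blockInner b B x h| ≤ √(2 / τ) * √(directionalVariance b σ x) * ‖h‖ := by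
  refine abs_le_of_sq_le_sq ?_ (by positivity)
  rw [mul_pow, mul_pow, Real.sq_sqrt (by positivity),
    Real.sq_sqrt (directionalVariance_nonneg (fun j => (hσ j).le) x)]
  refine (sq_blockInner_le B x h).trans ?_
  gcongr
  rw [div_mul_eq_mul_div, le_div_iff₀ hτ, Finset.sum_mul]
  calc ∑ j ∈ B, ⟪x, b j⟫ ^ 2 * τ ≤ ∑ j ∈ B, ⟪x, b j⟫ ^ 2 * (2 * σ j) := by
        gcongr with j hj
        exact hB j hj
    _ = 2 * ∑ j ∈ B, σ j * ⟪x, b j⟫ ^ 2 := by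
        rw [Finset.mul_sum]
        exact Finset.sum_congr rfl fun j _ => by ring
    _ ≤ 2 * directionalVariance b σ x := by
        gcongr
        exact sum_mul_inner_sq_le_directionalVariance (fun j => (hσ j).le) B x

lemma average_sq_blockInner_div_le [NeZero n] {B : Finset κ} {τ N : ℝ} (hτ : 0 < τ)
    (hB : ∀ j ∈ B, τ ≤ 2 * σ j)
    (hN : ∀ ε : Fin n → ℤˣ, ∑ j ∈ B, ⟪∑ i, ε i • a i, b j⟫ ^ 2 ≤ 8 * n * τ ^ 2 * N) (h : E) :
    (1 / (n : ℝ)) * ∑ i, blockInner b B (a i) h ^ 2 / √(directionalVariance b σ (a i))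
      ≤ 4 * √(τ * N / n) * ‖h‖ ^ 2 := by
  have hn : (0 : ℝ) < n := by exact_mod_cast Nat.pos_of_neZero n
  have hterm : ∀ i, blockInner b B (a i) h ^ 2 / √(directionalVariance b σ (a i))
      ≤ √(2 / τ) * ‖h‖ * |blockInner b B (a i) h| := fun i => by
    refine div_le_of_le_mul₀ (Real.sqrt_nonneg _) (by positivity) ?_
    rw [← sq_abs, sq]
    linarith [mul_le_mul_of_nonneg_right (abs_blockInner_le (b := b) hσ hτ hB (a i) h)
      (abs_nonneg (blockInner b B (a i) h))]
  have hsqrt : √(2 / τ) * √(8 * n * τ ^ 2 * N) = 4 * n * √(τ * N / n) := by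
    rw [← Real.sqrt_mul (by positivity),
      show 2 / τ * (8 * n * τ ^ 2 * N) = (4 * n) ^ 2 * (τ * N / n) by field_simp; ring,
      Real.sqrt_mul (by positivity), Real.sqrt_sq (by positivity)]
  calc (1 / (n : ℝ)) * ∑ i, blockInner b B (a i) h ^ 2 / √(directionalVariance b σ (a i))
      ≤ (1 / (n : ℝ)) * ∑ i, √(2 / τ) * ‖h‖ * |blockInner b B (a i) h| := by
        gcongr with i
        exact hterm i
    _ ≤ (1 / (n : ℝ)) * (√(2 / τ) * ‖h‖ * (√(8 * n * τ ^ 2 * N) * ‖h‖)) := by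
        rw [← Finset.mul_sum]
        gcongr
        exact sum_abs_blockInner_le hN h
    _ = (1 / (n : ℝ)) * (√(2 / τ) * √(8 * n * τ ^ 2 * N)) * ‖h‖ ^ 2 := by ring
    _ = 4 * √(τ * N / n) * ‖h‖ ^ 2 := by
        rw [hsqrt]
        field_simp

lemma sq_blockInner_div_le (B : Finset κ) (x h : E) :
    blockInner b B x h ^ 2 / √(directionalVariance b σ x)
      ≤ √(∑ j ∈ B, ⟪x, b j⟫ ^ 2 / σ j) * ‖h‖ ^ 2 := by
  have hcauchy : ∑ j ∈ B, ⟪x, b j⟫ ^ 2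
      ≤ √(directionalVariance b σ x) * √(∑ j ∈ B, ⟪x, b j⟫ ^ 2 / σ j) := by
    rw [← Real.sqrt_mul (directionalVariance_nonneg (fun j => (hσ j).le) x)]
    refine Real.le_sqrt_of_sq_le ((Finset.sum_sq_le_sum_mul_sum_of_sq_le_mul B
      (fun j _ => mul_nonneg (hσ j).le (sq_nonneg _))
      (fun j _ => div_nonneg (sq_nonneg _) (hσ j).le) fun j _ => ?_).trans
      (mul_le_mul_of_nonneg_right (sum_mul_inner_sq_le_directionalVariance (fun j => (hσ j).le) B x)
        (Finset.sum_nonneg fun j _ => div_nonneg (sq_nonneg _) (hσ j).le)))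
    have := (hσ j).ne'
    apply le_of_eq
    field_simp
  refine div_le_of_le_mul₀ (Real.sqrt_nonneg _) (by positivity) ((sq_blockInner_le B x h).trans ?_)
  linarith [mul_le_mul_of_nonneg_right hcauchy (sq_nonneg ‖h‖)]

end

/-- The indices whose scale index, truncated at `K`, equals `k`. -/
noncomputable def truncatedBlock (σ : κ → ℝ) (s : ℝ) (K k : ℕ) : Finset κ :=
  {j | min K (scaleIndex σ s j) = k}

lemma truncatedBlock_of_lt {s : ℝ} {K k : ℕ} (hk : k < K) :
    truncatedBlock σ s K k = scaleBlock σ s k := by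
  ext j
  simp only [truncatedBlock, scaleBlock, Finset.mem_filter, Finset.mem_univ, true_and]
  omega

lemma sum_truncatedBlock_self_le {s : ℝ} (hσ : ∀ j, 0 < σ j) (hs : ∀ j, σ j ≤ s) (hs0 : 0 ≤ s)
    {K : ℕ} (hK : Fintype.card κ ≤ 2 ^ K) : ∑ j ∈ truncatedBlock σ s K K, σ j ≤ s := by
  have hscale : ∀ j ∈ truncatedBlock σ s K K, σ j ≤ s / 2 ^ K := fun j hj => by
    have hj' : K ≤ scaleIndex σ s j := by simpa [truncatedBlock] using hj
    refine (le_div_two_pow_scaleIndex (hσ j) (hs j)).trans ?_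
    gcongr
    norm_num
  have hcard : ((truncatedBlock σ s K K).card : ℝ) ≤ 2 ^ K := by
    exact_mod_cast (Finset.card_le_univ _).trans hK
  calc ∑ j ∈ truncatedBlock σ s K K, σ j
      ≤ (truncatedBlock σ s K K).card * (s / 2 ^ K) := by
        simpa only [nsmul_eq_mul] using Finset.sum_le_card_nsmul _ _ _ hscale
    _ ≤ 2 ^ K * (s / 2 ^ K) := by gcongr
    _ = s := by field_simp

lemma inner_eq_sum_blockInner_truncatedBlock (s : ℝ) (K : ℕ) (x h : E) :
    ⟪x, h⟫ = ∑ k ∈ Finset.range (K + 1), blockInner b (truncatedBlock σ s K k) x h := by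
  rw [← b.sum_inner_mul_inner x h]
  exact (Finset.sum_fiberwise_of_maps_to (fun j _ => Finset.mem_range.2
    (Nat.lt_succ_of_le (min_le_left K (scaleIndex σ s j)))) _).symm

lemma average_inner_sq_div_le {s A : ℝ} {K : ℕ} {w : Fin n → ℝ} (hw : ∀ i, 0 ≤ w i) {h : E}
    (hA : ∀ k ≤ K, (1 / (n : ℝ)) * ∑ i, blockInner b (truncatedBlock σ s K k) (a i) h ^ 2 / w i
      ≤ A) :
    (1 / (n : ℝ)) * ∑ i, ⟪a i, h⟫ ^ 2 / w i ≤ ((K : ℝ) + 1) ^ 2 * A := by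
  calc (1 / (n : ℝ)) * ∑ i, ⟪a i, h⟫ ^ 2 / w i
      ≤ (1 / (n : ℝ)) * ∑ i, (((K : ℝ) + 1) * ∑ k ∈ Finset.range (K + 1),
          blockInner b (truncatedBlock σ s K k) (a i) h ^ 2) / w i := by
        gcongr with i
        · exact hw i
        rw [inner_eq_sum_blockInner_truncatedBlock (b := b) (σ := σ) s K (a i) h]
        simpa using sq_sum_le_card_mul_sum_sq (s := Finset.range (K + 1))
          (f := fun k => blockInner b (truncatedBlock σ s K k) (a i) h)
    _ = ((K : ℝ) + 1) * ∑ k ∈ Finset.range (K + 1),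
          (1 / (n : ℝ)) * ∑ i, blockInner b (truncatedBlock σ s K k) (a i) h ^ 2 / w i := by
        simp_rw [mul_div_assoc, Finset.sum_div, ← Finset.mul_sum]
        rw [Finset.sum_comm, mul_left_comm]
    _ ≤ ((K : ℝ) + 1) * ∑ _k ∈ Finset.range (K + 1), A := by
        gcongr with k hk
        exact hA k (Nat.lt_succ_iff.1 (Finset.mem_range.1 hk))
    _ = ((K : ℝ) + 1) ^ 2 * A := by
        rw [Finset.sum_const, Finset.card_range, nsmul_eq_mul]
        push_cast
        ring

namespace IsTypicalSample

variable {s l : ℝ} {K : ℕ} (ha : IsTypicalSample b σ s l K a) (hσ : ∀ j, 0 < σ j)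

include ha hσ

lemma average_sqrt_directionalVariance_le :
    (1 / (n : ℝ)) * ∑ i, √(directionalVariance b σ (a i)) ≤ √(4 * l * ∑ j, σ j ^ 3) := by
  refine (average_sqrt_le_sqrt_average fun i =>
    directionalVariance_nonneg (fun j => (hσ j).le) (a i)).trans (Real.sqrt_le_sqrt ?_)
  simp only [directionalVariance]
  rw [Finset.sum_comm, Finset.mul_sum, Finset.mul_sum]
  refine Finset.sum_le_sum fun j _ => ?_
  rw [← Finset.mul_sum]
  linarith [mul_le_mul_of_nonneg_left (ha.secondMoment_le j) (hσ j).le]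

lemma average_sq_blockInner_div_le (B : Finset κ) (h : E) :
    (1 / (n : ℝ)) * ∑ i, blockInner b B (a i) h ^ 2 / √(directionalVariance b σ (a i))
      ≤ √(4 * l * ∑ j ∈ B, σ j) * ‖h‖ ^ 2 := by
  have hmoment : (1 / (n : ℝ)) * ∑ i, ∑ j ∈ B, ⟪a i, b j⟫ ^ 2 / σ j ≤ 4 * l * ∑ j ∈ B, σ j := by
    rw [Finset.sum_comm, Finset.mul_sum, Finset.mul_sum]
    refine Finset.sum_le_sum fun j _ => ?_
    rw [← Finset.sum_div, ← mul_div_assoc, div_le_iff₀ (hσ j)]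
    linarith [ha.secondMoment_le j]
  calc (1 / (n : ℝ)) * ∑ i, blockInner b B (a i) h ^ 2 / √(directionalVariance b σ (a i))
      ≤ (1 / (n : ℝ)) * ∑ i, √(∑ j ∈ B, ⟪a i, b j⟫ ^ 2 / σ j) * ‖h‖ ^ 2 := by
        gcongr with i
        exact sq_blockInner_div_le hσ B (a i) h
    _ = ((1 / (n : ℝ)) * ∑ i, √(∑ j ∈ B, ⟪a i, b j⟫ ^ 2 / σ j)) * ‖h‖ ^ 2 := by
        rw [← Finset.sum_mul, mul_assoc]
    _ ≤ √(4 * l * ∑ j ∈ B, σ j) * ‖h‖ ^ 2 := by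
        gcongr
        exact (average_sqrt_le_sqrt_average fun i => Finset.sum_nonneg fun j _ =>
          div_nonneg (sq_nonneg _) (hσ j).le).trans (Real.sqrt_le_sqrt hmoment)

variable [NeZero n] (hs : ∀ j, σ j ≤ s) (hs0 : 0 < s) (hl : 0 ≤ l)

include hs hs0 hl

lemma average_sq_blockInner_scaleBlock_div_le {k : ℕ} (hk : k < K) (h : E) :
    (1 / (n : ℝ)) * ∑ i, blockInner b (scaleBlock σ s k) (a i) h ^ 2
      / √(directionalVariance b σ (a i)) ≤ 4 * √(s * (2 + l) + 2 * (∑ j, σ j) / n) * ‖h‖ ^ 2 := by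
  have hn : (1 : ℝ) ≤ n := by exact_mod_cast Nat.one_le_iff_ne_zero.2 (NeZero.ne n)
  have hB : ∀ j ∈ scaleBlock σ s k, s / 2 ^ k ≤ 2 * σ j :=
    fun j hj => le_two_mul_of_mem_scaleBlock hσ hs hj
  refine (NonIsoSmoothing.average_sq_blockInner_div_le hσ (by positivity) hB
    (ha.signedSum_le k hk) h).trans ?_
  gcongr
  have hcard : s / 2 ^ k * (scaleBlock σ s k).card ≤ 2 * ∑ j, σ j := by
    rw [mul_comm, ← nsmul_eq_mul, ← Finset.sum_const, Finset.mul_sum]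
    exact (Finset.sum_le_sum hB).trans (Finset.sum_le_sum_of_subset_of_nonneg
      (Finset.subset_univ _) fun j _ _ => by linarith [hσ j])
  have hscale : s / 2 ^ k * (2 * n + l) ≤ s * ((2 + l) * n) := by
    refine mul_le_mul (div_le_self hs0.le (one_le_pow₀ (by norm_num))) ?_ (by positivity) hs0.le
    nlinarith
  rw [div_le_iff₀ (by linarith), add_mul, div_mul_cancel₀ _ (by linarith)]
  linarith

lemma average_sq_blockInner_truncatedBlock_div_le (hK : Fintype.card κ ≤ 2 ^ K) {k : ℕ}
    (hk : k ≤ K) (h : E) :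
    (1 / (n : ℝ)) * ∑ i, blockInner b (truncatedBlock σ s K k) (a i) h ^ 2
      / √(directionalVariance b σ (a i)) ≤ 4 * √(s * (2 + l) + 2 * (∑ j, σ j) / n) * ‖h‖ ^ 2 := by
  rcases hk.eq_or_lt with rfl | hk
  · refine (ha.average_sq_blockInner_div_le hσ _ h).trans ?_
    gcongr
    refine Real.sqrt_le_iff.2 ⟨by positivity, ?_⟩
    have hsum : 0 ≤ ∑ j, σ j := Finset.sum_nonneg fun j _ => (hσ j).le
    have htail := mul_le_mul_of_nonneg_left (sum_truncatedBlock_self_le hσ hs hs0.le hK) hl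
    have : 0 ≤ 2 * (∑ j, σ j) / n := by positivity
    rw [mul_pow, Real.sq_sqrt (by positivity)]
    nlinarith
  · rw [truncatedBlock_of_lt hk]
    exact ha.average_sq_blockInner_scaleBlock_div_le hσ hs hs0 hl hk h

lemma average_inner_sq_div_le (hK : Fintype.card κ ≤ 2 ^ K) (h : E) :
    (1 / (n : ℝ)) * ∑ i, ⟪a i, h⟫ ^ 2 / √(directionalVariance b σ (a i))
      ≤ 4 * ((K : ℝ) + 1) ^ 2 * √(s * (2 + l) + 2 * (∑ j, σ j) / n) * ‖h‖ ^ 2 :=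
  (NonIsoSmoothing.average_inner_sq_div_le (fun _ => Real.sqrt_nonneg _) fun _ hk =>
    ha.average_sq_blockInner_truncatedBlock_div_le hσ hs hs0 hl hK hk h).trans_eq (by ring)

end IsTypicalSample

end QuadraticForm

/-! ### Covariance matrices and effective dimensions -/

section Covariance

variable {ι : Type*} [Fintype ι]

lemma mulVec_eq_smul_of_mulVec_mulVec_eq_smul {T : Matrix ι ι ℝ} (hT : T.PosSemidef) {s : ℝ}
    (hs : 0 < s) {v : ι → ℝ} (hv : T.mulVec (T.mulVec v) = (s * s) • v) : T.mulVec v = s • v := by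
  set w := T.mulVec v - s • v with hw
  have hTw : T.mulVec w = -(s • w) := by
    rw [hw, Matrix.mulVec_sub, hv, Matrix.mulVec_smul, smul_sub, smul_smul]
    abel
  have hTw_nonneg : 0 ≤ dotProduct w (T.mulVec w) := by simpa using hT.dotProduct_mulVec_nonneg w
  rw [hTw, dotProduct_neg, dotProduct_smul, smul_eq_mul] at hTw_nonneg
  have hw_nonneg : 0 ≤ dotProduct w w := by simpa using dotProduct_star_self_nonneg w
  have hw_zero : dotProduct w w = 0 := by nlinarith
  exact sub_eq_zero.1 (dotProduct_self_eq_zero.1 hw_zero)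

lemma dotProduct_mulVec_eq_directionalVariance (A : Matrix ι ι ℝ)
    (b : OrthonormalBasis ι ℝ (EuclideanSpace ℝ ι)) {e : ι → ℝ}
    (hA : ∀ j, A.mulVec (b j).ofLp = e j • (b j).ofLp) (x : EuclideanSpace ℝ ι) :
    dotProduct x.ofLp (A.mulVec x.ofLp) = directionalVariance b e x := by
  classical
  have hinner : dotProduct x.ofLp (A.mulVec x.ofLp) = ⟪x, A.toEuclideanLin x⟫ := by
    rw [EuclideanSpace.inner_eq_star_dotProduct, dotProduct_comm]
    simp
  have heigen : ∀ j, A.toEuclideanLin (b j) = e j • b j := fun j =>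
    WithLp.ofLp_injective 2 (by simpa using hA j)
  have himage : A.toEuclideanLin x = ∑ j, ⟪b j, x⟫ • e j • b j := by
    conv_lhs => rw [← b.sum_repr' x]
    simp only [map_sum, map_smul, heigen]
  rw [hinner, himage, inner_sum, directionalVariance]
  refine Finset.sum_congr rfl fun j _ => ?_
  rw [real_inner_smul_right, real_inner_smul_right, real_inner_comm]
  ring

variable [DecidableEq ι] {S : Matrix ι ι ℝ}

lemma sqrt_mulVec_eigenvectorBasis (hS : S.PosDef) (j : ι) :
    (CFC.sqrt S).mulVec (hS.isHermitian.eigenvectorBasis j).ofLp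
      = √(hS.isHermitian.eigenvalues j) • (hS.isHermitian.eigenvectorBasis j).ofLp := by
  refine mulVec_eq_smul_of_mulVec_mulVec_eq_smul
    (Matrix.nonneg_iff_posSemidef.1 (CFC.sqrt_nonneg S)) (Real.sqrt_pos.2 (hS.eigenvalues_pos j)) ?_
  rw [Matrix.mulVec_mulVec,
    CFC.sqrt_mul_sqrt_self S (Matrix.nonneg_iff_posSemidef.2 hS.posSemidef),
    Real.mul_self_sqrt (hS.eigenvalues_pos j).le]
  exact hS.isHermitian.mulVec_eigenvectorBasis j

lemma hasLaw_inner_multivariateGaussian {A : Matrix ι ι ℝ} (hA : A.PosSemidef)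
    (a : EuclideanSpace ℝ ι) :
    HasLaw (fun Z => ⟪a, Z⟫) (gaussianReal 0 (dotProduct a.ofLp (A.mulVec a.ofLp)).toNNReal)
      (multivariateGaussian 0 A) where
  aemeasurable := by fun_prop
  map_eq := by
    have hmean : (multivariateGaussian 0 A)[innerSL ℝ a] = 0 := by
      rw [(innerSL ℝ a).integral_comp_id_comm IsGaussian.integrable_id]
      simp
    have hvar : Var[innerSL ℝ a; multivariateGaussian 0 A]
        = dotProduct a.ofLp (A.mulVec a.ofLp) := by
      rw [← covarianceBilin_multivariateGaussian (μ := 0) hA,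
        covarianceBilin_self IsGaussian.memLp_two_id]
      rfl
    have hmap := IsGaussian.map_eq_gaussianReal (μ := multivariateGaussian 0 A) (innerSL ℝ a)
    rwa [hmean, hvar] at hmap

end Covariance

lemma IsSubgaussianVec.hasGaussianTail {d : ℕ} {Ω : Type*} [MeasurableSpace Ω] {P : Measure Ω}
    {S : Matrix (Fin d) (Fin d) ℝ} {a : Ω → Vec d} (ha : IsSubgaussianVec P S a)
    (b : OrthonormalBasis (Fin d) ℝ (Vec d)) {e : Fin d → ℝ}
    (hS : ∀ j, S.mulVec (b j).ofLp = e j • (b j).ofLp) (g : Vec d) :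
    HasGaussianTail (fun ω => ⟪a ω, g⟫) (directionalVariance b e g) P := by
  intro t ht
  rcases eq_or_ne g 0 with rfl | hg
  · simp only [inner_zero_right, abs_zero, ht.le.not_gt, Set.ofPred_false, measureReal_empty]
    positivity
  have hg0 : 0 < ‖g‖ := norm_pos_iff.2 hg
  have hunit := ha (t / ‖g‖) (by positivity) (‖g‖⁻¹ • g) (by
    rw [norm_smul, norm_inv, norm_norm, inv_mul_cancel₀ hg0.ne'])
  rw [dotProduct_mulVec_eq_directionalVariance S b hS, directionalVariance_smul, inv_pow,
    div_pow, inv_mul_eq_div, div_div_div_cancel_right₀ (by positivity)] at hunit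
  simpa only [real_inner_smul_right, inv_mul_eq_div, abs_div, abs_norm,
    div_lt_div_iff_of_pos_right hg0] using hunit

section EffectiveDimension

variable {d : ℕ} {S : Matrix (Fin d) (Fin d) ℝ}

/-- The square roots `σ_j` of the eigenvalues of `S`, in the order of its eigenbasis. -/
noncomputable def sigma (hS : S.IsHermitian) (j : Fin d) : ℝ := √(hS.eigenvalues j)

lemma sigma_pos (hS : S.PosDef) (j : Fin d) : 0 < sigma hS.isHermitian j :=
  Real.sqrt_pos.2 (hS.eigenvalues_pos j)

lemma sigma_sq (hS : S.PosDef) (j : Fin d) :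
    sigma hS.isHermitian j ^ 2 = hS.isHermitian.eigenvalues j :=
  Real.sq_sqrt (hS.eigenvalues_pos j).le

variable (hS : S.IsHermitian)

lemma sigma_nonneg (j : Fin d) : 0 ≤ sigma hS j := Real.sqrt_nonneg _

lemma sigmaOne_nonneg : 0 ≤ sigmaOne hS := Real.sqrt_nonneg _

lemma sigma_le_sigmaOne (j : Fin d) : sigma hS j ≤ sigmaOne hS :=
  Real.sqrt_le_sqrt (le_ciSup (Set.finite_range _).bddAbove j)

lemma exists_sigma_eq_sigmaOne [NeZero d] : ∃ j, sigma hS j = sigmaOne hS := by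
  obtain ⟨j, hj⟩ := exists_eq_ciSup_of_finite (f := hS.eigenvalues)
  exact ⟨j, by rw [sigma, sigmaOne, topEig, ← hj]⟩

lemma sigmaOne_pos [NeZero d] (hS : S.PosDef) : 0 < sigmaOne hS.isHermitian := by
  obtain ⟨j, hj⟩ := exists_sigma_eq_sigmaOne hS.isHermitian
  exact hj ▸ sigma_pos hS j

lemma sigma_div_sigmaOne_nonneg (j : Fin d) : 0 ≤ sigma hS j / sigmaOne hS :=
  div_nonneg (sigma_nonneg hS j) (sigmaOne_nonneg hS)

lemma sigma_div_sigmaOne_le_one (j : Fin d) : sigma hS j / sigmaOne hS ≤ 1 :=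
  div_le_one_of_le₀ (sigma_le_sigmaOne hS j) (sigmaOne_nonneg hS)

lemma sigmaOne_mul_sigma_div (j : Fin d) : sigmaOne hS * (sigma hS j / sigmaOne hS) = sigma hS j :=
  mul_div_cancel_of_imp' fun h => ((sigma_le_sigmaOne hS j).trans_eq h).antisymm (sigma_nonneg hS j)

lemma effDim_one : effDim hS 1 = ∑ j, (sigma hS j / sigmaOne hS) ^ 2 := by
  refine Finset.sum_congr rfl fun j _ => ?_
  rw [← Real.rpow_natCast, sigma]
  norm_num

lemma effDim_two : effDim hS 2 = ∑ j, sigma hS j / sigmaOne hS := by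
  refine Finset.sum_congr rfl fun j _ => ?_
  rw [sigma]
  norm_num

lemma effDim_nonneg (r : ℕ) : 0 ≤ effDim hS r :=
  Finset.sum_nonneg fun j _ => Real.rpow_nonneg (sigma_div_sigmaOne_nonneg hS j) _

lemma one_le_effDim_one [NeZero d] (h0 : 0 < sigmaOne hS) : 1 ≤ effDim hS 1 := by
  obtain ⟨j, hj⟩ := exists_sigma_eq_sigmaOne hS
  calc 1 = (sigma hS j / sigmaOne hS) ^ 2 := by rw [hj, div_self h0.ne', one_pow]
    _ ≤ ∑ j, (sigma hS j / sigmaOne hS) ^ 2 :=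
      Finset.single_le_sum (f := fun j => (sigma hS j / sigmaOne hS) ^ 2)
        (fun _ _ => sq_nonneg _) (Finset.mem_univ j)
    _ = effDim hS 1 := (effDim_one hS).symm

lemma effDim_one_le : effDim hS 1 ≤ d := by
  calc effDim hS 1 = ∑ j, (sigma hS j / sigmaOne hS) ^ 2 := effDim_one hS
    _ ≤ ∑ _j : Fin d, (1 : ℝ) := Finset.sum_le_sum fun j _ =>
      pow_le_one₀ (sigma_div_sigmaOne_nonneg hS j) (sigma_div_sigmaOne_le_one hS j)
    _ = d := by simp

lemma effDim_one_le_effDim_two : effDim hS 1 ≤ effDim hS 2 := by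
  rw [effDim_one hS, effDim_two hS]
  exact Finset.sum_le_sum fun j _ =>
    pow_le_of_le_one (sigma_div_sigmaOne_nonneg hS j) (sigma_div_sigmaOne_le_one hS j) two_ne_zero

lemma one_le_effDim_two_div_effDim_one [NeZero d] (h0 : 0 < sigmaOne hS) :
    1 ≤ effDim hS 2 / effDim hS 1 :=
  (one_le_div (one_pos.trans_le (one_le_effDim_one hS h0))).2 (effDim_one_le_effDim_two hS)

lemma sum_sigma : ∑ j, sigma hS j = sigmaOne hS * effDim hS 2 := by
  simp only [effDim_two, Finset.mul_sum, sigmaOne_mul_sigma_div]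

lemma sum_sigma_pow_three_le : ∑ j, sigma hS j ^ 3 ≤ sigmaOne hS ^ 3 * effDim hS 1 := by
  rw [effDim_one hS, Finset.mul_sum]
  refine Finset.sum_le_sum fun j _ => ?_
  calc sigma hS j ^ 3 = sigma hS j * sigma hS j ^ 2 := by ring
    _ ≤ sigmaOne hS * sigma hS j ^ 2 := by
      gcongr
      exact sigma_le_sigmaOne hS j
    _ = sigmaOne hS * (sigmaOne hS * (sigma hS j / sigmaOne hS)) ^ 2 := by
      rw [sigmaOne_mul_sigma_div]
    _ = sigmaOne hS ^ 3 * (sigma hS j / sigmaOne hS) ^ 2 := by ring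

end EffectiveDimension

/-! ### The step sizes -/

section StepSizes

lemma log_one_div_nonneg {δ : ℝ} (hδ : 0 < δ) (hδ1 : δ ≤ 1) : 0 ≤ Real.log (1 / δ) :=
  Real.log_nonneg ((one_le_div hδ).2 hδ1)

section LogFactor

variable (d : ℕ) {δ : ℝ} (hδ : 0 < δ)

include hδ

lemma one_le_logFactor (hδ1 : δ ≤ 1) : 1 ≤ logFactor d δ := by
  have hlogd := Real.log_natCast_nonneg d
  have hlogδ := log_one_div_nonneg hδ hδ1
  unfold logFactor
  linarith

lemma clog_add_one_le (hδ1 : δ ≤ 1) : (Nat.clog 2 d : ℝ) + 1 ≤ 2 * logFactor d δ := by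
  rcases le_or_gt d 1 with hd | hd
  · rw [Nat.clog_of_right_le_one hd]
    push_cast
    linarith [one_le_logFactor d hδ hδ1]
  have hpow : ((Nat.clog 2 d).pred : ℝ) * Real.log 2 ≤ Real.log d := by
    rw [← Real.log_pow]
    refine Real.log_le_log (by positivity) ?_
    exact_mod_cast (Nat.pow_pred_clog_lt_self one_lt_two hd).le
  have hpred : ((Nat.clog 2 d).pred : ℝ) + 1 = Nat.clog 2 d := by
    exact_mod_cast Nat.succ_pred_eq_of_pos (Nat.clog_pos one_lt_two hd)
  have hlogδ := log_one_div_nonneg hδ hδ1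
  unfold logFactor
  nlinarith [Real.log_two_gt_d9, (Nat.clog 2 d).pred.cast_nonneg (α := ℝ)]

lemma exp_neg_two_mul_logFactor [NeZero d] :
    Real.exp (-(2 * logFactor d δ)) = (Real.exp 1 ^ 2)⁻¹ * (δ / d) ^ 2 := by
  have hd : (0 : ℝ) < d := Nat.cast_pos.2 (NeZero.pos d)
  have hlog : 2 * logFactor d δ = (1 + 1) + (Real.log (d / δ) + Real.log (d / δ)) := by
    unfold logFactor
    rw [Real.log_div hd.ne' hδ.ne', Real.log_div one_ne_zero hδ.ne', Real.log_one]
    ring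
  rw [hlog, Real.exp_neg, Real.exp_add, Real.exp_add, Real.exp_add, Real.exp_log (by positivity)]
  field_simp

lemma clog_add_mul_exp_neg_logFactor_le [NeZero d] (hδ1 : δ ≤ 1) :
    ((Nat.clog 2 d : ℕ) + 3 * (d : ℝ)) * Real.exp (-(2 * logFactor d δ)) ≤ δ := by
  have hd : (1 : ℝ) ≤ d := Nat.one_le_cast.2 (NeZero.one_le (n := d))
  have hclog : (Nat.clog 2 d : ℝ) ≤ d := by
    exact_mod_cast Nat.clog_le_of_le_pow Nat.lt_two_pow_self.le
  have hexp : (4 : ℝ) ≤ Real.exp 1 ^ 2 := by nlinarith [Real.exp_one_gt_d9]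
  calc ((Nat.clog 2 d : ℕ) + 3 * (d : ℝ)) * Real.exp (-(2 * logFactor d δ))
      ≤ (d + 3 * d) * ((4 : ℝ)⁻¹ * (δ / d) ^ 2) := by
        rw [exp_neg_two_mul_logFactor d hδ]
        gcongr
    _ = δ * (δ / d) := by field_simp; ring
    _ ≤ δ * 1 := by
        gcongr
        rw [div_le_one (by linarith)]
        linarith
    _ = δ := mul_one δ

end LogFactor

lemma sqrt_eight_mul_le {Λ : ℝ} (hΛ : 1 ≤ Λ) : √(8 * Λ) ≤ 3 * Λ :=
  Real.sqrt_le_iff.2 ⟨by linarith, by nlinarith⟩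

variable {d : ℕ} {S : Matrix (Fin d) (Fin d) ℝ} (hS : S.IsHermitian) (n : ℕ) (δ : ℝ)

lemma one_le_sampleFactor : 1 ≤ sampleFactor hS n δ :=
  le_add_of_nonneg_right (Real.sqrt_nonneg _)

lemma sampleFactor_pos : 0 < sampleFactor hS n δ := one_pos.trans_le (one_le_sampleFactor hS n δ)

lemma modulus_nonneg {L B : ℝ} (hL : 0 ≤ L) (hB : 0 ≤ B) : 0 ≤ modulus hS n δ L B := by
  have hκ := sampleFactor_pos hS n δ
  have hd₁ := effDim_nonneg hS 1
  have hd₂ := effDim_nonneg hS 2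
  unfold modulus
  positivity

section PosDef

variable [NeZero d] (h0 : 0 < sigmaOne hS)

include h0

lemma radius_pos {R : ℝ} (hR : 0 < R) : 0 < radius hS n δ R := by
  have hκ := sampleFactor_pos hS n δ
  have hd₁ := one_pos.trans_le (one_le_effDim_one hS h0)
  have hd₂ := hd₁.trans_le (effDim_one_le_effDim_two hS)
  unfold radius
  positivity

lemma radius_eq (R : ℝ) : radius hS n δ R
    = R * √(sampleFactor hS n δ) * √(effDim hS 2 / √(effDim hS 1))
      / (√(sigmaOne hS) * √(effDim hS 1)) := by
  have hd₁ := one_pos.trans_le (one_le_effDim_one hS h0)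
  have hpow : effDim hS 1 ^ (3 / 4 : ℝ) = √√(effDim hS 1) * √(effDim hS 1) := by
    rw [Real.sqrt_eq_rpow, Real.sqrt_eq_rpow, ← Real.rpow_mul hd₁.le, ← Real.rpow_add hd₁]
    norm_num
  rw [radius, hpow, Real.sqrt_mul (effDim_nonneg hS 2), Real.sqrt_div (effDim_nonneg hS 2)]
  field_simp

lemma modulus_mul_sq_div_radius (L B R : ℝ) :
    modulus hS n δ L B * R ^ 2 / radius hS n δ R
      = B * (√(sampleFactor hS n δ)
        * (L * R * sigmaOne hS * √(effDim hS 2 / √(effDim hS 1)))) := by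
  have hκ := sampleFactor_pos hS n δ
  have hd₁ := one_pos.trans_le (one_le_effDim_one hS h0)
  have hd₂ := hd₁.trans_le (effDim_one_le_effDim_two hS)
  have hratio : effDim hS 2 / effDim hS 1
      = √(effDim hS 2 / √(effDim hS 1)) ^ 2 / √(effDim hS 1) := by
    rw [Real.sq_sqrt (by positivity), div_div, Real.mul_self_sqrt hd₁.le]
  have hX : 0 < √(effDim hS 2 / √(effDim hS 1)) := by positivity
  rw [modulus, radius_eq hS n δ h0, hratio]
  nth_rewrite 1 [← Real.sq_sqrt hκ.le]
  generalize √(effDim hS 2 / √(effDim hS 1)) = X at *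
  field_simp
  rw [Real.sq_sqrt h0.le]
  ring

lemma radius_mul_sqrt (R : ℝ) :
    radius hS n δ R * √(sigmaOne hS ^ 3 * effDim hS 1)
      = √(sampleFactor hS n δ) * (R * sigmaOne hS * √(effDim hS 2 / √(effDim hS 1))) := by
  have hd₁ := one_pos.trans_le (one_le_effDim_one hS h0)
  rw [radius_eq hS n δ h0, Real.sqrt_mul (by positivity), pow_succ, Real.sqrt_mul (by positivity),
    Real.sqrt_sq h0.le]
  field_simp

end PosDef

end StepSizes

section Curvature

variable {d n : ℕ} [NeZero n] {S : Matrix (Fin d) (Fin d) ℝ} (hS : S.IsHermitian) {δ : ℝ}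
  (hδ : 0 < δ) (hδ1 : δ ≤ 1)

include hδ hδ1

lemma effDim_one_div_le : effDim hS 1 / n ≤ 2 * sampleFactor hS n δ ^ 2 := by
  have hn : (1 : ℝ) ≤ n := Nat.one_le_cast.2 (NeZero.one_le (n := n))
  have hlogδ := log_one_div_nonneg hδ hδ1
  have hd₁ := effDim_nonneg hS 1
  set X := effDim hS 1 * Real.log d + Real.log (1 / δ)
  have hX0 : 0 ≤ X := add_nonneg (mul_nonneg hd₁ (Real.log_natCast_nonneg d)) hlogδ
  have heff : effDim hS 1 ≤ 2 * X + n := by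
    rcases le_or_gt d 1 with hd | hd
    · have : (d : ℝ) ≤ 1 := Nat.cast_le_one.2 hd
      linarith [effDim_one_le hS]
    · have hlog2 : 1 / 2 ≤ Real.log d := by
        have : Real.log 2 ≤ Real.log d := Real.log_le_log two_pos (Nat.ofNat_le_cast.2 hd)
        linarith [Real.log_two_gt_d9]
      nlinarith
  calc effDim hS 1 / n ≤ (2 * X + n) / n := by gcongr
    _ = 2 * √(X / n) ^ 2 + 1 := by
      rw [Real.sq_sqrt (by positivity)]
      field_simp
    _ ≤ 2 * sampleFactor hS n δ ^ 2 := by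
      rw [sampleFactor]
      nlinarith [Real.sqrt_nonneg (X / n)]

variable [NeZero d] (h0 : 0 < sigmaOne hS)

include h0

lemma curvature_radicand_le :
    sigmaOne hS * (2 + 2 * logFactor d δ) + 2 * (∑ j, sigma hS j) / n
      ≤ 8 * logFactor d δ
        * (sigmaOne hS * (effDim hS 2 / effDim hS 1 * sampleFactor hS n δ) ^ 2) := by
  have hΛ := one_le_logFactor d hδ hδ1
  have hκ := one_le_sampleFactor hS n δ
  have hρ := one_le_effDim_two_div_effDim_one hS h0
  have hd₁ := one_pos.trans_le (one_le_effDim_one hS h0)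
  have hdiv : effDim hS 2 / n ≤ 2 * (effDim hS 2 / effDim hS 1 * sampleFactor hS n δ) ^ 2 := by
    calc effDim hS 2 / n = effDim hS 2 / effDim hS 1 * (effDim hS 1 / n) := by field_simp
      _ ≤ (effDim hS 2 / effDim hS 1) ^ 2 * (2 * sampleFactor hS n δ ^ 2) := by
        gcongr
        · exact le_self_pow₀ hρ two_ne_zero
        · exact effDim_one_div_le hS hδ hδ1
      _ = 2 * (effDim hS 2 / effDim hS 1 * sampleFactor hS n δ) ^ 2 := by ring
  have hone : 1 ≤ (effDim hS 2 / effDim hS 1 * sampleFactor hS n δ) ^ 2 :=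
    one_le_pow₀ (one_le_mul_of_one_le_of_one_le hρ hκ)
  calc sigmaOne hS * (2 + 2 * logFactor d δ) + 2 * (∑ j, sigma hS j) / n
      = sigmaOne hS * (2 + 2 * logFactor d δ + 2 * (effDim hS 2 / n)) := by
        rw [sum_sigma]
        ring
    _ ≤ sigmaOne hS * (8 * logFactor d δ
          * (effDim hS 2 / effDim hS 1 * sampleFactor hS n δ) ^ 2) := by
        gcongr
        nlinarith
    _ = _ := by ring

lemma curvature_le_modulus {L : ℝ} (hL : 0 ≤ L) :
    4 * L * (4 * ((Nat.clog 2 d : ℕ) + 1 : ℝ) ^ 2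
      * √(sigmaOne hS * (2 + 2 * logFactor d δ) + 2 * (∑ j, sigma hS j) / n))
      ≤ modulus hS n δ L (192 * logFactor d δ ^ 3) := by
  have hΛ := one_le_logFactor d hδ hδ1
  have hκ := one_le_sampleFactor hS n δ
  have hρ := one_le_effDim_two_div_effDim_one hS h0
  have hsqrt : √(sigmaOne hS * (2 + 2 * logFactor d δ) + 2 * (∑ j, sigma hS j) / n)
      ≤ 3 * logFactor d δ
        * (√(sigmaOne hS) * (effDim hS 2 / effDim hS 1 * sampleFactor hS n δ)) := by
    refine (Real.sqrt_le_sqrt (curvature_radicand_le hS hδ hδ1 h0)).trans ?_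
    rw [Real.sqrt_mul (by positivity), Real.sqrt_mul h0.le, Real.sqrt_sq (by positivity)]
    gcongr
    exact sqrt_eight_mul_le hΛ
  calc _ ≤ 4 * L * (4 * (2 * logFactor d δ) ^ 2 * (3 * logFactor d δ
        * (√(sigmaOne hS) * (effDim hS 2 / effDim hS 1 * sampleFactor hS n δ)))) := by
        gcongr
        exact clog_add_one_le d hδ hδ1
    _ = modulus hS n δ L (192 * logFactor d δ ^ 3) := by
        rw [modulus]
        ring

end Curvature

/-! ### Typical data -/

section TypicalData

variable {d n : ℕ} {S : Matrix (Fin d) (Fin d) ℝ}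

/-- The event of probability at least `1 - δ` on which the convergence rate holds: the data are a
typical sample in the eigenbasis of `S`. The number of dyadic blocks of eigenvalues, `⌈log₂ d⌉`, is
such that the eigenvalues left out are smaller than the largest one by a factor `d²`. -/
def IsTypicalData (hS : S.IsHermitian) (δ : ℝ) (a : Fin n → Vec d) : Prop :=
  IsTypicalSample hS.eigenvectorBasis (sigma hS) (sigmaOne hS) (2 * logFactor d δ) (Nat.clog 2 d) a

lemma measurableSet_isTypicalData (hS : S.IsHermitian) (δ : ℝ) {Ω : Type*} [MeasurableSpace Ω]
    {a : Fin n → Ω → Vec d} (ha : ∀ i, Measurable (a i)) :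
    MeasurableSet {ω | IsTypicalData hS δ fun i => a i ω} :=
  measurableSet_isTypicalSample ha _ _ _

lemma one_sub_le_measureReal_isTypicalData [NeZero d] [NeZero n] (hS : S.PosDef) {Ω : Type*}
    [MeasurableSpace Ω] {P : Measure Ω} [IsProbabilityMeasure P] {a : Fin n → Ω → Vec d}
    (ha : ∀ i, Measurable (a i)) (hind : iIndepFun a P) (hsub : ∀ i, IsSubgaussianVec P S (a i))
    {δ : ℝ} (hδ : 0 < δ) (hδ1 : δ ≤ 1) :
    1 - δ ≤ P.real {ω | IsTypicalData hS.isHermitian δ fun i => a i ω} := by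
  have heigen : ∀ j, S.mulVec (hS.isHermitian.eigenvectorBasis j).ofLp
      = (sigma hS.isHermitian ^ 2) j • (hS.isHermitian.eigenvectorBasis j).ofLp := fun j => by
    rw [Pi.pow_apply, sigma_sq hS]
    exact hS.isHermitian.mulVec_eigenvectorBasis j
  have htypical := one_sub_le_measureReal_isTypicalSample ha hind (sigma_pos hS)
    (fun i => (hsub i).hasGaussianTail _ heigen) (sigma_le_sigmaOne _) (sigmaOne_pos hS)
    (2 * logFactor d δ) (Nat.clog 2 d)
  rw [Fintype.card_fin] at htypical
  exact (sub_le_sub_left (clog_add_mul_exp_neg_logFactor_le d hδ hδ1) 1).trans htypical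

/-- The variance of `⟪x, Z⟫` for `Z` with law `N(0, √S)`. -/
noncomputable def smoothingVariance (hS : S.IsHermitian) (x : Vec d) : ℝ≥0 :=
  (directionalVariance hS.eigenvectorBasis (sigma hS) x).toNNReal

lemma coe_smoothingVariance (hS : S.IsHermitian) (x : Vec d) :
    (smoothingVariance hS x : ℝ) = directionalVariance hS.eigenvectorBasis (sigma hS) x :=
  Real.coe_toNNReal _ (directionalVariance_nonneg (sigma_nonneg hS) x)

lemma eq_zero_of_smoothingVariance_eq_zero (hS : S.PosDef) {x : Vec d}
    (hx : smoothingVariance hS.isHermitian x = 0) : x = 0 := by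
  by_contra hne
  exact (directionalVariance_pos (sigma_pos hS) hne).not_ge (Real.toNNReal_eq_zero.1 hx)

lemma hasLaw_inner_smoothingVariance (hS : S.PosDef) (x : Vec d) :
    HasLaw (fun Z => ⟪x, Z⟫) (gaussianReal 0 (smoothingVariance hS.isHermitian x))
      (multivariateGaussian 0 (CFC.sqrt S)) := by
  have heigen : ∀ j, (CFC.sqrt S).mulVec (hS.isHermitian.eigenvectorBasis j).ofLp
      = sigma hS.isHermitian j • (hS.isHermitian.eigenvectorBasis j).ofLp :=
    sqrt_mulVec_eigenvectorBasis hS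
  rw [smoothingVariance, ← dotProduct_mulVec_eq_directionalVariance (CFC.sqrt S) _ heigen]
  exact hasLaw_inner_multivariateGaussian (Matrix.nonneg_iff_posSemidef.1 (CFC.sqrt_nonneg S)) x

namespace IsTypicalData

variable (hS : S.PosDef) {δ : ℝ} {a : Fin n → Vec d} (ha : IsTypicalData hS.isHermitian δ a)
  (hδ : 0 < δ) (hδ1 : δ ≤ 1)

include ha

lemma radius_mul_average_sqrt_le [NeZero d] (hΛ : 1 ≤ logFactor d δ) {R : ℝ} (hR : 0 < R) :
    radius hS.isHermitian n δ R
        * ((1 / (n : ℝ)) * ∑ i, √(smoothingVariance hS.isHermitian (a i)))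
      ≤ 3 * logFactor d δ ^ 3 * (√(sampleFactor hS.isHermitian n δ) * (R * sigmaOne hS.isHermitian
        * √(effDim hS.isHermitian 2 / √(effDim hS.isHermitian 1)))) := by
  simp only [coe_smoothingVariance]
  have hr := radius_pos hS.isHermitian n δ (sigmaOne_pos hS) hR
  rw [← radius_mul_sqrt hS.isHermitian n δ (sigmaOne_pos hS),
    mul_left_comm (3 * logFactor d δ ^ 3)]
  refine mul_le_mul_of_nonneg_left ?_ hr.le
  calc (1 / (n : ℝ)) * ∑ i, √(directionalVariance hS.isHermitian.eigenvectorBasis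
        (sigma hS.isHermitian) (a i))
      ≤ √(4 * (2 * logFactor d δ) * ∑ j, sigma hS.isHermitian j ^ 3) :=
        ha.average_sqrt_directionalVariance_le (sigma_pos hS)
    _ ≤ √(8 * logFactor d δ * (sigmaOne hS.isHermitian ^ 3 * effDim hS.isHermitian 1)) := by
        rw [← mul_assoc]
        norm_num only
        gcongr
        exact sum_sigma_pow_three_le hS.isHermitian
    _ = √(8 * logFactor d δ) * √(sigmaOne hS.isHermitian ^ 3 * effDim hS.isHermitian 1) :=
        Real.sqrt_mul (by positivity) _
    _ ≤ 3 * logFactor d δ ^ 3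
          * √(sigmaOne hS.isHermitian ^ 3 * effDim hS.isHermitian 1) := by
        gcongr
        exact (sqrt_eight_mul_le hΛ).trans (by linarith [le_self_pow₀ hΛ three_ne_zero])

include hδ hδ1

lemma average_inner_sq_div_le [NeZero d] [NeZero n] (h : Vec d) :
    (1 / (n : ℝ)) * ∑ i, ⟪a i, h⟫ ^ 2 / √(smoothingVariance hS.isHermitian (a i))
      ≤ 4 * ((Nat.clog 2 d : ℕ) + 1 : ℝ) ^ 2 * √(sigmaOne hS.isHermitian
        * (2 + 2 * logFactor d δ) + 2 * (∑ j, sigma hS.isHermitian j) / n) * ‖h‖ ^ 2 := by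
  simp only [coe_smoothingVariance]
  exact IsTypicalSample.average_inner_sq_div_le ha (sigma_pos hS) (sigma_le_sigmaOne _)
    (sigmaOne_pos hS) (by linarith [one_le_logFactor d hδ hδ1])
    (by simpa using Nat.le_pow_clog one_lt_two d) h

variable [NeZero d] [NeZero n] {loss : Fin n → ℝ → ℝ} {K K₀ : ℝ≥0} {R : ℝ} {D : Set (Vec d)}
  {ψ : Vec d → ℝ} {m : ℕ} {u Ls η : ℕ → ℝ} {w : Vec d} {Ω : Type*} [MeasurableSpace Ω]
  {Q : Measure Ω} [IsProbabilityMeasure Q]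
  (hs : IsStepSchedule (radius hS.isHermitian n δ R)
    (modulus hS.isHermitian n δ K (192 * logFactor d δ ^ 3)) (K₀ / (R * √m)) u Ls η)
  (hR : 0 < R) (hK₀ : 0 < K₀) (hl : ∀ i, LipschitzWith K (loss i))
  (hc : ∀ i, ConvexOn ℝ Set.univ (loss i)) (hD : D ⊆ Metric.closedBall 0 R)
  (hψ : ConvexOn ℝ D ψ) (hψm : Measurable fun v : D => ψ v) (hw : w ∈ D)
  (hmin : IsMinOn (fun v => empRisk loss a v + ψ v) D w)
  (hl₀ : ∀ i, LipschitzWith K₀ (linLoss loss a i)) (hm : 1 ≤ m)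
  (run : Run (multivariateGaussian 0 (CFC.sqrt S)) (linLoss loss a) D ψ m u Ls η Q)

include hs hR hK₀ hl hc hD hψ hψm hw hmin hl₀ hm

lemma integrable_gap {T : ℕ} (hT : 1 ≤ T) :
    Integrable (fun ω => empRisk loss a (run.x T ω) + ψ (run.x T ω)
      - empRisk loss a w - ψ w) Q := by
  obtain ⟨t, rfl⟩ := Nat.exists_eq_add_of_le' hT
  have hΛ := one_le_logFactor d hδ hδ1
  exact run.integrable_gap hψ hl hc (fun i => hasLaw_inner_smoothingVariance hS (a i))
    (fun i => eq_zero_of_smoothingVariance_eq_zero hS) (ha.average_inner_sq_div_le hS hδ hδ1) hs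
    (radius_pos _ n δ (sigmaOne_pos hS) hR)
    (modulus_nonneg _ n δ K.coe_nonneg (by positivity))
    (curvature_le_modulus _ hδ hδ1 (sigmaOne_pos hS) K.coe_nonneg) (by positivity) hw hψm hl₀ hm
    hR.le hD hmin t

theorem integral_gap_le {T : ℕ} (hT : 1 ≤ T) :
    ∫ ω, (empRisk loss a (run.x T ω) + ψ (run.x T ω) - empRisk loss a w - ψ w) ∂Q
      ≤ 396 * logFactor d δ ^ 3 * √(sampleFactor hS.isHermitian n δ)
          * (K * R * sigmaOne hS.isHermitian
            * √(effDim hS.isHermitian 2 / √(effDim hS.isHermitian 1)) / T)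
        + 5 * K₀ * R / √((T : ℝ) * m) := by
  have hΛ := one_le_logFactor d hδ hδ1
  have hm0 : (0 : ℝ) < m := Nat.cast_pos.2 hm
  have hT0 : (0 : ℝ) < T := Nat.cast_pos.2 hT
  have hsmooth := modulus_mul_sq_div_radius hS.isHermitian n δ (sigmaOne_pos hS) K
    (192 * logFactor d δ ^ 3) R
  refine (run.integral_gap_le hψ hl hc (fun i => hasLaw_inner_smoothingVariance hS (a i))
    (fun i => eq_zero_of_smoothingVariance_eq_zero hS) (ha.average_inner_sq_div_le hS hδ hδ1) hs
    (radius_pos _ n δ (sigmaOne_pos hS) hR)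
    (modulus_nonneg _ n δ K.coe_nonneg (by positivity))
    (curvature_le_modulus _ hδ hδ1 (sigmaOne_pos hS) K.coe_nonneg) (by positivity) hw hψm hl₀ hm
    hR.le hD hmin hT).trans ?_
  rw [hsmooth, mul_left_comm (radius hS.isHermitian n δ R)]
  have hnoise : 2 * (K₀ / (R * √m) * R ^ 2 + K₀ ^ 2 / (m * (K₀ / (R * √m)))) / √(T : ℝ)
      ≤ 5 * K₀ * R / √((T : ℝ) * m) := by
    calc 2 * (K₀ / (R * √m) * R ^ 2 + K₀ ^ 2 / (m * (K₀ / (R * √m)))) / √(T : ℝ)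
        = 4 * K₀ * R / √((T : ℝ) * m) := by
          rw [Real.sqrt_mul hT0.le]
          nth_rewrite 2 [← Real.sq_sqrt hm0.le]
          field_simp
          ring
      _ ≤ 5 * K₀ * R / √((T : ℝ) * m) := by
          gcongr
          norm_num
  have hbias := div_le_div_of_nonneg_right (mul_le_mul_of_nonneg_left (mul_le_mul_of_nonneg_left
    (ha.radius_mul_average_sqrt_le hS hΛ hR) K.coe_nonneg) zero_le_four) hT0.le
  exact add_le_add ((add_le_add_right hbias _).trans_eq (by ring)) hnoise

end IsTypicalData

end TypicalData

end NonIsoSmoothing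

theorem mainTheorem9 :
    ∃ c C : ℝ, ∃ p : ℕ, 0 < c ∧ 0 < C ∧
    ∀ (d n : ℕ), 1 ≤ d → 1 ≤ n →
    ∀ (S : Matrix (Fin d) (Fin d) ℝ) (hS : S.PosDef)
      (Ω : Type*) [MeasurableSpace Ω] (P : Measure Ω) [IsProbabilityMeasure P]
      (a : Fin n → Ω → NonIsoSmoothing.Vec d),
      (∀ i, Measurable (a i)) → iIndepFun a P →
      (∀ i, NonIsoSmoothing.IsSubgaussianVec P S (a i)) →
    ∀ δ : ℝ, 0 < δ → δ < 1 →
    -- the good event, which depends on the data only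
    ∃ G : Set Ω, MeasurableSet G ∧ 1 - δ ≤ P.real G ∧ ∀ ω ∈ G,
    ∀ (L R : ℝ), 0 < L → 0 < R →
    -- convex `L`-Lipschitz losses
    ∀ loss : Fin n → ℝ → ℝ,
      (∀ i, ConvexOn ℝ Set.univ (loss i)) →
      (∀ i s t, |loss i s - loss i t| ≤ L * |s - t|) →
    -- convex regularizer with domain in the ball of radius `R`
    ∀ (D : Set (NonIsoSmoothing.Vec d)) (ψ : NonIsoSmoothing.Vec d → ℝ),
      D ⊆ Metric.closedBall 0 R → ConvexOn ℝ D ψ → Measurable (fun v : D => ψ v) →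
    -- a minimizer of the objective
    ∀ xstar ∈ D,
      IsMinOn (fun v => NonIsoSmoothing.empRisk loss (fun i => a i ω) v + ψ v) D xstar →
    -- a Lipschitz constant of the individual losses
    ∀ L₀ : ℝ, 0 < L₀ →
      (∀ i v w, |NonIsoSmoothing.linLoss loss (fun i => a i ω) i v
        - NonIsoSmoothing.linLoss loss (fun i => a i ω) i w| ≤ L₀ * ‖v - w‖) →
    ∀ m : ℕ, 1 ≤ m →
    -- the step sizes
    ∀ (u Ls η : ℕ → ℝ),
      (∀ t, u t = NonIsoSmoothing.theta t * NonIsoSmoothing.radius hS.isHermitian n δ R) →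
      (∀ t, Ls t = NonIsoSmoothing.modulus hS.isHermitian n δ L
        (c * NonIsoSmoothing.logFactor d δ ^ p) / u t) →
      (∀ t : ℕ, η t = L₀ * √((t : ℝ) + 1) / (R * √(m : ℝ))) →
    -- a run of the algorithm with smoothing distribution `N(0, √S)`
    ∀ (Ω' : Type*) [MeasurableSpace Ω'] (Q : Measure Ω') [IsProbabilityMeasure Q]
      (run : NonIsoSmoothing.Run (multivariateGaussian 0 (CFC.sqrt S))
        (NonIsoSmoothing.linLoss loss (fun i => a i ω)) D ψ m u Ls η Q),
    ∀ T : ℕ, 1 ≤ T →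
      Integrable (fun ω' => NonIsoSmoothing.empRisk loss (fun i => a i ω) (run.x T ω')
        + ψ (run.x T ω')
        - NonIsoSmoothing.empRisk loss (fun i => a i ω) xstar - ψ xstar) Q ∧
      ∫ ω', (NonIsoSmoothing.empRisk loss (fun i => a i ω) (run.x T ω')
        + ψ (run.x T ω')
        - NonIsoSmoothing.empRisk loss (fun i => a i ω) xstar - ψ xstar) ∂Q
      ≤ C * NonIsoSmoothing.logFactor d δ ^ p * √(NonIsoSmoothing.sampleFactor hS.isHermitian n δ)
          * (L * R * NonIsoSmoothing.sigmaOne hS.isHermitian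
            * √(NonIsoSmoothing.effDim hS.isHermitian 2
                / √(NonIsoSmoothing.effDim hS.isHermitian 1)) / T)
        + 5 * L₀ * R / √((T : ℝ) * m) := by
  refine ⟨192, 396, 3, by norm_num, by norm_num, ?_⟩
  intro d n hd hn S hS Ω _ P _ a ha hind hsub δ hδ hδ1
  have : NeZero d := ⟨by omega⟩
  have : NeZero n := ⟨by omega⟩
  refine ⟨{ω | NonIsoSmoothing.IsTypicalData hS.isHermitian δ fun i => a i ω},
    NonIsoSmoothing.measurableSet_isTypicalData hS.isHermitian δ ha,
    NonIsoSmoothing.one_sub_le_measureReal_isTypicalData hS ha hind hsub hδ hδ1.le, ?_⟩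
  intro ω hω L R hL hR loss hc hl D ψ hD hψ hψm xstar hx hmin L₀ hL₀ hl₀ m hm u Ls η hu hLs hη
    Ω' _ Q _ run T hT
  lift L to NNReal using hL.le
  lift L₀ to NNReal using hL₀.le
  have hlip : ∀ i, LipschitzWith L (loss i) := fun i => LipschitzWith.of_dist_le_mul (hl i)
  have hlip₀ : ∀ i, LipschitzWith L₀ (NonIsoSmoothing.linLoss loss (fun i => a i ω) i) :=
    fun i => LipschitzWith.of_dist_le_mul fun v w => by
      simpa only [dist_eq_norm, Real.norm_eq_abs] using hl₀ i v w
  have hs : NonIsoSmoothing.IsStepSchedule (NonIsoSmoothing.radius hS.isHermitian n δ R)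
      (NonIsoSmoothing.modulus hS.isHermitian n δ L (192 * NonIsoSmoothing.logFactor d δ ^ 3))
      (L₀ / (R * √(m : ℝ))) u Ls η :=
    ⟨hu, hLs, fun t => (hη t).trans (by ring)⟩
  have hL₀' : 0 < L₀ := hL₀
  exact ⟨hω.integrable_gap hS hδ hδ1.le hs hR hL₀' hlip hc hD hψ hψm hx hmin hlip₀ hm run hT,
    hω.integral_gap_le hS hδ hδ1.le hs hR hL₀' hlip hc hD hψ hψm hx hmin hlip₀ hm run hT⟩
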